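/- Equip every tensor power $(\mathbb C^2)^{\otimes N}$ with the standard inner product, with the action of $SL(2,\mathbb C)$ by $g\otimes\cdots\otimes g$ and with the action of $\mathfrak S_N$ by permutation of the factors, and let $\mathfrak S_N\subset\mathfrak S_{N+2}$ be the subgroup fixing $N+1$ and $N+2$. A Schur–Weyl embedding is an isometric linear map $(\mathbb C^2)^{\otimes N}\hookrightarrow(\mathbb C^2)^{\otimes(N+2)}$ equivariant under $\mathfrak S_N\times SL(2,\mathbb C)$. It is called real if its matrix in the standard tensor bases has real entries. For a Young diagram $\lambda=(\lambda_1,\lambda_2)$ with $N$ cells and at most two rows, the $\lambda$-component of $(\mathbb C^2)^{\otimes N}$ is the summand $\pi_\lambda\otimes\rho_\lambda$ of its Schur–Weyl decomposition, i.e. the isotypic component of the irreducible $SL(2,\mathbb C)$-module of dimension $\lambda_1-\lambda_2+1$. A pair $(\lambda,\mu)$ of diagrams with $N$ and $N+2$ cells and at most two rows is nice if $\mu$ is obtained from $\lambda$ by adding one cell to each row. Its multiplicity space $H(\lambda,\mu)$ is the complex Hilbert space in which the paths $t=(\lambda\to\nu\to\mu)$ in the Young graph form an orthonormal basis. A path is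 called $t_{21}$ if the cell added first lies in the second row, and $t_{12}$ if it lies in the first row. The pair is exceptional if $\lambda_1=\lambda_2$. **Proposition.** Let $n\ge 0$, and let $N\ge 0$ with $N=2n-1$ or $N=2n$. 1. The space $H(\lambda,\mu)$ is two-dimensional for every non-exceptional nice pair and one-dimensional for an exceptional one. There are exactly $n$ non-exceptional nice pairs, one for each value $\lambda_2=n-k$, $k=1,\dots,n$. There is no exceptional pair if $N=2n-1$, and exactly one if $N=2n$. 2. For all nice pairs $(\lambda,\mu)$ and all paths $t=(\lambda\to\nu\to\mu)$ there are real $\mathfrak S_N\times SL(2,\mathbb C)$-equivariant linear maps $E_{\lambda,t}:(\mathbb C^2)^{\otimes N}\to(\mathbb C^2)^{\otimes(N+2)}$ such that $E_{\lambda,t}$ is isometric on the $\lambda$-component, vanishes on all the other components, and maps the $\lambda$-component into the intersection of the $\mu$-component of $(\mathbb C^2)^{\otimes(N+2)}$ with the subspace $(\nu\text{-component of }(\mathbb C^2)^{\otimes(N+1)})\otimes\mathbb C^2$, and such that the following holds. (a) The map $(h_\lambda)_\lambda\mapsto\sum_\lambda\sum_t h_\lambda(t)\,E_{\lambda,t}$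 is a bijection from the set of families of unit vectors $h_\lambda\in H(\lambda,\mu)$, one for each nice pair $(\lambda,\mu)$, onto the set of all Schur–Weyl embeddings. (b) Let $\mathbb T^1=\{z\in\mathbb C:|z|=1\}$, and let $\lambda^{(k)}$ be the diagram with $N$ cells, at most two rows and $\lambda^{(k)}_2=n-k$. If $N=2n-1$, then $(z_1,\dots,z_n)\mapsto\sum_{k=1}^n\bigl(\operatorname{Re}z_k\,E_{\lambda^{(k)},t_{21}}+\operatorname{Im}z_k\,E_{\lambda^{(k)},t_{12}}\bigr)$ is a bijection from $(\mathbb T^1)^n$ onto the set of real Schur–Weyl embeddings. (c) If $N=2n$, then $(z_1,\dots,z_n,s)\mapsto\sum_{k=1}^n\bigl(\operatorname{Re}z_k\,E_{\lambda^{(k)},t_{21}}+\operatorname{Im}z_k\,E_{\lambda^{(k)},t_{12}}\bigr)+s\,E_{(n,n),t}$, where $t$ is the only path from $(n,n)$ to $(n+1,n+1)$, is a bijection from $(\mathbb T^1)^n\times\{1,-1\}$ onto the set of real Schur–Weyl embeddings. -/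

import Mathlib

open scoped TensorProduct

noncomputable section

namespace SchurWeyl

/-! ### The tensor powers of `ℂ²` and the two group actions -/

/-- The tensor power `(ℂ²)^{⊗N}`. -/
abbrev TensorPow (N : ℕ) : Type := ⨂[ℂ] _ : Fin N, (Fin 2 → ℂ)

/-- The standard basis `e_{i₁} ⊗ ⋯ ⊗ e_{i_N}` of `(ℂ²)^{⊗N}`. -/
def stdBasis (N : ℕ) : Module.Basis (Fin N → Fin 2) ℂ (TensorPow N) :=
  Basis.piTensorProduct fun _ => Pi.basisFun ℂ (Fin 2)

/-- The standard inner product of `(ℂ²)^{⊗N}` (antilinear in the first variable), for which the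
standard basis is orthonormal. -/
def tensorInner {N : ℕ} (x y : TensorPow N) : ℂ :=
  ∑ i, star ((stdBasis N).repr x i) * (stdBasis N).repr y i

/-- On simple tensors, the inner product is the product of the inner products of `ℂ²`. -/
theorem tensorInner_tprod {N : ℕ} (u v : Fin N → Fin 2 → ℂ) :
    tensorInner (PiTensorProduct.tprod ℂ u) (PiTensorProduct.tprod ℂ v) =
      ∏ i, ∑ a, star (u i a) * v i a := by
  simp only [tensorInner, stdBasis, Basis.piTensorProduct_repr_tprod_apply, Pi.basisFun_repr,
    star_prod, ← Finset.prod_mul_distrib]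
  rw [Finset.prod_univ_sum]
  simp

/-- The action of `SL(2, ℂ)` on the first `k` tensor factors of `(ℂ²)^{⊗N}`, by
`g ⊗ ⋯ ⊗ g ⊗ 1 ⊗ ⋯ ⊗ 1`. -/
def slRepFirst (k N : ℕ) :
    Representation ℂ (Matrix.SpecialLinearGroup (Fin 2) ℂ) (TensorPow N) where
  toFun g := PiTensorProduct.map fun i : Fin N =>
    if (i : ℕ) < k then Matrix.toLin' (g : Matrix (Fin 2) (Fin 2) ℂ) else LinearMap.id
  map_one' := by
    rw [← PiTensorProduct.map_one]
    congr 1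
    funext i
    split_ifs
    · simp
      rfl
    · rfl
  map_mul' g h := by
    rw [← PiTensorProduct.map_mul]
    congr 1
    funext i
    split_ifs
    · simp [Matrix.toLin'_mul]
      rfl
    · rfl

/-- The diagonal action `g ⊗ ⋯ ⊗ g` of `SL(2, ℂ)` on `(ℂ²)^{⊗N}`. -/
def slRep (N : ℕ) : Representation ℂ (Matrix.SpecialLinearGroup (Fin 2) ℂ) (TensorPow N) where
  toFun g := PiTensorProduct.map fun _ => Matrix.toLin' (g : Matrix (Fin 2) (Fin 2) ℂ)
  map_one' := by
    rw [← PiTensorProduct.map_one]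
    congr 1
    funext i
    simp
    rfl
  map_mul' g h := by
    rw [← PiTensorProduct.map_mul]
    congr 1
    funext i
    simp [Matrix.toLin'_mul]
    rfl

/-- The action of the symmetric group `𝔖_N` on `(ℂ²)^{⊗N}` by permutation of the factors. -/
def permAct {N : ℕ} (σ : Equiv.Perm (Fin N)) : TensorPow N →ₗ[ℂ] TensorPow N :=
  (PiTensorProduct.reindex ℂ (fun _ : Fin N => Fin 2 → ℂ) σ).toLinearMap

/-- The standard embedding `𝔖_N ⊂ 𝔖_{N+2}`: the last two points are fixed. -/
def permExtend {N : ℕ} (σ : Equiv.Perm (Fin N)) : Equiv.Perm (Fin (N + 2)) :=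
  finSumFinEquiv.permCongr (Equiv.sumCongr σ (Equiv.refl (Fin 2)))

/-- Equivariance of a linear map `(ℂ²)^{⊗N} → (ℂ²)^{⊗(N+2)}` under `𝔖_N × SL(2, ℂ)`. -/
def IsEquivariant {N : ℕ} (f : TensorPow N →ₗ[ℂ] TensorPow (N + 2)) : Prop :=
  (∀ (σ : Equiv.Perm (Fin N)) (x : TensorPow N),
      f (permAct σ x) = permAct (permExtend σ) (f x)) ∧
    ∀ (g : Matrix.SpecialLinearGroup (Fin 2) ℂ) (x : TensorPow N),
      f (slRep N g x) = slRep (N + 2) g (f x)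

/-- A Schur--Weyl embedding `(ℂ²)^{⊗N} ↪ (ℂ²)^{⊗(N+2)}`: an isometric linear map that is
equivariant under `𝔖_N × SL(2, ℂ)`. -/
def IsSchurWeylEmbedding {N : ℕ} (f : TensorPow N →ₗ[ℂ] TensorPow (N + 2)) : Prop :=
  (∀ x y, tensorInner (f x) (f y) = tensorInner x y) ∧ IsEquivariant f

/-- A linear map is real if all its matrix entries in the standard bases are real. -/
def IsRealMap {N M : ℕ} (f : TensorPow N →ₗ[ℂ] TensorPow M) : Prop :=
  ∀ i j, ((stdBasis M).repr (f (stdBasis N j)) i).im = 0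

/-! ### Isotypic components -/

/-- The sum of all irreducible `d`-dimensional subrepresentations. (As `SL(2, ℂ)` has, up to
isomorphism, one irreducible polynomial representation `M_d` of each dimension `d`, for the
representations above it is the `M_d`-isotypic component.) -/
def isotypicOfDim {V : Type} [AddCommGroup V] [Module ℂ V]
    (ρ : Representation ℂ (Matrix.SpecialLinearGroup (Fin 2) ℂ) V) (d : ℕ) : Submodule ℂ V :=
  ⨆ (W : Subrepresentation ρ)
    (_ : W.toRepresentation.IsIrreducible ∧ Module.finrank ℂ W.toSubmodule = d), W.toSubmodule

/-- The component `π_μ ⊗ ρ_μ` of the Schur--Weyl decomposition of `(ℂ²)^{⊗N}` indexed by a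
diagram `μ` with `N` cells and at most two rows; here `ρ_μ` restricted to `SL(2, ℂ)` is
irreducible of dimension `μ₁ - μ₂ + 1`. -/
def component (N : ℕ) (μ : YoungDiagram) : Submodule ℂ (TensorPow N) :=
  isotypicOfDim (slRep N) (μ.rowLen 0 - μ.rowLen 1 + 1)

/-- For a diagram `ν` with `k ≤ N` cells and at most two rows, the subspace
`(π_ν ⊗ ρ_ν) ⊗ (ℂ²)^{⊗(N-k)}` of `(ℂ²)^{⊗k} ⊗ (ℂ²)^{⊗(N-k)} = (ℂ²)^{⊗N}`. -/
def componentFirst (k N : ℕ) (ν : YoungDiagram) : Submodule ℂ (TensorPow N) :=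
  isotypicOfDim (slRepFirst k N) (ν.rowLen 0 - ν.rowLen 1 + 1)

/-! ### Nice pairs of diagrams and their multiplicity spaces -/

/-- A nice pair `(lam, mu)`: diagrams with `N` and `N + 2` cells and at most two rows each, such
that `mu` is obtained from `lam` by adding one cell to each row. -/
@[ext]
structure NicePair (N : ℕ) where
  lam : YoungDiagram
  mu : YoungDiagram
  card_lam : lam.card = N
  card_mu : mu.card = N + 2
  rows_lam : lam.colLen 0 ≤ 2
  rows_mu : mu.colLen 0 ≤ 2
  le : lam ≤ mu
  row_zero : mu.rowLen 0 = lam.rowLen 0 + 1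
  row_one : mu.rowLen 1 = lam.rowLen 1 + 1

/-- The set `𝒯(lam, mu)` of paths `lam → ν → mu` in the Young graph; such a path is given by the
intermediate diagram `ν`, which has `N + 1` cells. -/
def NicePair.Path {N : ℕ} (p : NicePair N) : Type :=
  {ν : YoungDiagram // p.lam ≤ ν ∧ ν ≤ p.mu ∧ ν.card = N + 1}

/-- The pair is exceptional if `lam = (m, m)`, `mu = (m + 1, m + 1)` for some `m`. -/
def NicePair.IsExceptional {N : ℕ} (p : NicePair N) : Prop :=
  p.lam.rowLen 0 = p.lam.rowLen 1

/-- The path is `t₂₁`: the cell added first is in the second row, the other one in the first row.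
(Otherwise it is `t₁₂`.) -/
def NicePair.Path.IsT21 {N : ℕ} {p : NicePair N} (t : p.Path) : Prop :=
  t.1.rowLen 1 = p.lam.rowLen 1 + 1

instance {N : ℕ} (p : NicePair N) : Finite p.Path := by
  refine Finite.of_injective
    (β := {c : Finset (ℕ × ℕ) // c ∈ p.mu.cells.powerset})
    (fun t => ⟨t.1.cells, Finset.mem_powerset.2 t.2.2.1⟩) ?_
  intro s t h
  exact Subtype.ext (YoungDiagram.ext (congrArg Subtype.val h))

instance {N : ℕ} (p : NicePair N) : Fintype p.Path := Fintype.ofFinite _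

/-- The cells of a diagram lie in a square whose side is the number of cells. -/
theorem cells_subset_square (ν : YoungDiagram) :
    ν.cells ⊆ Finset.range ν.card ×ˢ Finset.range ν.card := by
  rintro ⟨i, j⟩ h
  have h' : (i, j) ∈ ν := h
  have hr : j < ν.card := by
    refine (YoungDiagram.mem_iff_lt_rowLen.1 h').trans_le ?_
    rw [YoungDiagram.rowLen_eq_card]
    exact Finset.card_le_card (Finset.filter_subset _ _)
  have hc : i < ν.card := by
    refine (YoungDiagram.mem_iff_lt_colLen.1 h').trans_le ?_
    rw [YoungDiagram.colLen_eq_card]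
    exact Finset.card_le_card (Finset.filter_subset _ _)
  simp [hr, hc]

instance (N : ℕ) : Finite (NicePair N) := by
  refine Finite.of_injective
    (β := {c : Finset (ℕ × ℕ) // c ∈ (Finset.range N ×ˢ Finset.range N).powerset} ×
      {c : Finset (ℕ × ℕ) // c ∈ (Finset.range (N + 2) ×ˢ Finset.range (N + 2)).powerset})
    (fun p => (⟨p.lam.cells, Finset.mem_powerset.2 (by
        have h := cells_subset_square p.lam
        rwa [p.card_lam] at h)⟩,
      ⟨p.mu.cells, Finset.mem_powerset.2 (by
        have h := cells_subset_square p.mu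
        rwa [p.card_mu] at h)⟩)) ?_
  intro p q h
  have h1 := congrArg (fun z => z.1.1) h
  have h2 := congrArg (fun z => z.2.1) h
  exact NicePair.ext (YoungDiagram.ext h1) (YoungDiagram.ext h2)

instance (N : ℕ) : Fintype (NicePair N) := Fintype.ofFinite _

/-- The multiplicity space `H(lam, mu)`: the complex Hilbert space in which the paths
`lam → ν → mu` form an orthonormal basis. -/
abbrev NicePair.MultSpace {N : ℕ} (p : NicePair N) : Type := EuclideanSpace ℂ p.Path

/-! ### Parametrization of equivariant maps by the multiplicity spaces -/

/-- A system of normalized real intertwiners, one for each path `lam → ν → mu`: the map indexed by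
the path is a real `𝔖_N × SL(2, ℂ)`-equivariant partial isometry whose initial space is the
`lam`-component of `(ℂ²)^{⊗N}`, and which carries this component into the part of
`(ℂ²)^{⊗(N+2)}` that belongs to `mu` for all `N + 2` factors and to `ν` for the first `N + 1`
factors. -/
structure IsPathSystem {N : ℕ}
    (E : ∀ p : NicePair N, p.Path → (TensorPow N →ₗ[ℂ] TensorPow (N + 2))) : Prop where
  equivariant : ∀ p t, IsEquivariant (E p t)
  real : ∀ p t, IsRealMap (E p t)
  isometric : ∀ p t, ∀ x ∈ component N p.lam, ∀ y ∈ component N p.lam,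
    tensorInner (E p t x) (E p t y) = tensorInner x y
  vanish : ∀ p t (q : NicePair N), q ≠ p → ∀ x ∈ component N q.lam, E p t x = 0
  mem_mu : ∀ p t, ∀ x ∈ component N p.lam, E p t x ∈ component (N + 2) p.mu
  mem_path : ∀ p t, ∀ x ∈ component N p.lam, E p t x ∈ componentFirst (N + 1) (N + 2) t.1

/-- The map `(ℂ²)^{⊗N} → (ℂ²)^{⊗(N+2)}` determined by a family of vectors of the multiplicity
spaces. -/
def pathMap {N : ℕ} (E : ∀ p : NicePair N, p.Path → (TensorPow N →ₗ[ℂ] TensorPow (N + 2)))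
    (h : ∀ p : NicePair N, p.MultSpace) : TensorPow N →ₗ[ℂ] TensorPow (N + 2) :=
  ∑ p, ∑ t, h p t • E p t

open Classical in
/-- The family of vectors of the multiplicity spaces given by points `z j` of the unit circle and
a sign `s`: the vector `(Re z) t₂₁ + (Im z) t₁₂` for the non-exceptional pairs, enumerated by `e`,
and the vector `s` for an exceptional pair. -/
def circleFamily {N n : ℕ} (e : Fin n ≃ {p : NicePair N // ¬ p.IsExceptional})
    (z : Fin n → Circle) (s : ℤˣ) (p : NicePair N) : p.MultSpace :=
  WithLp.toLp 2 fun t =>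
    if hp : p.IsExceptional then ((s : ℤ) : ℂ)
    else if t.IsT21 then (((z (e.symm ⟨p, hp⟩) : ℂ).re : ℝ) : ℂ)
    else (((z (e.symm ⟨p, hp⟩) : ℂ).im : ℝ) : ℂ)

end SchurWeyl

end

/-!
Write `V = ℂ²`. In the standard basis the operators `⨂ M_k`, the permutations of the factors and
hence all the objects of the theorem are explicit matrices indexed by `ι → Fin 2`, and the proof
takes place in these coordinates.

*Isotypic components are eigenspaces.* For a set `S` of `s` tensor factors, the sum `swapSum S` of
the permutations `(k l)` over all `(k, l) ∈ S × S`, with `(k k) = 1`, commutes with the action of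
`SL(2, ℂ)` on the factors in `S`. If a weight vector with `q` indices equal to `1` is killed by the
raising operator, then it is an eigenvector of `swapSum S` for the eigenvalue
`swapEigen s q = q² + (s - q)² - 2 q`, and these numbers are different for different `q ≤ s / 2`.
An irreducible invariant subspace contains such a vector and so lies in an eigenspace; the big cell
of `SL(2, ℂ)` shows that it is spanned by the weight components of its images under lower
triangular elements, one for each weight, so that its dimension is `s - 2 q + 1`
(`IsIrred.exists_finrank_eq`). Complete reducibility follows from the invariance of orthogonal
complements. Thus the `(s - q, q)`-component is the eigenspace `isoComp S q` of `swapSum S`, and the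
components are pairwise orthogonal (`isotypicOfDim_eq_comap`, `dotProduct_eq_zero_of_swapSum`).

*The path system.* Let `ω = e₀ ⊗ e₁ - e₁ ⊗ e₀`, and let `J` be the sum of the transpositions of the
factor `N + 1` with the first `N` factors (a Jucys–Murphy element). Because antisymmetrization over
three factors of `V` is zero, `J` satisfies a quadratic equation on `(λ-component) ⊗ V`, whose roots
`u`, `v` are the contents of the two cells that can be added to `λ` (`jucysMurphy_sub_smul`), and
`x ↦ x ⊗ ω` maps the `λ`-component to the `μ`-component (`swapSum_univ_tensorAlt`). The map
`x ↦ (J - v) (x ⊗ ω)` therefore lands in the part indexed by the path whose first cell has content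
`u`, and since `ω` is maximally entangled it multiplies the inner product by
`(u - v) (N - 2 v) > 0` (`pathOp_dotProduct`). Normalized, these maps are the `E_{λ,t}`.

*There are no other equivariant maps.* A map `F : V^{⊗N} → V^{⊗(N+2)} = V^{⊗N} ⊗ V ⊗ V` that is
`𝔖_N`-equivariant is determined by the polynomial function `X ↦ Tr (X^{⊗N} F) ∈ V ⊗ V` of a
`2 × 2` matrix `X`. If `F` is `SL(2, ℂ)`-equivariant, then so is this function for conjugation of
`X`, and it is determined by its restriction to diagonal matrices. There, by equivariance under the
torus and the Weyl element, it is determined by its `e₀ ⊗ e₁`-coefficient, a homogeneous polynomial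
of degree `N` in two variables. So the space of equivariant maps has dimension at most `N + 1`
(`finrank_equivariantMaps_le`), which is the total number of paths
(`NicePair.card_sigma_path`), and the `E_{λ,t}`, which are linearly independent by orthogonality,
form a basis of it. In this basis, isometric maps are given by unit vectors and real maps by real
coefficients (`isSchurWeylEmbedding_pathMap_iff`, `isRealMap_pathMap_iff`).
-/

namespace SchurWeyl

open Matrix

/-! ### Operators on tensors in coordinates -/

/-- A tensor in `⨂_{k : ι} ℂ²`, given by its coordinates in the standard basis. -/
abbrev Coord (ι : Type) : Type := (ι → Fin 2) → ℂ

/-- The matrix of `⨂_k M_k` in the standard basis. -/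
def kron {ι : Type} [Fintype ι] (M : ι → Matrix (Fin 2) (Fin 2) ℂ) :
    Matrix (ι → Fin 2) (ι → Fin 2) ℂ :=
  Matrix.of fun i j => ∏ k, M k (i k) (j k)

/-- The matrix of the operator that acts by `g` on the factors in `S` and trivially on the
others. -/
def kronOn {ι : Type} [Fintype ι] [DecidableEq ι] (S : Finset ι) (g : Matrix (Fin 2) (Fin 2) ℂ) :
    Matrix (ι → Fin 2) (ι → Fin 2) ℂ :=
  kron fun k => if k ∈ S then g else 1

/-- The permutation of the tensor factors by `σ`, in coordinates. -/
def permOp {ι : Type} (σ : Equiv.Perm ι) : Coord ι →ₗ[ℂ] Coord ι :=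
  LinearMap.funLeft ℂ ℂ fun i => i ∘ σ

/-- The sum of the transpositions `(k l)` over all ordered pairs of elements of `S`, the trivial
ones with `k = l` included. Up to an affine change, it is the Casimir operator of the action of
`SL(2, ℂ)` on the factors in `S`. -/
noncomputable def swapSum {ι : Type} [DecidableEq ι] (S : Finset ι) : Coord ι →ₗ[ℂ] Coord ι :=
  ∑ k ∈ S, ∑ l ∈ S, permOp (Equiv.swap k l)

/-- The eigenvalue of `swapSum S`, `|S| = s`, on the isotypic component indexed by the diagram
`(s - q, q)`. -/
def swapEigen (s q : ℕ) : ℝ := (q : ℝ) ^ 2 + ((s : ℝ) - q) ^ 2 - 2 * q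

theorem permOp_apply {ι : Type} (σ : Equiv.Perm ι) (x : Coord ι) (i : ι → Fin 2) :
    permOp σ x i = x (i ∘ σ) := rfl

theorem permOp_permOp {ι : Type} (σ τ : Equiv.Perm ι) (x : Coord ι) :
    permOp σ (permOp τ x) = permOp (σ * τ) x := rfl

theorem permOp_one {ι : Type} (x : Coord ι) : permOp 1 x = x := rfl

theorem swap_mem_iff {ι : Type} [DecidableEq ι] {S : Finset ι} {k l : ι} (hk : k ∈ S)
    (hl : l ∈ S) (m : ι) : Equiv.swap k l m ∈ S ↔ m ∈ S := by
  rw [Equiv.swap_apply_def]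
  split_ifs with h1 h2
  · simp [h1, hk, hl]
  · simp [h2, hk, hl]
  · rfl

theorem swapSum_apply {ι : Type} [DecidableEq ι] (S : Finset ι) (x : Coord ι) (i : ι → Fin 2) :
    swapSum S x i = ∑ k ∈ S, ∑ l ∈ S, x (i ∘ Equiv.swap k l) := by
  simp [swapSum, LinearMap.sum_apply, Finset.sum_apply, permOp_apply]

section kron

variable {ι : Type} [Fintype ι]

theorem kron_apply (M : ι → Matrix (Fin 2) (Fin 2) ℂ) (i j : ι → Fin 2) :
    kron M i j = ∏ k, M k (i k) (j k) := rfl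

theorem kron_mul [DecidableEq ι] (M M' : ι → Matrix (Fin 2) (Fin 2) ℂ) :
    kron M * kron M' = kron fun k => M k * M' k := by
  ext i j
  simp only [mul_apply, kron_apply, ← Finset.prod_mul_distrib]
  rw [Finset.prod_univ_sum]
  simp

theorem kron_one [DecidableEq ι] : kron (fun _ : ι => 1) = 1 := by
  ext i j
  simp only [kron_apply, one_apply]
  by_cases h : i = j
  · simp [h]
  · obtain ⟨k, hk⟩ := Function.ne_iff.1 h
    rw [if_neg h]
    exact Finset.prod_eq_zero (Finset.mem_univ k) (if_neg hk)

theorem kron_conjTranspose (M : ι → Matrix (Fin 2) (Fin 2) ℂ) :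
    (kron M)ᴴ = kron fun k => (M k)ᴴ := by
  ext i j
  simp [kron_apply, conjTranspose_apply]

theorem permOp_kron_mulVec (σ : Equiv.Perm ι) (M : ι → Matrix (Fin 2) (Fin 2) ℂ) (x : Coord ι)
    [DecidableEq ι] :
    permOp σ (kron M *ᵥ x) = kron (fun k => M (σ.symm k)) *ᵥ permOp σ x := by
  ext i
  simp only [permOp_apply, mulVec, dotProduct, kron_apply]
  refine Fintype.sum_equiv (Equiv.arrowCongr σ (Equiv.refl _)) _ _ fun j => ?_
  congr 1
  · refine Fintype.prod_equiv σ _ _ fun k => ?_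
    simp [Equiv.arrowCongr]
  · congr 1
    ext k
    simp [Equiv.arrowCongr]

variable [DecidableEq ι]

theorem kronOn_mul (S : Finset ι) (g h : Matrix (Fin 2) (Fin 2) ℂ) :
    kronOn S (g * h) = kronOn S g * kronOn S h := by
  rw [kronOn, kronOn, kronOn, kron_mul]
  congr 1
  funext k
  split_ifs <;> simp

theorem kronOn_one (S : Finset ι) : kronOn S 1 = 1 := by
  rw [kronOn, ← kron_one]
  congr 1
  funext k
  split_ifs <;> rfl

theorem kronOn_univ (g : Matrix (Fin 2) (Fin 2) ℂ) :
    kronOn (Finset.univ : Finset ι) g = kron fun _ => g := by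
  simp [kronOn]

theorem kronOn_conjTranspose (S : Finset ι) (g : Matrix (Fin 2) (Fin 2) ℂ) :
    (kronOn S g)ᴴ = kronOn S gᴴ := by
  rw [kronOn, kronOn, kron_conjTranspose]
  congr 1
  funext k
  split_ifs <;> simp

theorem permOp_kronOn_mulVec {S : Finset ι} {σ : Equiv.Perm ι} (hσ : ∀ k, σ k ∈ S ↔ k ∈ S)
    (g : Matrix (Fin 2) (Fin 2) ℂ) (x : Coord ι) :
    permOp σ (kronOn S g *ᵥ x) = kronOn S g *ᵥ permOp σ x := by
  rw [kronOn, permOp_kron_mulVec]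
  congr 2
  funext k
  have := hσ (σ.symm k)
  simp only [Equiv.apply_symm_apply] at this
  simp only [this]

theorem swapSum_kronOn_mulVec (S : Finset ι) (g : Matrix (Fin 2) (Fin 2) ℂ) (x : Coord ι) :
    swapSum S (kronOn S g *ᵥ x) = kronOn S g *ᵥ swapSum S x := by
  simp only [swapSum, LinearMap.sum_apply, mulVec_sum]
  refine Finset.sum_congr rfl fun k hk => Finset.sum_congr rfl fun l hl => ?_
  exact permOp_kronOn_mulVec (swap_mem_iff hk hl) g x

theorem star_permOp_dotProduct (σ : Equiv.Perm ι) (x y : Coord ι) :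
    star (permOp σ x) ⬝ᵥ y = star x ⬝ᵥ permOp σ⁻¹ y := by
  simp only [dotProduct, Pi.star_apply, permOp_apply]
  refine Fintype.sum_equiv (Equiv.arrowCongr σ.symm (Equiv.refl _)) _ _ fun j => ?_
  congr 2
  ext k
  simp [Equiv.arrowCongr]

theorem star_swapSum_dotProduct (S : Finset ι) (x y : Coord ι) :
    star (swapSum S x) ⬝ᵥ y = star x ⬝ᵥ swapSum S y := by
  simp only [swapSum, LinearMap.sum_apply, star_sum, sum_dotProduct, dotProduct_sum]
  refine Finset.sum_congr rfl fun k _ => Finset.sum_congr rfl fun l _ => ?_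
  rw [star_permOp_dotProduct, Equiv.swap_inv]

/-- Eigenvectors of a swap sum for different eigenvalues are orthogonal. -/
theorem dotProduct_eq_zero_of_swapSum {S : Finset ι} {x y : Coord ι} {a b : ℝ}
    (hx : swapSum S x = (a : ℂ) • x) (hy : swapSum S y = (b : ℂ) • y) (hab : a ≠ b) :
    star x ⬝ᵥ y = 0 := by
  have h := star_swapSum_dotProduct S x y
  rw [hx, hy, star_smul, smul_dotProduct, dotProduct_smul] at h
  simp only [smul_eq_mul, Complex.star_def, Complex.conj_ofReal] at h
  have h' : ((a : ℂ) - b) * (star x ⬝ᵥ y) = 0 := by rw [sub_mul, h, sub_self]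
  exact (mul_eq_zero.1 h').resolve_left (sub_ne_zero.2 (by exact_mod_cast hab))

theorem swapEigen_injective {s q r : ℕ} (hq : 2 * q ≤ s) (hr : 2 * r ≤ s)
    (h : swapEigen s q = swapEigen s r) : q = r := by
  have h1 : ((q : ℝ) - r) * ((q : ℝ) + r - s - 1) = 0 := by
    simp only [swapEigen] at h
    linarith
  have hq' : 2 * (q : ℝ) ≤ s := by exact_mod_cast hq
  have hr' : 2 * (r : ℝ) ≤ s := by exact_mod_cast hr
  have h2 : (q : ℝ) + r - s - 1 ≠ 0 := by
    intro h0
    linarith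
  have := (mul_eq_zero.1 h1).resolve_right h2
  exact_mod_cast sub_eq_zero.1 this

end kron

/-! ### Weights and unipotent elements -/

/-- The number of positions in `S` at which the multi-index `i` takes the value `a`. The weight of
a basis tensor for the torus of `SL(2, ℂ)` is `count 0 S i - count 1 S i`. -/
def count {ι : Type} [DecidableEq ι] (a : Fin 2) (S : Finset ι) (i : ι → Fin 2) : ℕ :=
  (S.filter fun k => i k = a).card

/-- The projection onto the weight space spanned by the basis tensors with `count 1 S = r`. -/
def weightProj {ι : Type} [DecidableEq ι] (S : Finset ι) (r : ℕ) : Coord ι →ₗ[ℂ] Coord ι where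
  toFun x i := if count 1 S i = r then x i else 0
  map_add' x y := by
    ext i
    by_cases h : count 1 S i = r <;> simp [h]
  map_smul' c x := by
    ext i
    by_cases h : count 1 S i = r <;> simp [h]

/-- The unipotent element of `SL(2, ℂ)` with off-diagonal entry `t` in the column `a`: upper
triangular for `a = 1`, lower triangular for `a = 0`. -/
def unip (a : Fin 2) (t : ℂ) : Matrix.SpecialLinearGroup (Fin 2) ℂ :=
  ⟨Matrix.of fun i j => if i = j then 1 else if j = a then t else 0, by
    fin_cases a <;> simp [det_fin_two]⟩

/-- The element `diag(s, s⁻¹)` of `SL(2, ℂ)`. -/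
noncomputable def torus (s : ℂˣ) : Matrix.SpecialLinearGroup (Fin 2) ℂ :=
  ⟨!![(s : ℂ), 0; 0, ((s⁻¹ : ℂˣ) : ℂ)], by simp [det_fin_two]⟩

section

variable {ι : Type} [DecidableEq ι]

theorem weightProj_apply (S : Finset ι) (r : ℕ) (x : Coord ι) (i : ι → Fin 2) :
    weightProj S r x i = if count 1 S i = r then x i else 0 := rfl

theorem count_zero_add_count_one (S : Finset ι) (i : ι → Fin 2) :
    count 0 S i + count 1 S i = S.card := by
  have h := Finset.card_filter_add_card_filter_not (s := S) (fun k => i k = 0)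
  rw [← h, count, count]
  congr 2
  ext k
  simp only [Finset.mem_filter]
  refine and_congr_right fun _ => ?_
  omega

theorem count_le_card (a : Fin 2) (S : Finset ι) (i : ι → Fin 2) : count a S i ≤ S.card :=
  Finset.card_filter_le _ _

theorem weightProj_eq_zero_of_card_lt {S : Finset ι} {r : ℕ} (h : S.card < r) (x : Coord ι) :
    weightProj S r x = 0 := by
  ext i
  rw [weightProj_apply, if_neg]
  · rfl
  · have := count_le_card 1 S i
    omega

/-- A sum of weight projections over all weights is the identity. -/
theorem sum_weightProj (S : Finset ι) (x : Coord ι) :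
    ∑ r ∈ Finset.range (S.card + 1), weightProj S r x = x := by
  ext i
  simp only [Finset.sum_apply, weightProj_apply]
  rw [Finset.sum_ite_eq, if_pos]
  have := count_le_card 1 S i
  exact Finset.mem_range.2 (by omega)

theorem count_weightProj {S : Finset ι} {q : ℕ} {x : Coord ι} {i : ι → Fin 2}
    (h : weightProj S q x i ≠ 0) : count 1 S i = q := by
  by_contra h0
  rw [weightProj_apply, if_neg h0] at h
  exact h rfl

theorem count_update {a : Fin 2} {S : Finset ι} {i : ι → Fin 2} {k : ι} (hk : k ∈ S)
    (hik : i k ≠ a) : count a S (Function.update i k a) = count a S i + 1 := by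
  rw [count, count, ← Finset.card_insert_of_notMem (a := k)]
  · congr 1
    ext l
    simp only [Finset.mem_filter, Finset.mem_insert, Function.update_apply]
    by_cases h : l = k
    · simp [h, hk]
    · simp [h]
  · simp [hik]

theorem count_comp_swap {a : Fin 2} {S : Finset ι} {k l : ι} (hk : k ∈ S) (hl : l ∈ S)
    (i : ι → Fin 2) : count a S (i ∘ Equiv.swap k l) = count a S i := by
  refine Finset.card_equiv (Equiv.swap k l) fun m => ?_
  simp only [Finset.mem_filter, swap_mem_iff hk hl, Function.comp_apply]

/-- A weight vector that is killed by the raising operator (`a = 1`) or by the lowering operator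
(`a = 0`) is an eigenvector of the swap sum. -/
theorem swapSum_of_sum_update_eq_zero {S : Finset ι} {a : Fin 2} {q : ℕ} {v : Coord ι}
    (hv : ∀ i, v i ≠ 0 → count a S i = q)
    (h0 : ∀ i, count a S i + 1 = q →
      ∑ k ∈ S.filter (fun k => i k ≠ a), v (Function.update i k a) = 0) :
    swapSum S v = (swapEigen S.card q : ℂ) • v := by
  ext i
  rw [swapSum_apply, Pi.smul_apply, smul_eq_mul]
  by_cases hi : count a S i = q
  · have hsplit : ∀ f : ι → ℂ, ∑ k ∈ S, f k =
        ∑ k ∈ S.filter (fun k => i k = a), f k + ∑ k ∈ S.filter (fun k => i k ≠ a), f k :=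
      fun f => (Finset.sum_filter_add_sum_filter_not S _ f).symm
    have hcB : ((S.filter fun k => i k ≠ a).card : ℂ) = (S.card : ℂ) - q := by
      rw [eq_sub_iff_add_eq, add_comm, ← hi]
      exact_mod_cast Finset.card_filter_add_card_filter_not (s := S) (fun k => i k = a)
    have heq : ∀ k l, i k = i l → v (i ∘ Equiv.swap k l) = v i := by
      intro k l h
      congr 1
      ext1 m
      rw [Function.comp_apply, Equiv.swap_apply_def]
      split_ifs with h1 h2
      · rw [h1, h]
      · rw [h2, h]
      · rfl
    have hAA : ∑ k ∈ S.filter (fun k => i k = a), ∑ l ∈ S.filter (fun k => i k = a),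
        v (i ∘ Equiv.swap k l) = q ^ 2 * v i := by
      have hcA : (S.filter fun k => i k = a).card = q := hi
      rw [Finset.sum_congr rfl fun k hk => Finset.sum_congr rfl fun l hl => heq k l
        ((Finset.mem_filter.1 hk).2.trans (Finset.mem_filter.1 hl).2.symm)]
      simp only [Finset.sum_const, nsmul_eq_mul, hcA]
      ring
    have hBB : ∑ k ∈ S.filter (fun k => i k ≠ a), ∑ l ∈ S.filter (fun k => i k ≠ a),
        v (i ∘ Equiv.swap k l) = ((S.card : ℂ) - q) ^ 2 * v i := by
      rw [Finset.sum_congr rfl fun k hk => Finset.sum_congr rfl fun l hl => heq k l (by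
        have h1 := (Finset.mem_filter.1 hk).2
        have h2 := (Finset.mem_filter.1 hl).2
        omega)]
      simp only [Finset.sum_const, nsmul_eq_mul, hcB]
      ring
    -- undo the value `a` at one place `k`, and use that the raised vector vanishes there
    have hAB : ∑ k ∈ S.filter (fun k => i k = a), ∑ l ∈ S.filter (fun k => i k ≠ a),
        v (i ∘ Equiv.swap k l) = -(q * v i) := by
      have hcA : (S.filter fun k => i k = a).card = q := hi
      have hk0 : ∀ k ∈ S.filter (fun k => i k = a), ∑ l ∈ S.filter (fun k => i k ≠ a),
          v (i ∘ Equiv.swap k l) = -v i := by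
        intro k hk
        rw [Finset.mem_filter] at hk
        obtain ⟨b, hb⟩ : ∃ b : Fin 2, b ≠ a := exists_ne a
        have hupd : Function.update (Function.update i k b) k a = i := by
          rw [Function.update_idem, ← hk.2, Function.update_eq_self]
        have hcount : count a S (Function.update i k b) + 1 = q := by
          rw [← count_update hk.1 (by simpa using hb), hupd, hi]
        have h := h0 _ hcount
        have hfil : S.filter (fun l => Function.update i k b l ≠ a) =
            insert k (S.filter fun l => i l ≠ a) := by
          ext l
          simp only [Finset.mem_filter, Finset.mem_insert, Function.update_apply]
          by_cases hl : l = k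
          · simp [hl, hb, hk.1]
          · simp [hl]
        rw [hfil, Finset.sum_insert (by simp [hk.2]), hupd] at h
        rw [eq_neg_iff_add_eq_zero, add_comm, ← h]
        congr 1
        refine Finset.sum_congr rfl fun l hl => ?_
        rw [Finset.mem_filter] at hl
        congr 1
        ext1 m
        have hlk : l ≠ k := fun h => hl.2 (h ▸ hk.2)
        rw [Function.comp_apply, Equiv.swap_apply_def]
        by_cases hm : m = l
        · subst hm
          simp [hlk, hk.2]
        · rw [Function.update_of_ne hm, if_neg hm, Function.update_apply]
          have : i l = b := by omega
          split_ifs <;> simp [this]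
      rw [Finset.sum_congr rfl hk0, Finset.sum_const, hcA, nsmul_eq_mul]
      ring
    rw [hsplit, Finset.sum_congr rfl fun k _ => hsplit _,
      Finset.sum_congr (s₁ := S.filter fun k => i k ≠ a) rfl fun k _ => hsplit _,
      Finset.sum_add_distrib, Finset.sum_add_distrib, hAA, hBB, hAB, Finset.sum_comm]
    rw [Finset.sum_congr rfl fun k _ => Finset.sum_congr rfl fun l _ => by
      rw [Equiv.swap_comm], hAB]
    simp only [swapEigen]
    push_cast
    ring
  · have hz : ∀ j, count a S j ≠ q → v j = 0 := fun j hj => by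
      by_contra h
      exact hj (hv j h)
    rw [hz i hi, mul_zero]
    refine Finset.sum_eq_zero fun k hk => Finset.sum_eq_zero fun l hl => hz _ ?_
    rwa [count_comp_swap hk hl]

variable [Fintype ι]

/-- The action of `S` copies of a torus element on a multi-index is by its weight. -/
theorem kronOn_torus_mulVec (S : Finset ι) (s : ℂˣ) (x : Coord ι) (i : ι → Fin 2) :
    (kronOn S (torus s : Matrix (Fin 2) (Fin 2) ℂ) *ᵥ x) i =
      (s : ℂ) ^ count 0 S i * ((s⁻¹ : ℂˣ) : ℂ) ^ count 1 S i * x i := by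
  rw [mulVec, dotProduct, Finset.sum_eq_single i]
  · congr 1
    rw [kronOn, kron_apply]
    have : ∀ k, (if k ∈ S then (torus s : Matrix (Fin 2) (Fin 2) ℂ) else 1) (i k) (i k) =
        if k ∈ S then (if i k = 0 then (s : ℂ) else ((s⁻¹ : ℂˣ) : ℂ)) else 1 := by
      intro k
      split_ifs with h1 h2
      · simp [torus, h2]
      · have : i k = 1 := by omega
        simp [torus, this]
      · simp
    rw [Finset.prod_congr rfl fun k _ => this k, Finset.prod_ite_mem, Finset.univ_inter,
      Finset.prod_ite, Finset.prod_const, Finset.prod_const, count, count]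
    congr 3
    ext k
    simp only [Finset.mem_filter]
    refine and_congr_right fun _ => ?_
    omega
  · intro j _ hj
    obtain ⟨k, hk⟩ := Function.ne_iff.1 hj
    rw [kronOn, kron_apply, Finset.prod_eq_zero (Finset.mem_univ k), zero_mul]
    split_ifs
    · have : (i k = 0 ∧ j k = 1) ∨ (i k = 1 ∧ j k = 0) := by omega
      rcases this with ⟨h1, h2⟩ | ⟨h1, h2⟩ <;> simp [torus, h1, h2]
    · exact one_apply_ne (Ne.symm hk)
  · simp

/-- The entry of a unipotent element at `(i, j)` vanishes unless `j` arises from `i` by changing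
some values in `S` to `a`. -/
theorem kronOn_unip_ne_zero {S : Finset ι} {a : Fin 2} {t : ℂ} {i j : ι → Fin 2}
    (h : kronOn S (unip a t : Matrix (Fin 2) (Fin 2) ℂ) i j ≠ 0) (k : ι) :
    i k = j k ∨ k ∈ S ∧ j k = a := by
  rw [kronOn, kron_apply, Finset.prod_ne_zero_iff] at h
  have hk := h k (Finset.mem_univ k)
  by_contra hc
  push Not at hc
  apply hk
  split_ifs with hS
  · simp [unip, hc.1, hc.2 hS]
  · exact one_apply_ne hc.1

theorem filter_subset_of_kronOn_unip_ne_zero {S : Finset ι} {a : Fin 2} {t : ℂ} {i j : ι → Fin 2}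
    (h : kronOn S (unip a t : Matrix (Fin 2) (Fin 2) ℂ) i j ≠ 0) :
    (S.filter fun k => i k = a) ⊆ S.filter fun k => j k = a := by
  intro k hk
  rw [Finset.mem_filter] at hk ⊢
  refine ⟨hk.1, ?_⟩
  rcases kronOn_unip_ne_zero h k with h1 | h1
  · rw [← h1, hk.2]
  · exact h1.2

theorem count_le_of_kronOn_unip_ne_zero {S : Finset ι} {a : Fin 2} {t : ℂ} {i j : ι → Fin 2}
    (h : kronOn S (unip a t : Matrix (Fin 2) (Fin 2) ℂ) i j ≠ 0) :
    count a S i ≤ count a S j :=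
  Finset.card_le_card (filter_subset_of_kronOn_unip_ne_zero h)

theorem eq_of_kronOn_unip_ne_zero {S : Finset ι} {a : Fin 2} {t : ℂ} {i j : ι → Fin 2}
    (h : kronOn S (unip a t : Matrix (Fin 2) (Fin 2) ℂ) i j ≠ 0)
    (hc : count a S j ≤ count a S i) : i = j := by
  have hs := Finset.eq_of_subset_of_card_le (filter_subset_of_kronOn_unip_ne_zero h) hc
  ext1 k
  rcases kronOn_unip_ne_zero h k with h1 | h1
  · exact h1
  · have : k ∈ S.filter fun k => i k = a := by
      rw [hs]
      exact Finset.mem_filter.2 h1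
    rw [(Finset.mem_filter.1 this).2, h1.2]

theorem kronOn_unip_self (S : Finset ι) (a : Fin 2) (t : ℂ) (i : ι → Fin 2) :
    kronOn S (unip a t : Matrix (Fin 2) (Fin 2) ℂ) i i = 1 := by
  rw [kronOn, kron_apply]
  refine Finset.prod_eq_one fun k _ => ?_
  split_ifs <;> simp [unip]

/-- A unipotent element acts trivially on the top-weight part of a vector. -/
theorem kronOn_unip_mulVec_apply {S : Finset ι} {a : Fin 2} (t : ℂ) {q : ℕ} {v : Coord ι}
    (hv : ∀ i, v i ≠ 0 → count a S i = q) {i : ι → Fin 2} (hi : q ≤ count a S i) :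
    (kronOn S (unip a t : Matrix (Fin 2) (Fin 2) ℂ) *ᵥ v) i = v i := by
  rw [mulVec, dotProduct, Finset.sum_eq_single i]
  · rw [kronOn_unip_self, one_mul]
  · intro j _ hj
    by_contra h0
    have h1 := left_ne_zero_of_mul h0
    have h2 := hv j (right_ne_zero_of_mul h0)
    exact hj (eq_of_kronOn_unip_ne_zero h1 (h2.trans_le hi)).symm
  · simp

/-- The component of weight next to that of `v` in `u v`, for `u` unipotent, is the image of `v`
under the raising or lowering operator. -/
theorem kronOn_unip_mulVec_apply_of_count_add_one {S : Finset ι} {a : Fin 2} {q : ℕ} {v : Coord ι}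
    (hv : ∀ i, v i ≠ 0 → count a S i = q) {i : ι → Fin 2} (hi : count a S i + 1 = q) :
    (kronOn S (unip a 1 : Matrix (Fin 2) (Fin 2) ℂ) *ᵥ v) i =
      ∑ k ∈ S.filter (fun k => i k ≠ a), v (Function.update i k a) := by
  have hinj : Set.InjOn (fun k => Function.update i k a)
      (S.filter fun k => i k ≠ a : Finset ι) := by
    intro k hk l hl hkl
    by_contra hne
    have h1 := congrFun hkl k
    simp only [Function.update_self, Function.update_of_ne hne] at h1
    exact (Finset.mem_filter.1 hk).2 h1.symm
  rw [mulVec, dotProduct, ← Finset.sum_image (f := fun j => v j) hinj]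
  symm
  refine Finset.sum_subset_zero_on_sdiff (Finset.subset_univ _) ?_ ?_
  · intro j hj
    by_contra h0
    have h1 := left_ne_zero_of_mul h0
    have h2 := hv j (right_ne_zero_of_mul h0)
    refine (Finset.mem_sdiff.1 hj).2 (Finset.mem_image.2 ?_)
    -- `i` and `j` differ in exactly one place
    have hcard : ((S.filter fun k => j k = a) \ (S.filter fun k => i k = a)).card = 1 := by
      rw [Finset.card_sdiff_of_subset (filter_subset_of_kronOn_unip_ne_zero h1)]
      change count a S j - count a S i = 1
      omega
    obtain ⟨k, hk⟩ := Finset.card_eq_one.1 hcard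
    have hk' : k ∈ (S.filter fun k => j k = a) \ (S.filter fun k => i k = a) := by
      rw [hk]
      exact Finset.mem_singleton_self k
    simp only [Finset.mem_sdiff, Finset.mem_filter, not_and] at hk'
    refine ⟨k, Finset.mem_filter.2 ⟨hk'.1.1, hk'.2 hk'.1.1⟩, ?_⟩
    ext1 l
    by_cases hl : l = k
    · subst hl
      simp [hk'.1.2]
    · rw [Function.update_of_ne hl]
      rcases kronOn_unip_ne_zero h1 l with h3 | h3
      · exact h3
      · by_contra h4
        have : l ∈ (S.filter fun k => j k = a) \ (S.filter fun k => i k = a) := by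
          simp only [Finset.mem_sdiff, Finset.mem_filter, not_and]
          exact ⟨h3, fun _ h5 => h4 (by rw [h5, h3.2])⟩
        rw [hk, Finset.mem_singleton] at this
        exact hl this
  · intro j hj
    obtain ⟨k, hk, rfl⟩ := Finset.mem_image.1 hj
    have hk := Finset.mem_filter.1 hk
    have : kronOn S (unip a 1 : Matrix (Fin 2) (Fin 2) ℂ) i (Function.update i k a) = 1 := by
      rw [kronOn, kron_apply]
      refine Finset.prod_eq_one fun l _ => ?_
      by_cases hl : l = k
      · subst hl
        simp [hk.1, unip]
      · rw [Function.update_of_ne hl]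
        split_ifs <;> simp [unip]
    simp only [this, one_mul]

end

/-! ### Irreducible subspaces for the action on the factors in a set -/

/-- Invariance of a subspace under the action of `SL(2, ℂ)` on the factors in `S`. -/
def IsInvariant {ι : Type} [Fintype ι] [DecidableEq ι] (S : Finset ι)
    (W : Submodule ℂ (Coord ι)) : Prop :=
  ∀ (g : Matrix.SpecialLinearGroup (Fin 2) ℂ), ∀ x ∈ W,
    kronOn S (g : Matrix (Fin 2) (Fin 2) ℂ) *ᵥ x ∈ W

/-- Irreducibility of a subspace under the action of `SL(2, ℂ)` on the factors in `S`. -/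
structure IsIrred {ι : Type} [Fintype ι] [DecidableEq ι] (S : Finset ι)
    (W : Submodule ℂ (Coord ι)) : Prop where
  invariant : IsInvariant S W
  ne_bot : W ≠ ⊥
  eq_bot_or_eq : ∀ U ≤ W, IsInvariant S U → U = ⊥ ∨ U = W

/-- A subspace that contains the values of a polynomial at infinitely many points contains its
coefficients. -/
theorem mem_of_infinite_sum_pow_smul_mem {V : Type} [AddCommGroup V] [Module ℂ V]
    {W : Submodule ℂ V} {n : ℕ} {y : ℕ → V} {T : Set ℂ} (hT : T.Infinite)
    (h : ∀ t ∈ T, ∑ k ∈ Finset.range n, t ^ k • y k ∈ W) {k : ℕ} (hk : k < n) : y k ∈ W := by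
  by_contra hy
  obtain ⟨φ, hφ, hW⟩ := Submodule.exists_le_ker_of_notMem hy
  let p : Polynomial ℂ := ∑ m ∈ Finset.range n, Polynomial.C (φ (y m)) * Polynomial.X ^ m
  have hp : p = 0 := by
    refine Polynomial.eq_zero_of_infinite_isRoot p (hT.mono fun t ht => ?_)
    have := hW (h t ht)
    rw [LinearMap.mem_ker, map_sum] at this
    change p.eval t = 0
    rw [Polynomial.eval_finsetSum, ← this]
    refine Finset.sum_congr rfl fun m _ => ?_
    rw [Polynomial.eval_mul, Polynomial.eval_C, Polynomial.eval_pow, Polynomial.eval_X, map_smul,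
      smul_eq_mul, mul_comm]
  have hc : p.coeff k = 0 := by rw [hp, Polynomial.coeff_zero]
  rw [Polynomial.finsetSum_coeff, Finset.sum_congr rfl fun m _ =>
    Polynomial.coeff_C_mul_X_pow _ _ _] at hc
  rw [Finset.sum_ite_eq, if_pos (Finset.mem_range.2 hk)] at hc
  exact hφ hc

theorem aeval_apply_mem {V : Type} [AddCommGroup V] [Module ℂ V] {W : Submodule ℂ V}
    {D : Module.End ℂ V} (hD : ∀ x ∈ W, D x ∈ W) (p : Polynomial ℂ) {x : V} (hx : x ∈ W) :
    Polynomial.aeval D p x ∈ W := by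
  induction p using Polynomial.induction_on' with
  | add p q hp hq =>
    rw [map_add, LinearMap.add_apply]
    exact W.add_mem hp hq
  | monomial n a =>
    rw [Polynomial.aeval_monomial, Module.End.mul_apply, Module.algebraMap_end_apply]
    refine W.smul_mem _ ?_
    induction n with
    | zero => simpa using hx
    | succ n ih =>
      rw [pow_succ', Module.End.mul_apply]
      exact hD _ ih

/-- The eigenvalue `swapEigen s q` is symmetric under the reflection `q ↦ s + 1 - q`, and takes the
same value twice for no other reason. -/
theorem swapEigen_eq_cases {s q r : ℕ} (h : swapEigen s q = swapEigen s r) :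
    q = r ∨ q + r = s + 1 := by
  have h1 : ((q : ℝ) - r) * ((q : ℝ) + r - s - 1) = 0 := by
    simp only [swapEigen] at h
    linarith
  rcases mul_eq_zero.1 h1 with h2 | h2
  · left
    exact_mod_cast sub_eq_zero.1 h2
  · right
    have : (q : ℝ) + r = s + 1 := by linarith
    exact_mod_cast this

section

variable {ι : Type} [Fintype ι] [DecidableEq ι] {S : Finset ι} {W : Submodule ℂ (Coord ι)}

/-- An invariant subspace is the sum of its weight spaces: the weight projections are polynomials
in the action of `diag(2, 1/2)`. -/
theorem weightProj_mem (hW : IsInvariant S W) (r : ℕ) {x : Coord ι} (hx : x ∈ W) :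
    weightProj S r x ∈ W := by
  by_cases hr : S.card < r
  · rw [weightProj_eq_zero_of_card_lt hr]
    exact W.zero_mem
  let D : Module.End ℂ (Coord ι) :=
    (kronOn S (torus (Units.mk0 2 two_ne_zero) : Matrix (Fin 2) (Fin 2) ℂ)).mulVecLin
  let d : ℕ → ℂ := fun r => 2 ^ (S.card - r) * 2⁻¹ ^ r
  have hDx : ∀ x i, D x i = d (count 1 S i) * x i := by
    intro x i
    have h0 : count 0 S i = S.card - count 1 S i := by
      have := count_zero_add_count_one S i
      omega
    simp only [D, mulVecLin_apply, kronOn_torus_mulVec, h0, d, Units.val_mk0,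
      Units.val_inv_eq_inv_val]
  have hinj : Set.InjOn d (Finset.range (S.card + 1)) := by
    have key : ∀ r ∈ Finset.range (S.card + 1), d r = 2 ^ S.card * 4⁻¹ ^ r := by
      intro r hr
      rw [Finset.mem_range] at hr
      have h2 : (2 : ℂ) ^ S.card = 2 ^ (S.card - r) * 2 ^ r := by
        rw [← pow_add]
        congr 1
        omega
      rw [h2, mul_assoc, ← mul_pow]
      simp only [d]
      norm_num
    intro a ha b hb hab
    rw [key a ha, key b hb] at hab
    have h1 := mul_left_cancel₀ (pow_ne_zero _ two_ne_zero) hab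
    rw [inv_pow, inv_pow, _root_.inv_inj] at h1
    have h2 : (4 : ℕ) ^ a = 4 ^ b := by exact_mod_cast h1
    exact Nat.pow_right_injective (by norm_num) h2
  have haeval : ∀ (p : Polynomial ℂ) (x : Coord ι) i,
      Polynomial.aeval D p x i = p.eval (d (count 1 S i)) * x i := by
    intro p x i
    induction p using Polynomial.induction_on' with
    | add p q hp hq =>
      rw [map_add, LinearMap.add_apply, Pi.add_apply, hp, hq, Polynomial.eval_add, add_mul]
    | monomial n a =>
      rw [Polynomial.aeval_monomial, Module.End.mul_apply, Module.algebraMap_end_apply,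
        Polynomial.eval_monomial, Pi.smul_apply, smul_eq_mul, mul_assoc]
      congr 1
      induction n with
      | zero => simp
      | succ n ih => rw [pow_succ', Module.End.mul_apply, hDx, ih, pow_succ]; ring
  have : weightProj S r x =
      Polynomial.aeval D (Lagrange.basis (Finset.range (S.card + 1)) d r) x := by
    ext i
    have hi : count 1 S i ∈ Finset.range (S.card + 1) :=
      Finset.mem_range.2 (Nat.lt_succ_of_le (count_le_card 1 S i))
    rw [haeval, weightProj_apply]
    split_ifs with h
    · rw [h, Lagrange.eval_basis_self hinj (h ▸ hi), one_mul]
    · rw [Lagrange.eval_basis_of_ne (Ne.symm h) hi, zero_mul]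
  rw [this]
  exact aeval_apply_mem (fun y hy => hW _ y hy) _ hx

/-- A vector of top weight of an invariant subspace is an eigenvector of the swap sum. -/
theorem swapSum_of_top_weight (hW : IsInvariant S W) {q : ℕ} {v : Coord ι} (hvW : v ∈ W)
    (hv : ∀ i, v i ≠ 0 → count 1 S i = q)
    (htop : ∀ r, r + 1 = q → ∀ x ∈ W, weightProj S r x = 0) :
    swapSum S v = (swapEigen S.card q : ℂ) • v := by
  refine swapSum_of_sum_update_eq_zero hv fun i hi => ?_
  rw [← kronOn_unip_mulVec_apply_of_count_add_one hv hi]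
  have := congrFun (htop _ hi _ (hW (unip 1 1) v hvW)) i
  rwa [weightProj_apply, if_pos rfl] at this

/-- A vector of bottom weight of an invariant subspace is an eigenvector of the swap sum. -/
theorem swapSum_of_bottom_weight (hW : IsInvariant S W) {q : ℕ} {v : Coord ι} (hvW : v ∈ W)
    (hv : ∀ i, v i ≠ 0 → count 1 S i = q)
    (hbot : ∀ x ∈ W, weightProj S (q + 1) x = 0) :
    swapSum S v = (swapEigen S.card (S.card - q) : ℂ) • v := by
  have hv' : ∀ i, v i ≠ 0 → count 0 S i = S.card - q := by
    intro i hi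
    have := hv i hi
    have := count_zero_add_count_one S i
    omega
  refine swapSum_of_sum_update_eq_zero hv' fun i hi => ?_
  rw [← kronOn_unip_mulVec_apply_of_count_add_one hv' hi]
  have := congrFun (hbot _ (hW (unip 0 1) v hvW)) i
  rwa [weightProj_apply, if_pos] at this
  have := count_zero_add_count_one S i
  omega

/-- On an irreducible subspace the swap sum is a scalar as soon as it has an eigenvector there. -/
theorem IsIrred.swapSum_eq (hW : IsIrred S W) {v : Coord ι} (hvW : v ∈ W) (hv : v ≠ 0) {c : ℂ}
    (h : swapSum S v = c • v) {x : Coord ι} (hx : x ∈ W) : swapSum S x = c • x := by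
  let U : Submodule ℂ (Coord ι) := W ⊓ Module.End.eigenspace (swapSum S) c
  have hU : IsInvariant S U := by
    intro g y hy
    refine ⟨hW.invariant g y hy.1, ?_⟩
    rw [SetLike.mem_coe, Module.End.mem_eigenspace_iff, swapSum_kronOn_mulVec,
      Module.End.mem_eigenspace_iff.1 hy.2, mulVec_smul]
  rcases hW.eq_bot_or_eq U inf_le_left hU with h0 | h0
  · have hvU : v ∈ U := ⟨hvW, Module.End.mem_eigenspace_iff.2 h⟩
    exact absurd ((Submodule.mem_bot ℂ).1 (h0 ▸ hvU)) hv
  · rw [← h0] at hx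
    exact Module.End.mem_eigenspace_iff.1 hx.2

/-- A matrix entry of a unipotent element acting on the factors in `S` is a monomial in `t`, whose
degree is the difference of the weights of the two indices. -/
theorem kronOn_unip_apply (S : Finset ι) (a : Fin 2) (t : ℂ) (i j : ι → Fin 2) :
    kronOn S (unip a t : Matrix (Fin 2) (Fin 2) ℂ) i j =
      t ^ (count a S j - count a S i) *
        kronOn S (unip a 1 : Matrix (Fin 2) (Fin 2) ℂ) i j := by
  have h1 : kronOn S (unip a t : Matrix (Fin 2) (Fin 2) ℂ) i j =
      t ^ ((S.filter fun k => j k = a) \ (S.filter fun k => i k = a)).card *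
        kronOn S (unip a 1 : Matrix (Fin 2) (Fin 2) ℂ) i j := by
    have h2 : t ^ ((S.filter fun k => j k = a) \ (S.filter fun k => i k = a)).card =
        ∏ k, if k ∈ (S.filter fun k => j k = a) \ (S.filter fun k => i k = a) then t else 1 := by
      rw [Finset.prod_ite_mem, Finset.univ_inter, Finset.prod_const]
    rw [h2, kronOn, kron_apply, kronOn, kron_apply, ← Finset.prod_mul_distrib]
    refine Finset.prod_congr rfl fun k _ => ?_
    simp only [Finset.mem_sdiff, Finset.mem_filter, not_and]
    by_cases hk : k ∈ S
    · by_cases h3 : i k = j k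
      · simp [hk, h3, unip]
      · by_cases h4 : j k = a
        · have h5 : i k ≠ a := fun h => h3 (h.trans h4.symm)
          simp [hk, h4, h5, unip]
        · simp [hk, h3, h4, unip]
    · simp [hk]
  by_cases h0 : kronOn S (unip a 1 : Matrix (Fin 2) (Fin 2) ℂ) i j = 0
  · rw [h1, h0, mul_zero, mul_zero]
  · rw [h1, Finset.card_sdiff_of_subset (filter_subset_of_kronOn_unip_ne_zero h0)]
    rfl

/-- The weight components of `u v` for a lower triangular unipotent element `u`. -/
theorem kronOn_unip_zero_mulVec {q : ℕ} {v : Coord ι} (hv : ∀ i, v i ≠ 0 → count 1 S i = q)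
    (t : ℂ) :
    kronOn S (unip 0 t : Matrix (Fin 2) (Fin 2) ℂ) *ᵥ v =
      ∑ k ∈ Finset.range (S.card + 1), t ^ k •
        weightProj S (q + k) (kronOn S (unip 0 1 : Matrix (Fin 2) (Fin 2) ℂ) *ᵥ v) := by
  ext i
  simp only [Finset.sum_apply, Pi.smul_apply, weightProj_apply, smul_eq_mul, mul_ite, mul_zero]
  have hi := count_zero_add_count_one S i
  by_cases hq : q ≤ count 1 S i
  · rw [Finset.sum_eq_single (count 1 S i - q)]
    · rw [if_pos (by omega), mulVec, dotProduct, mulVec, dotProduct, Finset.mul_sum]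
      refine Finset.sum_congr rfl fun j _ => ?_
      by_cases hj : v j = 0
      · simp [hj]
      · rw [kronOn_unip_apply, mul_assoc]
        congr 2
        have := hv j hj
        have := count_zero_add_count_one S j
        omega
    · intro k _ hk
      rw [if_neg (by omega)]
    · intro h
      rw [Finset.mem_range] at h
      omega
  · rw [Finset.sum_eq_zero fun k _ => if_neg (by omega)]
    refine Finset.sum_eq_zero fun j _ => ?_
    by_contra h0
    have h1 := count_le_of_kronOn_unip_ne_zero (left_ne_zero_of_mul h0)
    have := hv j (right_ne_zero_of_mul h0)
    have := count_zero_add_count_one S j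
    omega

theorem eq_unip_mul_torus_mul_unip (g : Matrix.SpecialLinearGroup (Fin 2) ℂ) {α : ℂˣ}
    (h : g 0 0 = (α : ℂ)) :
    g = unip 0 (g 1 0 / (α : ℂ)) * torus α * unip 1 (g 0 1 / (α : ℂ)) := by
  have hd := g.det_coe
  rw [det_fin_two, h] at hd
  ext i j
  have hα := α.ne_zero
  rw [Matrix.SpecialLinearGroup.coe_mul, Matrix.SpecialLinearGroup.coe_mul]
  fin_cases i <;> fin_cases j <;>
    simp [unip, torus, Matrix.mul_apply, Fin.sum_univ_two, h]
  · field_simp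
  · field_simp
    linear_combination hd

/-- The structure of an irreducible subspace: it has dimension `s - 2 q + 1`, where `q ≤ s / 2`
gives the top weight, and the swap sum acts by the corresponding scalar. -/
theorem IsIrred.exists_finrank_eq (hW : IsIrred S W) :
    ∃ q, 2 * q ≤ S.card ∧ Module.finrank ℂ W = S.card - 2 * q + 1 ∧
      ∀ x ∈ W, swapSum S x = (swapEigen S.card q : ℂ) • x := by
  classical
  have hinv := hW.invariant
  obtain ⟨w, hw, hw0⟩ := (Submodule.ne_bot_iff W).1 hW.ne_bot
  have hex : ∃ r, ∃ x ∈ W, weightProj S r x ≠ 0 := by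
    by_contra! h
    apply hw0
    rw [← sum_weightProj S w]
    exact Finset.sum_eq_zero fun r _ => h r w hw
  have hmin : ∀ r < Nat.find hex, ∀ x ∈ W, weightProj S r x = 0 := by
    intro r hr x hx
    by_contra h
    exact Nat.find_min hex hr ⟨x, hx, h⟩
  obtain ⟨x, hx, hv0⟩ := Nat.find_spec hex
  generalize Nat.find hex = q at hmin hv0
  set v := weightProj S q x
  have hvW : v ∈ W := weightProj_mem hinv q hx
  have hv : ∀ i, v i ≠ 0 → count 1 S i = q := fun i hi => count_weightProj hi
  have hqs : q ≤ S.card := by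
    by_contra h
    exact hv0 (weightProj_eq_zero_of_card_lt (by omega) x)
  have hT : ∀ y ∈ W, swapSum S y = (swapEigen S.card q : ℂ) • y := fun y hy =>
    hW.swapSum_eq hvW hv0 (swapSum_of_top_weight hinv hvW hv fun r hr => hmin r (by omega)) hy
  have heig : ∀ r y, y ∈ W → y ≠ 0 → swapSum S y = (swapEigen S.card r : ℂ) • y →
      q = r ∨ q + r = S.card + 1 := by
    intro r y hy hy0 h
    rw [hT y hy] at h
    have := smul_left_injective ℂ hy0 h
    exact swapEigen_eq_cases (by exact_mod_cast this)
  -- the bottom weight is opposite to the top weight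
  have hgap : ∀ r, q ≤ r → r ≤ S.card → (∃ x ∈ W, weightProj S r x ≠ 0) →
      (∀ x ∈ W, weightProj S (r + 1) x = 0) → r + q = S.card := by
    rintro r hr hrs ⟨y, hy, hy0⟩ hnext
    have h1 := swapSum_of_bottom_weight hinv (weightProj_mem hinv r hy)
      (fun i hi => count_weightProj hi) hnext
    rcases heig _ _ (weightProj_mem hinv r hy) hy0 h1 with h | h <;> omega
  have hne : ∀ k, k + 2 * q ≤ S.card → ∃ x ∈ W, weightProj S (q + k) x ≠ 0 := by
    intro k
    induction k with
    | zero => exact fun _ => ⟨x, hx, hv0⟩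
    | succ k ih =>
      intro hk
      by_contra! h
      have := hgap (q + k) (by omega) (by omega) (ih (by omega)) h
      omega
  have hq2 : 2 * q ≤ S.card := by
    by_contra hq2
    have hall : ∀ k, ∃ x ∈ W, weightProj S (q + k) x ≠ 0 := by
      intro k
      induction k with
      | zero => exact ⟨x, hx, hv0⟩
      | succ k ih =>
        by_contra! h
        have hle : q + k ≤ S.card := by
          by_contra hlt
          obtain ⟨y, _, hy⟩ := ih
          exact hy (weightProj_eq_zero_of_card_lt (by omega) y)
        have := hgap (q + k) (by omega) hle ih h
        omega
    obtain ⟨y, _, hy⟩ := hall (S.card + 1)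
    exact hy (weightProj_eq_zero_of_card_lt (by omega) y)
  have hzero : ∀ r, S.card < r + q → ∀ y ∈ W, weightProj S r y = 0 := by
    intro r hr
    by_contra! hy
    have hqr : q ≤ r := by
      by_contra hlt
      obtain ⟨y, hyW, hy0⟩ := hy
      exact hy0 (hmin r (by omega) y hyW)
    have hall : ∀ k, ∃ x ∈ W, weightProj S (r + k) x ≠ 0 := by
      intro k
      induction k with
      | zero => exact hy
      | succ k ih =>
        by_contra! h
        have hle : r + k ≤ S.card := by
          by_contra hlt
          obtain ⟨y, _, hy⟩ := ih
          exact hy (weightProj_eq_zero_of_card_lt (by omega) y)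
        have := hgap (r + k) (by omega) hle ih h
        omega
    obtain ⟨y, _, hy⟩ := hall (S.card + 1)
    exact hy (weightProj_eq_zero_of_card_lt (by omega) y)
  -- the subspace is spanned by the weight components of `u v`, `u` lower triangular
  let y : ℕ → Coord ι := fun k =>
    weightProj S (q + k) (kronOn S (unip 0 1 : Matrix (Fin 2) (Fin 2) ℂ) *ᵥ v)
  have hyW : ∀ k, y k ∈ W := fun k => weightProj_mem hinv _ (hinv _ _ hvW)
  let U : Submodule ℂ (Coord ι) := Submodule.span ℂ (Set.range y)
  have hyU : ∀ k, y k ∈ U := fun k => Submodule.subset_span ⟨k, rfl⟩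
  have hUW : U ≤ W := Submodule.span_le.2 (by rintro _ ⟨k, rfl⟩; exact hyW k)
  have hlow : ∀ t, kronOn S (unip 0 t : Matrix (Fin 2) (Fin 2) ℂ) *ᵥ v ∈ U := by
    intro t
    rw [kronOn_unip_zero_mulVec hv]
    exact Submodule.sum_mem _ fun k _ => Submodule.smul_mem _ _ (hyU k)
  have hup : ∀ t, kronOn S (unip 1 t : Matrix (Fin 2) (Fin 2) ℂ) *ᵥ v = v := by
    intro t
    ext i
    by_cases hi : q ≤ count 1 S i
    · exact kronOn_unip_mulVec_apply t hv hi
    · have h1 := congrFun (hmin _ (not_le.1 hi) _ (hinv (unip 1 t) v hvW)) i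
      rw [weightProj_apply, if_pos rfl] at h1
      rw [h1]
      by_contra h2
      exact hi (hv i (Ne.symm h2)).ge
  have htor : ∀ α : ℂˣ, ∃ c : ℂ, kronOn S (torus α : Matrix (Fin 2) (Fin 2) ℂ) *ᵥ v = c • v := by
    intro α
    refine ⟨(α : ℂ) ^ (S.card - q) * ((α⁻¹ : ℂˣ) : ℂ) ^ q, ?_⟩
    ext i
    rw [kronOn_torus_mulVec, Pi.smul_apply, smul_eq_mul]
    by_cases hi : v i = 0
    · simp [hi]
    · have h1 := hv i hi
      have h2 := count_zero_add_count_one S i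
      rw [h1, show count 0 S i = S.card - q by omega]
  have hcell : ∀ g : Matrix.SpecialLinearGroup (Fin 2) ℂ, g 0 0 ≠ 0 →
      kronOn S (g : Matrix (Fin 2) (Fin 2) ℂ) *ᵥ v ∈ U := by
    intro g hg
    rw [eq_unip_mul_torus_mul_unip g (α := Units.mk0 _ hg) rfl,
      Matrix.SpecialLinearGroup.coe_mul, Matrix.SpecialLinearGroup.coe_mul, kronOn_mul, kronOn_mul,
      ← mulVec_mulVec, ← mulVec_mulVec, hup]
    obtain ⟨c, hc⟩ := htor (Units.mk0 _ hg)
    rw [hc, mulVec_smul]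
    exact U.smul_mem _ (hlow _)
  have hUinv : IsInvariant S U := by
    intro g z hz
    have hyk : ∀ k, kronOn S (g : Matrix (Fin 2) (Fin 2) ℂ) *ᵥ y k ∈ U := by
      intro k
      by_cases hk : S.card < k
      · have : y k = 0 := weightProj_eq_zero_of_card_lt (by omega) _
        rw [this, mulVec_zero]
        exact U.zero_mem
      have hinf : ({t : ℂ | g 0 0 + g 0 1 * t = 0}ᶜ).Infinite := by
        apply Set.Finite.infinite_compl
        apply Set.Subsingleton.finite
        intro t ht t' ht'
        change g 0 0 + g 0 1 * t = 0 at ht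
        change g 0 0 + g 0 1 * t' = 0 at ht'
        have h01 : g 0 1 ≠ 0 := by
          intro h
          have hd := g.det_coe
          rw [det_fin_two, h] at hd
          rw [h, zero_mul, add_zero] at ht
          rw [ht] at hd
          simp at hd
        exact mul_left_cancel₀ h01 (by linear_combination ht - ht')
      refine mem_of_infinite_sum_pow_smul_mem (n := S.card + 1)
        (y := fun k => kronOn S (g : Matrix (Fin 2) (Fin 2) ℂ) *ᵥ y k) hinf (fun t ht => ?_)
        (by omega)
      have h1 := hcell (g * unip 0 t) (by
        rw [Matrix.SpecialLinearGroup.coe_mul]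
        simpa [Matrix.mul_apply, Fin.sum_univ_two, unip] using ht)
      rw [Matrix.SpecialLinearGroup.coe_mul, kronOn_mul, ← mulVec_mulVec,
        kronOn_unip_zero_mulVec hv, mulVec_sum] at h1
      simpa only [mulVec_smul] using h1
    have : U ≤ U.comap (kronOn S (g : Matrix (Fin 2) (Fin 2) ℂ)).mulVecLin := by
      refine Submodule.span_le.2 ?_
      rintro _ ⟨k, rfl⟩
      exact hyk k
    exact this hz
  have hvU : v ∈ U := by
    have := hcell 1 (by simp)
    rwa [Matrix.SpecialLinearGroup.coe_one, kronOn_one, one_mulVec] at this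
  have hUeq : U = W := by
    rcases hW.eq_bot_or_eq U hUW hUinv with h | h
    · rw [h, Submodule.mem_bot] at hvU
      exact absurd hvU hv0
    · exact h
  have hyproj : ∀ r k, weightProj S (q + r) (y k) = if k = r then y k else 0 := by
    intro r k
    ext i
    simp only [y]
    split_ifs with h
    · subst h
      simp only [weightProj_apply]
      split_ifs <;> rfl
    · simp only [weightProj_apply]
      split_ifs <;> first | rfl | omega
  have hy0 : ∀ k, k + 2 * q ≤ S.card → y k ≠ 0 := by
    intro k hk h0
    obtain ⟨z, hz, hz0⟩ := hne k hk
    have : U ≤ LinearMap.ker (weightProj S (q + k)) := by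
      refine Submodule.span_le.2 ?_
      rintro _ ⟨m, rfl⟩
      rw [SetLike.mem_coe, LinearMap.mem_ker, hyproj]
      split_ifs with h
      · rw [h, h0]
      · rfl
    rw [← hUeq] at hz
    exact hz0 (this hz)
  have hspan : W = Submodule.span ℂ (Set.range fun k : Fin (S.card - 2 * q + 1) => y k) := by
    rw [← hUeq]
    apply le_antisymm
    · refine Submodule.span_le.2 ?_
      rintro _ ⟨k, rfl⟩
      by_cases hk : k < S.card - 2 * q + 1
      · exact Submodule.subset_span ⟨⟨k, hk⟩, rfl⟩
      · have : y k = 0 := hzero _ (by omega) _ (hinv _ _ hvW)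
        rw [this]
        exact Submodule.zero_mem _
    · refine Submodule.span_le.2 ?_
      rintro _ ⟨k, rfl⟩
      exact hyU k
  refine ⟨q, hq2, ?_, hT⟩
  have hli : LinearIndependent ℂ fun k : Fin (S.card - 2 * q + 1) => y k := by
    rw [Fintype.linearIndependent_iff]
    intro c hc k
    have h1 := congrArg (weightProj S (q + k)) hc
    rw [map_sum, map_zero, Finset.sum_eq_single k] at h1
    · rw [map_smul, hyproj, if_pos rfl] at h1
      exact (smul_eq_zero.1 h1).resolve_right (hy0 k (by have := k.2; omega))
    · intro m _ hm
      rw [map_smul, hyproj, if_neg (fun h => hm (Fin.ext h)), smul_zero]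
    · simp
  rw [hspan, finrank_span_eq_card hli, Fintype.card_fin]

end

/-! ### Complete reducibility and isotypic components -/

theorem exists_mem_add_orthogonal {n : Type} [Fintype n] (M : Submodule ℂ (n → ℂ)) (x : n → ℂ) :
    ∃ m ∈ M, ∃ c, x = m + c ∧ ∀ y ∈ M, star y ⬝ᵥ c = 0 := by
  let e : EuclideanSpace ℂ n ≃ₗ[ℂ] (n → ℂ) := WithLp.linearEquiv 2 ℂ (n → ℂ)
  obtain ⟨m, hm, c, hc, h⟩ := (M.comap e.toLinearMap).exists_add_mem_mem_orthogonal (e.symm x)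
  refine ⟨e m, hm, e c, ?_, fun y hy => ?_⟩
  · rw [← map_add, ← h, LinearEquiv.apply_symm_apply]
  · have := (Submodule.mem_orthogonal _ _).1 hc (e.symm y) (by
      simpa using hy)
    rw [EuclideanSpace.inner_eq_star_dotProduct, dotProduct_comm] at this
    exact this

open scoped ComplexOrder in
theorem eq_zero_of_star_dotProduct_self {n : Type} [Fintype n] {w : n → ℂ}
    (h : star w ⬝ᵥ w = 0) : w = 0 :=
  dotProduct_star_self_eq_zero.1 h

section

variable {ι : Type} [Fintype ι] [DecidableEq ι] {S : Finset ι}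

theorem IsInvariant.exists_isIrred_le {U : Submodule ℂ (Coord ι)} (hU : IsInvariant S U)
    (h0 : U ≠ ⊥) : ∃ W ≤ U, IsIrred S W := by
  obtain ⟨W, ⟨hWU, hW, hW0⟩, hmin⟩ := wellFounded_lt.has_min
    {W : Submodule ℂ (Coord ι) | W ≤ U ∧ IsInvariant S W ∧ W ≠ ⊥} ⟨U, le_rfl, hU, h0⟩
  refine ⟨W, hWU, hW, hW0, fun A hA hAinv => ?_⟩
  by_contra! hc
  exact hmin A ⟨hA.trans hWU, hAinv, hc.1⟩ (lt_of_le_of_ne hA hc.2)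

/-- The action of `SL(2, ℂ)` is completely reducible: the orthogonal complement of an invariant
subspace is invariant, as the group is closed under conjugate transposition. -/
theorem IsInvariant.le_iSup_isIrred {U : Submodule ℂ (Coord ι)} (hU : IsInvariant S U) :
    U ≤ ⨆ (W : Submodule ℂ (Coord ι)) (_ : W ≤ U ∧ IsIrred S W), W := by
  set M := ⨆ (W : Submodule ℂ (Coord ι)) (_ : W ≤ U ∧ IsIrred S W), W
  have hMU : M ≤ U := iSup₂_le fun W hW => hW.1
  have hM : IsInvariant S M := by
    intro g
    have : M ≤ M.comap (kronOn S (g : Matrix (Fin 2) (Fin 2) ℂ)).mulVecLin := by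
      refine iSup₂_le fun W hW x hx => ?_
      exact (le_iSup₂ (f := fun (W : Submodule ℂ (Coord ι)) (_ : W ≤ U ∧ IsIrred S W) => W) W hW)
        (hW.2.invariant g x hx)
    exact this
  let C : Submodule ℂ (Coord ι) :=
    { carrier := {c | ∀ y ∈ M, star y ⬝ᵥ c = 0}
      add_mem' := fun ha hb y hy => by rw [dotProduct_add, ha y hy, hb y hy, add_zero]
      zero_mem' := fun y _ => dotProduct_zero _
      smul_mem' := fun r a ha y hy => by rw [dotProduct_smul, ha y hy, smul_zero] }
  have hC : IsInvariant S C := by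
    intro g c hc y hy
    have h1 := hc _ (hM ⟨(g : Matrix (Fin 2) (Fin 2) ℂ)ᴴ, by simp [det_conjTranspose]⟩ y hy)
    rwa [← kronOn_conjTranspose, star_mulVec, conjTranspose_conjTranspose,
      ← dotProduct_mulVec] at h1
  have hbot : U ⊓ C = ⊥ := by
    by_contra h0
    obtain ⟨W, hW, hirr⟩ := IsInvariant.exists_isIrred_le (S := S) (U := U ⊓ C)
      (fun g x hx => ⟨hU g x hx.1, hC g x hx.2⟩) h0
    have hWM : W ≤ M :=
      le_iSup₂ (f := fun (W : Submodule ℂ (Coord ι)) (_ : W ≤ U ∧ IsIrred S W) => W) W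
        ⟨hW.trans inf_le_left, hirr⟩
    obtain ⟨w, hw, hw0⟩ := (Submodule.ne_bot_iff W).1 hirr.ne_bot
    exact hw0 (eq_zero_of_star_dotProduct_self ((hW hw).2 w (hWM hw)))
  intro x hx
  obtain ⟨m, hm, c, h, hc⟩ := exists_mem_add_orthogonal M x
  have hcU : c ∈ U ⊓ C := by
    refine ⟨?_, hc⟩
    rw [show c = x - m by rw [h]; abel]
    exact U.sub_mem hx (hMU hm)
  rw [hbot, Submodule.mem_bot] at hcU
  rwa [h, hcU, add_zero]

/-- The eigenspace of the swap sum that is the isotypic component indexed by `(s - q, q)`. -/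
noncomputable def isoComp {ι : Type} [DecidableEq ι] (S : Finset ι) (q : ℕ) :
    Submodule ℂ (Coord ι) :=
  Module.End.eigenspace (swapSum S) (swapEigen S.card q : ℂ)

theorem mem_isoComp {ι : Type} [DecidableEq ι] {S : Finset ι} {q : ℕ} {x : Coord ι} :
    x ∈ isoComp S q ↔ swapSum S x = (swapEigen S.card q : ℂ) • x :=
  Module.End.mem_eigenspace_iff

theorem isInvariant_isoComp (S : Finset ι) (q : ℕ) : IsInvariant S (isoComp S q) := by
  intro g x hx
  rw [mem_isoComp] at hx ⊢
  rw [swapSum_kronOn_mulVec, hx, mulVec_smul]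

theorem iSup_isoComp (S : Finset ι) : ⨆ (q : ℕ) (_ : 2 * q ≤ S.card), isoComp S q = ⊤ := by
  rw [eq_top_iff]
  refine (IsInvariant.le_iSup_isIrred (S := S) (fun _ _ _ => Submodule.mem_top)).trans ?_
  refine iSup₂_le fun W hW => ?_
  obtain ⟨q, hq, -, h⟩ := hW.2.exists_finrank_eq
  refine le_trans (fun x hx => ?_)
    (le_iSup₂ (f := fun (q : ℕ) (_ : 2 * q ≤ S.card) => isoComp S q) q hq)
  exact mem_isoComp.2 (h x hx)

theorem isoComp_eq_iSup_isIrred {q : ℕ} (hq : 2 * q ≤ S.card) :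
    isoComp S q = ⨆ (W : Submodule ℂ (Coord ι))
      (_ : IsIrred S W ∧ Module.finrank ℂ W = S.card - 2 * q + 1), W := by
  apply le_antisymm
  · refine (isInvariant_isoComp S q).le_iSup_isIrred.trans (iSup₂_le fun W hW => ?_)
    refine le_iSup₂ (f := fun (W : Submodule ℂ (Coord ι))
      (_ : IsIrred S W ∧ Module.finrank ℂ W = S.card - 2 * q + 1) => W) W ⟨hW.2, ?_⟩
    obtain ⟨r, hr, hfin, h⟩ := hW.2.exists_finrank_eq
    obtain ⟨w, hw, hw0⟩ := (Submodule.ne_bot_iff W).1 hW.2.ne_bot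
    have h1 := mem_isoComp.1 (hW.1 hw)
    rw [h w hw] at h1
    have h2 := smul_left_injective ℂ hw0 h1
    rw [hfin, swapEigen_injective hr hq (by exact_mod_cast h2)]
  · refine iSup₂_le fun W hW x hx => ?_
    obtain ⟨r, hr, hfin, h⟩ := hW.1.exists_finrank_eq
    have : r = q := by
      have := hW.2
      omega
    subst this
    exact mem_isoComp.2 (h x hx)

/-- Isotypic components of a representation which in suitable coordinates is the action of
`SL(2, ℂ)` on the tensor factors in `S`. -/
theorem isotypicOfDim_eq_comap {V : Type} [AddCommGroup V] [Module ℂ V]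
    (ρ : Representation ℂ (Matrix.SpecialLinearGroup (Fin 2) ℂ) V) (Φ : V ≃ₗ[ℂ] Coord ι)
    (hΦ : ∀ g x, Φ (ρ g x) = kronOn S (g : Matrix (Fin 2) (Fin 2) ℂ) *ᵥ Φ x)
    {q : ℕ} (hq : 2 * q ≤ S.card) :
    isotypicOfDim ρ (S.card - 2 * q + 1) = (isoComp S q).comap Φ.toLinearMap := by
  have hfin : ∀ W : Submodule ℂ V,
      Module.finrank ℂ (W.map Φ.toLinearMap) = Module.finrank ℂ W := fun W =>
    LinearEquiv.finrank_map_eq Φ W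
  have hΦ' : ∀ g x, ρ g (Φ.symm x) = Φ.symm (kronOn S (g : Matrix (Fin 2) (Fin 2) ℂ) *ᵥ x) := by
    intro g x
    rw [LinearEquiv.eq_symm_apply, hΦ, LinearEquiv.apply_symm_apply]
  rw [isoComp_eq_iSup_isIrred hq, isotypicOfDim]
  apply le_antisymm
  · refine iSup₂_le fun W hW => ?_
    rw [← Submodule.map_le_iff_le_comap]
    refine le_iSup₂ (f := fun (W : Submodule ℂ (Coord ι))
      (_ : IsIrred S W ∧ Module.finrank ℂ W = S.card - 2 * q + 1) => W)
      (W.toSubmodule.map Φ.toLinearMap) ⟨⟨?_, ?_, ?_⟩, (hfin _).trans hW.2⟩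
    · rintro g _ ⟨x, hx, rfl⟩
      exact ⟨ρ g x, W.apply_mem_toSubmodule g hx, hΦ g x⟩
    · intro h0
      have := hfin W.toSubmodule
      rw [h0, hW.2, finrank_bot] at this
      omega
    · intro U hU hinv
      have hUm : ∀ u ∈ U, Φ.symm u ∈ W.toSubmodule := by
        intro u hu
        obtain ⟨x, hx, rfl⟩ := hU hu
        simpa using hx
      let A : Subrepresentation W.toRepresentation :=
        { toSubmodule := (U.comap Φ.toLinearMap).comap W.toSubmodule.subtype
          apply_mem_toSubmodule := by
            intro g v hv
            change Φ (ρ g v) ∈ U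
            rw [hΦ]
            exact hinv g _ hv }
      have hsimple : IsSimpleOrder (Subrepresentation W.toRepresentation) := hW.1
      rcases hsimple.eq_bot_or_eq_top A with h | h
      · left
        rw [eq_bot_iff]
        intro u hu
        have hu' : (⟨Φ.symm u, hUm u hu⟩ : W.toSubmodule) ∈ A.toSubmodule := by
          change Φ (Φ.symm u) ∈ U
          rwa [LinearEquiv.apply_symm_apply]
        rw [h] at hu'
        have h1 : (⟨Φ.symm u, hUm u hu⟩ : W.toSubmodule) = 0 := (Submodule.mem_bot ℂ).1 hu'
        have h2 : Φ.symm u = 0 := congrArg Subtype.val h1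
        simpa using h2
      · right
        refine le_antisymm hU ?_
        rintro _ ⟨x, hx, rfl⟩
        have : (⟨x, hx⟩ : W.toSubmodule) ∈ A.toSubmodule := by
          rw [h]
          exact Submodule.mem_top
        exact this
  · have hcomap : ∀ K : Submodule ℂ (Coord ι),
        K.comap Φ.toLinearMap = K.map Φ.symm.toLinearMap := fun K =>
      (Submodule.map_equiv_eq_comap_symm Φ.symm K).symm
    rw [hcomap, Submodule.map_le_iff_le_comap]
    refine iSup₂_le fun W hW => ?_
    rw [← Submodule.map_le_iff_le_comap, ← hcomap]
    let B : Subrepresentation ρ :=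
      { toSubmodule := W.comap Φ.toLinearMap
        apply_mem_toSubmodule := by
          intro g v hv
          change Φ (ρ g v) ∈ W
          rw [hΦ]
          exact hW.1.invariant g _ hv }
    have hBfin : Module.finrank ℂ B.toSubmodule = S.card - 2 * q + 1 := by
      rw [← hfin, ← hW.2]
      change Module.finrank ℂ ((W.comap Φ.toLinearMap).map Φ.toLinearMap) = _
      rw [Submodule.map_comap_eq_of_surjective Φ.surjective]
    refine le_iSup₂ (f := fun (W : Subrepresentation ρ)
      (_ : W.toRepresentation.IsIrreducible ∧
        Module.finrank ℂ W.toSubmodule = S.card - 2 * q + 1) => W.toSubmodule) B ⟨?_, hBfin⟩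
    have htopbot : (⊥ : Subrepresentation B.toRepresentation) ≠ ⊤ := by
      intro h
      have h1 : (⊥ : Submodule ℂ B.toSubmodule) = ⊤ :=
        congrArg Subrepresentation.toSubmodule h
      have h2 : Module.finrank ℂ B.toSubmodule = 0 := by
        rw [← finrank_top, ← h1, finrank_bot]
      omega
    have : Nontrivial (Subrepresentation B.toRepresentation) := ⟨⊥, ⊤, htopbot⟩
    refine IsSimpleOrder.mk fun A => ?_
    have hU : (A.toSubmodule.map B.toSubmodule.subtype).map Φ.toLinearMap ≤ W := by
      rintro _ ⟨_, ⟨x, _, rfl⟩, rfl⟩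
      exact x.2
    rcases hW.1.eq_bot_or_eq _ hU (by
      rintro g _ ⟨_, ⟨x, hx, rfl⟩, rfl⟩
      exact ⟨ρ g x, ⟨B.toRepresentation g x, A.apply_mem_toSubmodule g hx, rfl⟩, hΦ g x⟩)
      with h | h
    · left
      apply Subrepresentation.toSubmodule_injective
      change A.toSubmodule = ⊥
      rw [eq_bot_iff]
      intro x hx
      have hx' : Φ x ∈ (A.toSubmodule.map B.toSubmodule.subtype).map Φ.toLinearMap :=
        ⟨x, ⟨x, hx, rfl⟩, rfl⟩
      rw [h, Submodule.mem_bot, LinearEquiv.map_eq_zero_iff] at hx'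
      exact (Submodule.mem_bot ℂ).2 (Subtype.ext hx')
    · right
      apply Subrepresentation.toSubmodule_injective
      change A.toSubmodule = ⊤
      rw [eq_top_iff]
      rintro x -
      have hx : Φ x ∈ (A.toSubmodule.map B.toSubmodule.subtype).map Φ.toLinearMap := by
        rw [h]
        exact x.2
      obtain ⟨_, ⟨y, hy, rfl⟩, hxy⟩ := hx
      have : y = x := Subtype.ext (Φ.injective hxy)
      rwa [← this]

end

/-! ### The tensor powers in coordinates -/

/-- The coordinates of a tensor in the standard basis. -/
noncomputable def coord (N : ℕ) : TensorPow N ≃ₗ[ℂ] Coord (Fin N) := (stdBasis N).equivFun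

theorem tensorInner_eq {N : ℕ} (x y : TensorPow N) :
    tensorInner x y = star (coord N x) ⬝ᵥ coord N y := rfl

/-- The matrix of a tensor product of linear maps is the Kronecker product of the matrices. -/
theorem coord_map {N : ℕ} (M : Fin N → Matrix (Fin 2) (Fin 2) ℂ) (x : TensorPow N) :
    coord N (PiTensorProduct.map (fun k => Matrix.toLin' (M k)) x) = kron M *ᵥ coord N x := by
  induction x using PiTensorProduct.induction_on with
  | smul_tprod r v =>
    rw [map_smul, map_smul, map_smul, mulVec_smul, PiTensorProduct.map_tprod]
    congr 1
    ext i
    simp only [coord, Module.Basis.equivFun_apply, stdBasis,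
      Basis.piTensorProduct_repr_tprod_apply, Pi.basisFun_repr, mulVec, dotProduct, kron_apply,
      toLin'_apply, ← Finset.prod_mul_distrib]
    rw [Finset.prod_univ_sum]
    simp
  | add x y hx hy => rw [map_add, map_add, map_add, hx, hy, mulVec_add]

/-- The first `k` of `N` positions. -/
def firstSet (k N : ℕ) : Finset (Fin N) := Finset.univ.filter fun i => (i : ℕ) < k

theorem card_firstSet {k N : ℕ} (h : k ≤ N) : (firstSet k N).card = k := by
  rw [firstSet, Fin.card_filter_val_lt, min_eq_right h]

theorem coord_slRepFirst (k N : ℕ) (g : Matrix.SpecialLinearGroup (Fin 2) ℂ) (x : TensorPow N) :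
    coord N (slRepFirst k N g x) =
      kronOn (firstSet k N) (g : Matrix (Fin 2) (Fin 2) ℂ) *ᵥ coord N x := by
  rw [kronOn, ← coord_map]
  congr 1
  change PiTensorProduct.map _ x = _
  congr 2
  funext i
  by_cases h : (i : ℕ) < k <;> simp [h, firstSet]

theorem coord_slRep (N : ℕ) (g : Matrix.SpecialLinearGroup (Fin 2) ℂ) (x : TensorPow N) :
    coord N (slRep N g x) =
      kronOn Finset.univ (g : Matrix (Fin 2) (Fin 2) ℂ) *ᵥ coord N x := by
  rw [kronOn_univ, ← coord_map]
  rfl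

theorem coord_permAct {N : ℕ} (σ : Equiv.Perm (Fin N)) (x : TensorPow N) :
    coord N (permAct σ x) = permOp σ (coord N x) := by
  induction x using PiTensorProduct.induction_on with
  | smul_tprod r v =>
    rw [map_smul, map_smul, map_smul, map_smul]
    congr 1
    ext i
    change coord N (PiTensorProduct.reindex ℂ _ σ (PiTensorProduct.tprod ℂ v)) i = _
    rw [PiTensorProduct.reindex_tprod, permOp_apply]
    simp only [coord, Module.Basis.equivFun_apply, stdBasis,
      Basis.piTensorProduct_repr_tprod_apply, Pi.basisFun_repr]
    refine Fintype.prod_equiv σ.symm _ _ fun k => ?_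
    simp
  | add x y hx hy => rw [map_add, map_add, map_add, hx, hy, map_add]

theorem mem_component_iff {N : ℕ} {μ : YoungDiagram} (h : μ.rowLen 0 + μ.rowLen 1 = N)
    {x : TensorPow N} :
    x ∈ component N μ ↔ coord N x ∈ isoComp Finset.univ (μ.rowLen 1) := by
  have hle : μ.rowLen 1 ≤ μ.rowLen 0 := μ.rowLen_anti 0 1 zero_le_one
  have hc : (Finset.univ : Finset (Fin N)).card = N := by simp
  have := isotypicOfDim_eq_comap (S := Finset.univ) (slRep N) (coord N) (coord_slRep N)
    (q := μ.rowLen 1) (by omega)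
  rw [hc, show N - 2 * μ.rowLen 1 = μ.rowLen 0 - μ.rowLen 1 by omega] at this
  rw [component, this]
  rfl

theorem mem_componentFirst_iff {k N : ℕ} (hk : k ≤ N) {ν : YoungDiagram}
    (h : ν.rowLen 0 + ν.rowLen 1 = k) {x : TensorPow N} :
    x ∈ componentFirst k N ν ↔ coord N x ∈ isoComp (firstSet k N) (ν.rowLen 1) := by
  have hle : ν.rowLen 1 ≤ ν.rowLen 0 := ν.rowLen_anti 0 1 zero_le_one
  have hc := card_firstSet hk
  have := isotypicOfDim_eq_comap (S := firstSet k N) (slRepFirst k N) (coord N)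
    (coord_slRepFirst k N) (q := ν.rowLen 1) (by omega)
  rw [hc, show k - 2 * ν.rowLen 1 = ν.rowLen 0 - ν.rowLen 1 by omega] at this
  rw [componentFirst, this]
  rfl

/-! ### Two additional tensor factors -/

/-- The multi-index `i` followed by the two values `a` and `b`. -/
def extendIdx {N : ℕ} (i : Fin N → Fin 2) (a b : Fin 2) : Fin (N + 2) → Fin 2 :=
  Fin.append i ![a, b]

@[simp] theorem extendIdx_castAdd {N : ℕ} (i : Fin N → Fin 2) (a b : Fin 2) (k : Fin N) :
    extendIdx i a b (Fin.castAdd 2 k) = i k := Fin.append_left _ _ _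

@[simp] theorem extendIdx_natAdd_zero {N : ℕ} (i : Fin N → Fin 2) (a b : Fin 2) :
    extendIdx i a b (Fin.natAdd N 0) = a := Fin.append_right _ _ _

@[simp] theorem extendIdx_natAdd_one {N : ℕ} (i : Fin N → Fin 2) (a b : Fin 2) :
    extendIdx i a b (Fin.natAdd N 1) = b := Fin.append_right _ _ _

theorem forall_fin_add_two {N : ℕ} {p : Fin (N + 2) → Prop} (h : ∀ k : Fin N, p (Fin.castAdd 2 k))
    (h0 : p (Fin.natAdd N 0)) (h1 : p (Fin.natAdd N 1)) (m : Fin (N + 2)) : p m := by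
  refine Fin.addCases h (fun c => ?_) m
  fin_cases c
  · exact h0
  · exact h1

theorem exists_eq_extendIdx {N : ℕ} (j : Fin (N + 2) → Fin 2) :
    ∃ i a b, j = extendIdx i a b := by
  refine ⟨fun k => j (Fin.castAdd 2 k), j (Fin.natAdd N 0), j (Fin.natAdd N 1), ?_⟩
  ext1 m
  induction m using forall_fin_add_two <;> simp

@[simp] theorem permExtend_castAdd {N : ℕ} (σ : Equiv.Perm (Fin N)) (k : Fin N) :
    permExtend σ (Fin.castAdd 2 k) = Fin.castAdd 2 (σ k) := by
  simp [permExtend, Equiv.permCongr_apply]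

@[simp] theorem permExtend_natAdd {N : ℕ} (σ : Equiv.Perm (Fin N)) (c : Fin 2) :
    permExtend σ (Fin.natAdd N c) = Fin.natAdd N c := by
  simp [permExtend, Equiv.permCongr_apply]

theorem extendIdx_comp_permExtend {N : ℕ} (i : Fin N → Fin 2) (a b : Fin 2)
    (σ : Equiv.Perm (Fin N)) : extendIdx i a b ∘ permExtend σ = extendIdx (i ∘ σ) a b := by
  ext1 m
  induction m using forall_fin_add_two <;> simp

theorem sum_extendIdx {N : ℕ} (f : (Fin (N + 2) → Fin 2) → ℂ) :
    ∑ j, f j = ∑ i, ∑ a, ∑ b, f (extendIdx i a b) := by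
  have h1 : ∑ j, f j = ∑ p : (Fin N → Fin 2) × (Fin 2 → Fin 2), f (Fin.append p.1 p.2) :=
    (Fintype.sum_equiv (Fin.appendEquiv N 2) _ _ fun p => rfl).symm
  rw [h1, Fintype.sum_prod_type]
  refine Finset.sum_congr rfl fun i _ => ?_
  rw [← Fintype.sum_prod_type' (f := fun a b => f (extendIdx i a b))]
  refine Fintype.sum_equiv (finTwoArrowEquiv (Fin 2)) _ _ fun c => ?_
  congr 2
  ext1 m
  fin_cases m <;> rfl

/-- The part of a tensor with `N + 2` factors at which the last two indices are `a` and `b`. -/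
def slice {N : ℕ} (a b : Fin 2) : Coord (Fin (N + 2)) →ₗ[ℂ] Coord (Fin N) :=
  LinearMap.funLeft ℂ ℂ fun i => extendIdx i a b

theorem slice_apply {N : ℕ} (a b : Fin 2) (y : Coord (Fin (N + 2))) (i : Fin N → Fin 2) :
    slice a b y i = y (extendIdx i a b) := rfl

theorem slice_kron {N : ℕ} (a b : Fin 2) (g : Matrix (Fin 2) (Fin 2) ℂ)
    (y : Coord (Fin (N + 2))) :
    slice a b (kron (fun _ => g) *ᵥ y) =
      ∑ a', ∑ b', (g a a' * g b b') • (kron (fun _ => g) *ᵥ slice a' b' y) := by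
  ext i
  simp only [slice_apply, mulVec, dotProduct, Finset.sum_apply, Pi.smul_apply, smul_eq_mul,
    Finset.mul_sum]
  rw [sum_extendIdx, Finset.sum_comm]
  refine Finset.sum_congr rfl fun a' _ => ?_
  rw [Finset.sum_comm]
  refine Finset.sum_congr rfl fun b' _ => Finset.sum_congr rfl fun j _ => ?_
  rw [kron_apply, Fin.prod_univ_add, Fin.prod_univ_two, kron_apply]
  simp only [extendIdx_castAdd, extendIdx_natAdd_zero, extendIdx_natAdd_one]
  ring

/-! ### A bound for the space of equivariant maps -/

/-- Two functions on a finite set that take each value equally often differ by a permutation. -/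
theorem exists_perm_of_card_fiber_eq {α β : Type} [Fintype α] [DecidableEq β] {c c' : α → β}
    (h : ∀ z, Fintype.card {k // c k = z} = Fintype.card {k // c' k = z}) :
    ∃ σ : Equiv.Perm α, c = c' ∘ σ := by
  refine ⟨Equiv.ofFiberEquiv fun z => Fintype.equivOfCardEq (h z), ?_⟩
  funext a
  exact (Equiv.ofFiberEquiv_map _ a).symm

/-- The matrices that have nonzero discriminant and nonzero upper right entry are diagonalized
by elements of `SL(2, ℂ)`. -/
theorem exists_mul_eq_mul_diagonal (X : Matrix (Fin 2) (Fin 2) ℂ) (h01 : X 0 1 ≠ 0)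
    (hdisc : (X 0 0 - X 1 1) ^ 2 + 4 * X 0 1 * X 1 0 ≠ 0) :
    ∃ (g : Matrix.SpecialLinearGroup (Fin 2) ℂ) (d : Fin 2 → ℂ),
      X * (g : Matrix (Fin 2) (Fin 2) ℂ) = (g : Matrix (Fin 2) (Fin 2) ℂ) * diagonal d := by
  obtain ⟨δ, hδ⟩ := IsAlgClosed.exists_pow_nat_eq
    ((X 0 0 - X 1 1) ^ 2 + 4 * X 0 1 * X 1 0) (n := 2) (by norm_num)
  have hδ0 : δ ≠ 0 := by
    rintro rfl
    exact hdisc (by rw [← hδ]; norm_num)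
  refine ⟨⟨!![X 0 1, -1 / δ; (X 1 1 - X 0 0 + δ) / 2,
    -((X 1 1 - X 0 0 - δ) / 2) / (X 0 1 * δ)], ?_⟩,
    ![(X 0 0 + X 1 1 + δ) / 2, (X 0 0 + X 1 1 - δ) / 2], ?_⟩
  · rw [det_fin_two]
    simp only [of_apply, cons_val', cons_val_zero, cons_val_one, cons_val_fin_one]
    field_simp
    ring
  · ext i j
    fin_cases i <;> fin_cases j <;>
      simp [Matrix.mul_apply, Fin.sum_univ_two]
    · ring
    · field_simp
      ring
    · linear_combination (-1 / 4 : ℂ) * hδ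
    · field_simp
      linear_combination hδ

/-- A polynomial function on `2 × 2` matrices that vanishes on a nonempty Zariski open set is
zero. -/
theorem mvPolynomial_eq_zero_of_eval {p : MvPolynomial (Fin 2 × Fin 2) ℂ}
    (h : ∀ x : Fin 2 × Fin 2 → ℂ, x (0, 1) ≠ 0 →
      (x (0, 0) - x (1, 1)) ^ 2 + 4 * x (0, 1) * x (1, 0) ≠ 0 → MvPolynomial.eval x p = 0) :
    p = 0 := by
  obtain ⟨D, hD⟩ : ∃ D : MvPolynomial (Fin 2 × Fin 2) ℂ, ∀ x, MvPolynomial.eval x D =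
      x (0, 1) * ((x (0, 0) - x (1, 1)) ^ 2 + 4 * x (0, 1) * x (1, 0)) :=
    ⟨MvPolynomial.X (0, 1) * ((MvPolynomial.X (0, 0) - MvPolynomial.X (1, 1)) ^ 2 +
      MvPolynomial.C 4 * MvPolynomial.X (0, 1) * MvPolynomial.X (1, 0)), fun x => by
        simp only [map_mul, map_add, map_sub, map_pow, MvPolynomial.eval_X, MvPolynomial.eval_C]⟩
  have hpD : p * D = 0 := by
    refine MvPolynomial.funext fun x => ?_
    rw [map_mul, map_zero, hD]
    by_cases h1 : x (0, 1) = 0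
    · rw [h1, zero_mul, mul_zero]
    by_cases h2 : (x (0, 0) - x (1, 1)) ^ 2 + 4 * x (0, 1) * x (1, 0) = 0
    · rw [h2, mul_zero, mul_zero]
    · rw [h x h1 h2, zero_mul]
  refine (mul_eq_zero.1 hpD).resolve_right fun h0 => ?_
  have h1 := hD fun z => if z = (0, 1) ∨ z = (1, 0) then 1 else 0
  rw [h0] at h1
  norm_num at h1

section

variable {N : ℕ} {F : Coord (Fin N) →ₗ[ℂ] Coord (Fin (N + 2))}

/-- The components `Tr (X^{⊗N} F_{ab})` of the polynomial function on `2 × 2` matrices that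
corresponds to a linear map `F` from `N`-fold to `(N + 2)`-fold tensors. -/
def tracePoly (F : Coord (Fin N) →ₗ[ℂ] Coord (Fin (N + 2))) (a b : Fin 2)
    (X : Matrix (Fin 2) (Fin 2) ℂ) : ℂ :=
  trace (kron (fun _ => X) * LinearMap.toMatrix' (slice a b ∘ₗ F))

theorem tracePoly_conj
    (hF : ∀ (g : Matrix.SpecialLinearGroup (Fin 2) ℂ) x,
      F (kron (fun _ => (g : Matrix (Fin 2) (Fin 2) ℂ)) *ᵥ x) =
        kron (fun _ => (g : Matrix (Fin 2) (Fin 2) ℂ)) *ᵥ F x)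
    (g : Matrix.SpecialLinearGroup (Fin 2) ℂ) {X Y : Matrix (Fin 2) (Fin 2) ℂ}
    (hXY : X * (g : Matrix (Fin 2) (Fin 2) ℂ) = (g : Matrix (Fin 2) (Fin 2) ℂ) * Y)
    (a b : Fin 2) :
    tracePoly F a b X = ∑ a', ∑ b', (g a a' * g b b') * tracePoly F a' b' Y := by
  set K : Matrix (Fin 2) (Fin 2) ℂ → Matrix (Fin N → Fin 2) (Fin N → Fin 2) ℂ :=
    fun X => kron fun _ => X
  have hK : ∀ X Y, K (X * Y) = K X * K Y := fun X Y => (kron_mul _ _).symm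
  have hM : LinearMap.toMatrix' (slice a b ∘ₗ F) * K g =
      ∑ a', ∑ b', (g a a' * g b b') • (K g * LinearMap.toMatrix' (slice a' b' ∘ₗ F)) := by
    refine Matrix.toLin'.injective (LinearMap.ext fun x => ?_)
    simp only [map_sum, map_smul, toLin'_mul, toLin'_toMatrix', LinearMap.sum_apply,
      LinearMap.comp_apply, LinearMap.smul_apply, toLin'_apply, K]
    rw [hF, slice_kron]
  have hg : (g : Matrix (Fin 2) (Fin 2) ℂ) * ((g⁻¹ : Matrix.SpecialLinearGroup (Fin 2) ℂ) :
      Matrix (Fin 2) (Fin 2) ℂ) = 1 := by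
    rw [← Matrix.SpecialLinearGroup.coe_mul, mul_inv_cancel, Matrix.SpecialLinearGroup.coe_one]
  have hg' : ((g⁻¹ : Matrix.SpecialLinearGroup (Fin 2) ℂ) : Matrix (Fin 2) (Fin 2) ℂ) *
      (g : Matrix (Fin 2) (Fin 2) ℂ) = 1 := by
    rw [← Matrix.SpecialLinearGroup.coe_mul, inv_mul_cancel, Matrix.SpecialLinearGroup.coe_one]
  have hX : X = (g : Matrix (Fin 2) (Fin 2) ℂ) * Y *
      ((g⁻¹ : Matrix.SpecialLinearGroup (Fin 2) ℂ) : Matrix (Fin 2) (Fin 2) ℂ) := by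
    rw [← hXY, Matrix.mul_assoc, hg, Matrix.mul_one]
  have hK1 : K ((g⁻¹ : Matrix.SpecialLinearGroup (Fin 2) ℂ) : Matrix (Fin 2) (Fin 2) ℂ) * K g
      = 1 := by
    rw [← hK, hg']
    exact kron_one
  have h1 : tracePoly F a b X = trace (K X * LinearMap.toMatrix' (slice a b ∘ₗ F)) := rfl
  rw [h1, hX, hK, hK, Matrix.mul_assoc, Matrix.mul_assoc, trace_mul_comm, Matrix.mul_assoc,
    Matrix.mul_assoc, hM]
  simp only [Matrix.mul_sum, Matrix.mul_smul, trace_sum, trace_smul, smul_eq_mul]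
  refine Finset.sum_congr rfl fun a' _ => Finset.sum_congr rfl fun b' _ => ?_
  congr 1
  rw [← Matrix.mul_assoc (K _) (K g), hK1, Matrix.one_mul]
  rfl

theorem tracePoly_diagonal (d : Fin 2 → ℂ)
    (h : ∀ i, F (Pi.single i 1) (extendIdx i 0 1) = 0) : tracePoly F 0 1 (diagonal d) = 0 := by
  rw [tracePoly, trace]
  refine Finset.sum_eq_zero fun i _ => ?_
  rw [diag_apply, Matrix.mul_apply]
  refine Finset.sum_eq_zero fun j _ => ?_
  by_cases hij : i = j
  · subst hij
    have h1 : LinearMap.toMatrix' (slice 0 1 ∘ₗ F) i i = 0 := by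
      rw [LinearMap.toMatrix'_apply, LinearMap.comp_apply, slice_apply]
      exact h i
    rw [h1, mul_zero]
  · obtain ⟨k, hk⟩ := Function.ne_iff.1 hij
    have h1 : kron (fun _ => diagonal d) i j = 0 :=
      Finset.prod_eq_zero (Finset.mem_univ k) (diagonal_apply_ne d hk)
    rw [h1, zero_mul]

/-- The polynomial function of an equivariant map is determined by its `(0, 1)`-component on
diagonal matrices: the torus kills the `(a, a)`-components and the Weyl element relates the
`(1, 0)`-component to the `(0, 1)`-component there, and almost every matrix is diagonalizable. -/
theorem tracePoly_eq_zero
    (hF : ∀ (g : Matrix.SpecialLinearGroup (Fin 2) ℂ) x,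
      F (kron (fun _ => (g : Matrix (Fin 2) (Fin 2) ℂ)) *ᵥ x) =
        kron (fun _ => (g : Matrix (Fin 2) (Fin 2) ℂ)) *ᵥ F x)
    (h : ∀ i, F (Pi.single i 1) (extendIdx i 0 1) = 0) (a b : Fin 2)
    {X : Matrix (Fin 2) (Fin 2) ℂ} (h01 : X 0 1 ≠ 0)
    (hdisc : (X 0 0 - X 1 1) ^ 2 + 4 * X 0 1 * X 1 0 ≠ 0) : tracePoly F a b X = 0 := by
  obtain ⟨g, d, hg⟩ := exists_mul_eq_mul_diagonal X h01 hdisc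
  have hdiag : ∀ d a b, tracePoly F a b (diagonal d) = 0 := by
    intro d
    have ht : diagonal d * (torus (Units.mk0 2 two_ne_zero) : Matrix (Fin 2) (Fin 2) ℂ) =
        (torus (Units.mk0 2 two_ne_zero) : Matrix (Fin 2) (Fin 2) ℂ) * diagonal d := by
      ext i j
      fin_cases i <;> fin_cases j <;> simp [torus, Matrix.mul_apply, Fin.sum_univ_two, mul_comm]
    let w : Matrix.SpecialLinearGroup (Fin 2) ℂ := ⟨!![0, 1; -1, 0], by simp [det_fin_two]⟩
    have hw : diagonal ![d 1, d 0] * (w : Matrix (Fin 2) (Fin 2) ℂ) =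
        (w : Matrix (Fin 2) (Fin 2) ℂ) * diagonal d := by
      ext i j
      fin_cases i <;> fin_cases j <;> simp [w, Matrix.mul_apply, Fin.sum_univ_two]
    -- The torus element `diag(2, 1/2)` commutes with `diagonal d` and multiplies the
    -- `(a, a)`-component by `4` or `1/4`.
    have h1 := fun a => tracePoly_conj hF _ ht a a
    have h2 := tracePoly_conj hF _ hw 0 1
    rw [tracePoly_diagonal _ h] at h2
    have h00 := h1 0
    have h11 := h1 1
    simp [torus, Fin.sum_univ_two] at h00 h11
    simp [w, Fin.sum_univ_two] at h2
    intro a b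
    fin_cases a <;> fin_cases b
    · change tracePoly F 0 0 (diagonal d) = 0
      linear_combination (-1 / 3 : ℂ) * h00
    · exact tracePoly_diagonal _ h
    · change tracePoly F 1 0 (diagonal d) = 0
      linear_combination h2
    · change tracePoly F 1 1 (diagonal d) = 0
      linear_combination (4 / 3 : ℂ) * h11
  rw [tracePoly_conj hF g hg]
  simp [hdiag]

/-- An equivariant map with vanishing diagonal `(0, 1)`-entries is zero. -/
theorem eq_zero_of_equivariant
    (hperm : ∀ σ x, F (permOp σ x) = permOp (permExtend σ) (F x))
    (hF : ∀ (g : Matrix.SpecialLinearGroup (Fin 2) ℂ) x,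
      F (kron (fun _ => (g : Matrix (Fin 2) (Fin 2) ℂ)) *ᵥ x) =
        kron (fun _ => (g : Matrix (Fin 2) (Fin 2) ℂ)) *ᵥ F x)
    (h : ∀ i, F (Pi.single i 1) (extendIdx i 0 1) = 0) : F = 0 := by
  classical
  have hsymm : ∀ (σ : Equiv.Perm (Fin N)) i j a b,
      F (Pi.single (i ∘ σ) 1) (extendIdx (j ∘ σ) a b) =
        F (Pi.single i 1) (extendIdx j a b) := by
    intro σ i j a b
    have h1 : permOp σ (Pi.single (i ∘ σ) 1) = (Pi.single i 1 : Coord (Fin N)) := by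
      ext m
      rw [permOp_apply, Pi.single_apply, Pi.single_apply]
      simp only [σ.surjective.injective_comp_right.eq_iff]
    rw [← h1, hperm, permOp_apply, extendIdx_comp_permExtend]
  have key : ∀ a b i j, F (Pi.single j 1) (extendIdx i a b) = 0 := by
    intro a b i₀ j₀
    let mon : (Fin N → Fin 2) → (Fin N → Fin 2) → (Fin 2 × Fin 2) →₀ ℕ :=
      fun i j => ∑ k, Finsupp.single (j k, i k) 1
    let p : MvPolynomial (Fin 2 × Fin 2) ℂ :=
      ∑ i, ∑ j, MvPolynomial.monomial (mon i j) (F (Pi.single j 1) (extendIdx i a b))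
    have heval : ∀ x : Fin 2 × Fin 2 → ℂ,
        MvPolynomial.eval x p = tracePoly F a b (Matrix.of fun c d => x (c, d)) := by
      intro x
      simp only [p, map_sum, MvPolynomial.eval_monomial]
      rw [Finset.sum_comm, tracePoly, trace]
      refine Finset.sum_congr rfl fun j _ => ?_
      rw [diag_apply, Matrix.mul_apply]
      refine Finset.sum_congr rfl fun i _ => ?_
      rw [LinearMap.toMatrix'_apply, LinearMap.comp_apply, slice_apply, mul_comm]
      congr 1
      simp only [mon]
      rw [← Finsupp.prod_finsetSum_index (fun _ => pow_zero _) (fun _ _ _ => pow_add _ _ _)]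
      simp only [Finsupp.prod_single_index, pow_zero, pow_one]
      rfl
    have hp : p = 0 := by
      refine mvPolynomial_eq_zero_of_eval fun x h01 hdisc => ?_
      rw [heval]
      exact tracePoly_eq_zero hF h a b h01 hdisc
    -- all the terms that contribute to the coefficient of a monomial are equal
    have hterm : ∀ i j, mon i j = mon i₀ j₀ →
        F (Pi.single j 1) (extendIdx i a b) = F (Pi.single j₀ 1) (extendIdx i₀ a b) := by
      intro i j hij
      have hfib : ∀ (i j : Fin N → Fin 2) z,
          mon i j z = Fintype.card {k // (j k, i k) = z} := by
        intro i j z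
        simp only [mon, Finsupp.coe_finsetSum, Finset.sum_apply, Finsupp.single_apply]
        rw [Finset.sum_boole, Fintype.card_subtype]
        rfl
      obtain ⟨σ, hσ⟩ := exists_perm_of_card_fiber_eq (c := fun k => (j k, i k))
        (c' := fun k => (j₀ k, i₀ k)) (fun z => by rw [← hfib, ← hfib, hij])
      have hj : j = j₀ ∘ σ := funext fun k => congrArg Prod.fst (congrFun hσ k)
      have hi : i = i₀ ∘ σ := funext fun k => congrArg Prod.snd (congrFun hσ k)
      rw [hj, hi, hsymm]
    have hcoeff : MvPolynomial.coeff (mon i₀ j₀) p = 0 := by rw [hp, MvPolynomial.coeff_zero]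
    have hcoeff' : MvPolynomial.coeff (mon i₀ j₀) p =
        ∑ i, ∑ j, (if mon i j = mon i₀ j₀ then 1 else 0) *
          F (Pi.single j₀ 1) (extendIdx i₀ a b) := by
      simp only [p, MvPolynomial.coeff_sum, MvPolynomial.coeff_monomial]
      refine Finset.sum_congr rfl fun i _ => Finset.sum_congr rfl fun j _ => ?_
      split_ifs with hij
      · rw [one_mul, hterm i j hij]
      · rw [zero_mul]
    rw [hcoeff'] at hcoeff
    simp only [← Finset.sum_mul] at hcoeff
    refine (mul_eq_zero.1 hcoeff).resolve_left ?_
    simp only [Finset.sum_boole]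
    rw [← Nat.cast_sum]
    refine Nat.cast_ne_zero.2 (ne_of_gt (Finset.sum_pos' (fun _ _ => Nat.zero_le _)
      ⟨i₀, Finset.mem_univ _, Finset.card_pos.2 ⟨j₀, by simp⟩⟩))
  refine LinearMap.pi_ext' fun j => LinearMap.ext_ring ?_
  ext m
  obtain ⟨i, a, b, rfl⟩ := exists_eq_extendIdx m
  simpa using key a b i j

end

/-- The space of linear maps from `N`-fold to `(N + 2)`-fold tensors that are equivariant under
`𝔖_N × SL(2, ℂ)`, in coordinates. -/
def equivariantMaps (N : ℕ) : Submodule ℂ (Coord (Fin N) →ₗ[ℂ] Coord (Fin (N + 2))) where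
  carrier := {F | (∀ σ x, F (permOp σ x) = permOp (permExtend σ) (F x)) ∧
    ∀ (g : Matrix.SpecialLinearGroup (Fin 2) ℂ) x,
      F (kron (fun _ => (g : Matrix (Fin 2) (Fin 2) ℂ)) *ᵥ x) =
        kron (fun _ => (g : Matrix (Fin 2) (Fin 2) ℂ)) *ᵥ F x}
  add_mem' hf hg := ⟨fun σ x => by simp [hf.1 σ x, hg.1 σ x],
    fun s x => by simp [hf.2 s x, hg.2 s x, mulVec_add]⟩
  zero_mem' := ⟨fun σ x => by simp, fun s x => by simp⟩
  smul_mem' c f hf := ⟨fun σ x => by simp [hf.1 σ x], fun s x => by simp [hf.2 s x, mulVec_smul]⟩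

/-- The multi-index `(1, …, 1, 0, …, 0)` with `m` ones. -/
def onesIdx (N m : ℕ) : Fin N → Fin 2 := fun k => if (k : ℕ) < m then 1 else 0

theorem exists_eq_onesIdx_comp {N : ℕ} (i : Fin N → Fin 2) :
    ∃ m : Fin (N + 1), ∃ σ : Equiv.Perm (Fin N), i = onesIdx N m ∘ σ := by
  have hle : count 1 Finset.univ i ≤ N := by
    simpa using count_le_card 1 Finset.univ i
  refine ⟨⟨count 1 Finset.univ i, by omega⟩, exists_perm_of_card_fiber_eq fun z => ?_⟩
  have h1 := count_zero_add_count_one Finset.univ i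
  have h2 := count_zero_add_count_one Finset.univ (onesIdx N (count 1 Finset.univ i))
  have h3 : count 1 Finset.univ (onesIdx N (count 1 Finset.univ i)) = count 1 Finset.univ i := by
    have : (Finset.univ.filter fun k => onesIdx N (count 1 Finset.univ i) k = 1) =
        firstSet (count 1 Finset.univ i) N := by
      ext k
      by_cases hk : (k : ℕ) < count 1 Finset.univ i <;> simp [onesIdx, firstSet, hk]
    rw [count, this, card_firstSet hle]
  have h4 : count z Finset.univ i =
      count z Finset.univ (onesIdx N (count 1 Finset.univ i)) := by
    fin_cases z
    · change count 0 _ _ = count 0 _ _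
      omega
    · exact h3.symm
  rw [Fintype.card_subtype, Fintype.card_subtype]
  exact h4

theorem finrank_equivariantMaps_le (N : ℕ) : Module.finrank ℂ (equivariantMaps N) ≤ N + 1 := by
  let φ : equivariantMaps N →ₗ[ℂ] (Fin (N + 1) → ℂ) :=
    { toFun := fun F m => F.1 (Pi.single (onesIdx N m) 1) (extendIdx (onesIdx N m) 0 1)
      map_add' := fun f g => by ext m; simp
      map_smul' := fun c f => by ext m; simp }
  have hφ : Function.Injective φ := by
    rw [injective_iff_map_eq_zero]
    intro F hF
    refine Subtype.ext (eq_zero_of_equivariant F.2.1 F.2.2 fun i => ?_)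
    obtain ⟨m, σ, rfl⟩ := exists_eq_onesIdx_comp i
    have h1 : permOp σ (Pi.single (onesIdx N m ∘ σ) 1) =
        (Pi.single (onesIdx N m) 1 : Coord (Fin N)) := by
      ext i
      rw [permOp_apply, Pi.single_apply, Pi.single_apply]
      simp only [σ.surjective.injective_comp_right.eq_iff]
    have h2 := congrFun (F.2.1 σ (Pi.single (onesIdx N m ∘ σ) 1)) (extendIdx (onesIdx N m) 0 1)
    rw [permOp_apply, extendIdx_comp_permExtend, h1] at h2
    rw [← h2]
    exact congrFun hF m
  have h := LinearMap.finrank_le_finrank_of_injective hφ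
  simpa using h

/-! ### Jucys–Murphy elements -/

/-- The Jucys–Murphy element: the sum of the transpositions `(k a)` with `k ∈ S`. -/
noncomputable def jucysMurphy {ι : Type} [DecidableEq ι] (S : Finset ι) (a : ι) :
    Coord ι →ₗ[ℂ] Coord ι :=
  ∑ k ∈ S, permOp (Equiv.swap k a)

section

variable {ι : Type} [DecidableEq ι]

theorem jucysMurphy_apply (S : Finset ι) (a : ι) (x : Coord ι) :
    jucysMurphy S a x = ∑ k ∈ S, permOp (Equiv.swap k a) x := by
  rw [jucysMurphy, LinearMap.sum_apply]

theorem swapSum_insert {S : Finset ι} {a : ι} (ha : a ∉ S) (x : Coord ι) :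
    swapSum (insert a S) x = swapSum S x + (2 : ℂ) • jucysMurphy S a x + x := by
  simp only [swapSum, jucysMurphy_apply, LinearMap.sum_apply, Finset.sum_insert ha,
    Finset.sum_add_distrib, Equiv.swap_self, LinearMap.add_apply]
  have h1 : ∑ k ∈ S, permOp (Equiv.swap a k) x = ∑ k ∈ S, permOp (Equiv.swap k a) x :=
    Finset.sum_congr rfl fun k _ => by rw [Equiv.swap_comm]
  have h2 : permOp (Equiv.refl ι) x = x := rfl
  rw [h1, h2, two_smul]
  abel

/-- Antisymmetrization over three factors of `ℂ²` vanishes. -/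
theorem permOp_swap_add_permOp_swap {k l a : ι} (hkl : k ≠ l) (hka : k ≠ a) (hla : l ≠ a)
    (x : Coord ι) :
    permOp (Equiv.swap k a) (permOp (Equiv.swap l a) x) +
        permOp (Equiv.swap l a) (permOp (Equiv.swap k a) x) =
      permOp (Equiv.swap k l) x + permOp (Equiv.swap k a) x + permOp (Equiv.swap l a) x - x := by
  ext i
  simp only [Pi.add_apply, Pi.sub_apply, permOp_apply]
  have hcase : i k = i l ∨ i k = i a ∨ i l = i a := by omega
  have hext : ∀ {j j' : ι → Fin 2}, j k = j' k → j l = j' l → j a = j' a →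
      (∀ m, m ≠ k → m ≠ l → m ≠ a → j m = j' m) → j = j' := by
    intro j j' h1 h2 h3 h4
    ext1 m
    by_cases hk : m = k
    · rw [hk, h1]
    by_cases hl : m = l
    · rw [hl, h2]
    by_cases hm : m = a
    · rw [hm, h3]
    exact h4 m hk hl hm
  rcases hcase with h | h | h
  · have h1 : i ∘ Equiv.swap k l = i := by
      apply hext <;> intros <;> simp [Equiv.swap_apply_def, *, Ne.symm]
    have h2 : (i ∘ Equiv.swap k a) ∘ Equiv.swap l a = i ∘ Equiv.swap k a := by
      apply hext <;> intros <;> simp [Equiv.swap_apply_def, *, Ne.symm]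
    have h3 : (i ∘ Equiv.swap l a) ∘ Equiv.swap k a = i ∘ Equiv.swap l a := by
      apply hext <;> intros <;> simp [Equiv.swap_apply_def, *, Ne.symm]
    rw [h1, h2, h3]
    ring
  · have h1 : i ∘ Equiv.swap k a = i := by
      apply hext <;> intros <;> simp [Equiv.swap_apply_def, *, Ne.symm]
    have h2 : (i ∘ Equiv.swap l a) ∘ Equiv.swap k a = i ∘ Equiv.swap k l := by
      apply hext <;> intros <;> simp [Equiv.swap_apply_def, *, Ne.symm]
    rw [h1, h2]
    ring
  · have h1 : i ∘ Equiv.swap l a = i := by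
      apply hext <;> intros <;> simp [Equiv.swap_apply_def, *, Ne.symm]
    have h2 : (i ∘ Equiv.swap k a) ∘ Equiv.swap l a = i ∘ Equiv.swap k l := by
      apply hext <;> intros <;> simp [Equiv.swap_apply_def, *, Ne.symm]
    rw [h1, h2]
    ring

/-- The quadratic relation between a Jucys–Murphy element and a swap sum. -/
theorem two_smul_jucysMurphy_jucysMurphy {S : Finset ι} {a : ι} (ha : a ∉ S) (x : Coord ι) :
    (2 : ℂ) • jucysMurphy S a (jucysMurphy S a x) =
      swapSum S x + (2 * ((S.card : ℂ) - 1)) • jucysMurphy S a x +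
        (2 * (S.card : ℂ) - (S.card : ℂ) ^ 2) • x := by
  have hterm : ∀ k ∈ S, ∀ l ∈ S, permOp (Equiv.swap k a) (permOp (Equiv.swap l a) x) +
        permOp (Equiv.swap l a) (permOp (Equiv.swap k a) x) =
      permOp (Equiv.swap k l) x + permOp (Equiv.swap k a) x + permOp (Equiv.swap l a) x - x +
        if k = l then (2 : ℂ) • x - (2 : ℂ) • permOp (Equiv.swap k a) x else 0 := by
    intro k hk l hl
    have hka : k ≠ a := fun h => ha (h ▸ hk)
    have hla : l ≠ a := fun h => ha (h ▸ hl)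
    split_ifs with h
    · subst h
      rw [permOp_permOp, Equiv.swap_mul_self, permOp_one, Equiv.swap_self]
      have h2 : permOp (Equiv.refl ι) x = x := rfl
      rw [h2, two_smul, two_smul]
      abel
    · rw [permOp_swap_add_permOp_swap h hka hla, add_zero]
  have hJ : (2 : ℂ) • jucysMurphy S a (jucysMurphy S a x) =
      ∑ k ∈ S, ∑ l ∈ S, (permOp (Equiv.swap k a) (permOp (Equiv.swap l a) x) +
        permOp (Equiv.swap l a) (permOp (Equiv.swap k a) x)) := by
    have h1 : jucysMurphy S a (jucysMurphy S a x) =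
        ∑ k ∈ S, ∑ l ∈ S, permOp (Equiv.swap k a) (permOp (Equiv.swap l a) x) := by
      rw [jucysMurphy_apply, jucysMurphy_apply]
      exact Finset.sum_congr rfl fun k _ => map_sum _ _ _
    simp only [Finset.sum_add_distrib]
    rw [two_smul, h1]
    congr 1
    exact Finset.sum_comm
  rw [hJ, Finset.sum_congr rfl fun k hk => Finset.sum_congr rfl fun l hl => hterm k hk l hl]
  simp only [Finset.sum_add_distrib, Finset.sum_sub_distrib, Finset.sum_const, swapSum,
    LinearMap.sum_apply, jucysMurphy_apply, Finset.sum_ite_eq, ← Finset.smul_sum]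
  rw [Finset.sum_congr rfl fun k hk => if_pos hk]
  simp only [Finset.sum_sub_distrib, Finset.sum_const, ← Finset.smul_sum,
    ← Nat.cast_smul_eq_nsmul ℂ]
  module

theorem permOp_jucysMurphy {S : Finset ι} {a : ι} {σ : Equiv.Perm ι} (hσ : ∀ k, σ k ∈ S ↔ k ∈ S)
    (ha : σ a = a) (x : Coord ι) :
    permOp σ (jucysMurphy S a x) = jucysMurphy S a (permOp σ x) := by
  rw [jucysMurphy_apply, jucysMurphy_apply, map_sum]
  refine Finset.sum_equiv σ (fun k => (hσ k).symm) fun k _ => ?_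
  rw [permOp_permOp, permOp_permOp]
  rw [Equiv.mul_swap_eq_swap_mul, ha]

theorem swapSum_jucysMurphy {S : Finset ι} {a : ι} (ha : a ∉ S) (x : Coord ι) :
    swapSum S (jucysMurphy S a x) = jucysMurphy S a (swapSum S x) := by
  simp only [swapSum, LinearMap.sum_apply, map_sum]
  refine Finset.sum_congr rfl fun k hk => Finset.sum_congr rfl fun l hl => ?_
  exact permOp_jucysMurphy (swap_mem_iff hk hl)
    (Equiv.swap_apply_of_ne_of_ne (by rintro rfl; exact ha hk) (by rintro rfl; exact ha hl)) x

theorem star_jucysMurphy_dotProduct [Fintype ι] (S : Finset ι) (a : ι) (x y : Coord ι) :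
    star (jucysMurphy S a x) ⬝ᵥ y = star x ⬝ᵥ jucysMurphy S a y := by
  simp only [jucysMurphy_apply, star_sum, sum_dotProduct, dotProduct_sum]
  refine Finset.sum_congr rfl fun k _ => ?_
  rw [star_permOp_dotProduct, Equiv.swap_inv]

theorem jucysMurphy_kron_mulVec [Fintype ι] (S : Finset ι) (a : ι) (g : Matrix (Fin 2) (Fin 2) ℂ)
    (x : Coord ι) :
    jucysMurphy S a (kron (fun _ => g) *ᵥ x) = kron (fun _ => g) *ᵥ jucysMurphy S a x := by
  simp only [jucysMurphy_apply, mulVec_sum]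
  exact Finset.sum_congr rfl fun k _ => permOp_kron_mulVec _ _ _

theorem star_jucysMurphy (S : Finset ι) (a : ι) (x : Coord ι) :
    jucysMurphy S a (star x) = star (jucysMurphy S a x) := by
  simp only [jucysMurphy_apply, star_sum]
  rfl

theorem star_swapSum (S : Finset ι) (x : Coord ι) :
    swapSum S (star x) = star (swapSum S x) := by
  simp only [swapSum, LinearMap.sum_apply, star_sum]
  rfl

end

/-! ### Tensoring with the invariant of `ℂ² ⊗ ℂ²` -/

/-- The coefficients of the invariant `e₀ ⊗ e₁ - e₁ ⊗ e₀` of `ℂ² ⊗ ℂ²`. -/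
def alt (a b : Fin 2) : ℂ := !![0, 1; -1, 0] a b

/-- The map `x ↦ x ⊗ (e₀ ⊗ e₁ - e₁ ⊗ e₀)`. -/
def tensorAlt (N : ℕ) : Coord (Fin N) →ₗ[ℂ] Coord (Fin (N + 2)) where
  toFun x j := alt (j (Fin.natAdd N 0)) (j (Fin.natAdd N 1)) * x fun k => j (Fin.castAdd 2 k)
  map_add' x y := by
    ext j
    simp [mul_add]
  map_smul' c x := by
    ext j
    simp [mul_left_comm]

section

variable {N : ℕ}

theorem tensorAlt_extendIdx (x : Coord (Fin N)) (i : Fin N → Fin 2) (a b : Fin 2) :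
    tensorAlt N x (extendIdx i a b) = alt a b * x i := by
  simp [tensorAlt]

theorem coord_ext {x y : Coord (Fin (N + 2))}
    (h : ∀ i a b, x (extendIdx i a b) = y (extendIdx i a b)) : x = y := by
  ext j
  obtain ⟨i, a, b, rfl⟩ := exists_eq_extendIdx j
  exact h i a b

theorem permOp_tensorAlt (σ : Equiv.Perm (Fin N)) (x : Coord (Fin N)) :
    permOp (permExtend σ) (tensorAlt N x) = tensorAlt N (permOp σ x) := by
  refine coord_ext fun i a b => ?_
  rw [permOp_apply, extendIdx_comp_permExtend, tensorAlt_extendIdx, tensorAlt_extendIdx,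
    permOp_apply]

theorem kron_mulVec_tensorAlt (g : Matrix.SpecialLinearGroup (Fin 2) ℂ) (x : Coord (Fin N)) :
    kron (fun _ => (g : Matrix (Fin 2) (Fin 2) ℂ)) *ᵥ tensorAlt N x =
      tensorAlt N (kron (fun _ => (g : Matrix (Fin 2) (Fin 2) ℂ)) *ᵥ x) := by
  refine coord_ext fun i a b => ?_
  have hs : ∀ a b, slice a b (tensorAlt N x) = alt a b • x := by
    intro a b
    ext i
    rw [slice_apply, tensorAlt_extendIdx]
    rfl
  have h1 := congrFun (slice_kron a b (g : Matrix (Fin 2) (Fin 2) ℂ) (tensorAlt N x)) i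
  rw [slice_apply] at h1
  have hd := g.det_coe
  rw [det_fin_two] at hd
  rw [h1, tensorAlt_extendIdx]
  simp only [hs, mulVec_smul, Finset.sum_apply, Fin.sum_univ_two, alt]
  have hz : (kron (fun _ => (g : Matrix (Fin 2) (Fin 2) ℂ)) *ᵥ x) i *
      (g 0 0 * g 1 1 - g 0 1 * g 1 0) =
      (kron (fun _ => (g : Matrix (Fin 2) (Fin 2) ℂ)) *ᵥ x) i := by
    rw [hd, mul_one]
  fin_cases a <;> fin_cases b <;> simp
  · ring
  · linear_combination hz
  · linear_combination -hz
  · ring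

theorem star_tensorAlt (x : Coord (Fin N)) : tensorAlt N (star x) = star (tensorAlt N x) := by
  refine coord_ext fun i a b => ?_
  rw [Pi.star_apply, tensorAlt_extendIdx, tensorAlt_extendIdx, star_mul', Pi.star_apply]
  congr 1
  fin_cases a <;> fin_cases b <;> simp [alt]

theorem permExtend_swap (k l : Fin N) :
    permExtend (Equiv.swap k l) = Equiv.swap (Fin.castAdd 2 k) (Fin.castAdd 2 l) := by
  ext1 m
  induction m using forall_fin_add_two with
  | h m =>
    rw [permExtend_castAdd, Function.Injective.swap_apply (Fin.castAdd_injective N 2)]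
  | h0 =>
    rw [permExtend_natAdd, Equiv.swap_apply_of_ne_of_ne] <;>
      exact fun h => absurd (congrArg Fin.val h) (by simp; omega)
  | h1 =>
    rw [permExtend_natAdd, Equiv.swap_apply_of_ne_of_ne] <;>
      exact fun h => absurd (congrArg Fin.val h) (by simp; omega)

theorem firstSet_eq_map : firstSet N (N + 2) = Finset.univ.map (Fin.castAddEmb 2) := by
  ext m
  induction m using forall_fin_add_two with
  | h m => simp [firstSet]
  | h0 => simp [firstSet, Fin.ext_iff]; omega
  | h1 => simp [firstSet, Fin.ext_iff]; omega

theorem natAdd_zero_notMem : Fin.natAdd N 0 ∉ firstSet N (N + 2) := by simp [firstSet]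

theorem natAdd_one_notMem : Fin.natAdd N 1 ∉ firstSet (N + 1) (N + 2) := by simp [firstSet]

theorem firstSet_succ :
    firstSet (N + 1) (N + 2) = insert (Fin.natAdd N 0) (firstSet N (N + 2)) := by
  ext m
  simp only [firstSet, Finset.mem_filter, Finset.mem_univ, true_and, Finset.mem_insert, Fin.ext_iff]
  simp
  omega

theorem univ_eq_insert :
    (Finset.univ : Finset (Fin (N + 2))) = insert (Fin.natAdd N 1) (firstSet (N + 1) (N + 2)) := by
  ext m
  simp only [firstSet, Finset.mem_filter, Finset.mem_univ, true_and, Finset.mem_insert, Fin.ext_iff]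
  simp
  omega

theorem swapSum_firstSet_tensorAlt (x : Coord (Fin N)) :
    swapSum (firstSet N (N + 2)) (tensorAlt N x) = tensorAlt N (swapSum Finset.univ x) := by
  simp only [firstSet_eq_map, swapSum, LinearMap.sum_apply, Finset.sum_map, map_sum,
    ← permOp_tensorAlt, permExtend_swap]
  rfl

theorem permOp_swap_natAdd_tensorAlt (x : Coord (Fin N)) :
    permOp (Equiv.swap (Fin.natAdd N 0) (Fin.natAdd N 1)) (tensorAlt N x) = -tensorAlt N x := by
  refine coord_ext fun i a b => ?_
  have h1 : extendIdx i a b ∘ Equiv.swap (Fin.natAdd N 0) (Fin.natAdd N 1) = extendIdx i b a := by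
    ext1 m
    induction m using forall_fin_add_two with
    | h m =>
      rw [Function.comp_apply, Equiv.swap_apply_of_ne_of_ne]
      · simp
      all_goals exact fun h => absurd (congrArg Fin.val h) (by simp; omega)
    | h0 => simp
    | h1 => simp
  rw [permOp_apply, h1, Pi.neg_apply, tensorAlt_extendIdx, tensorAlt_extendIdx]
  fin_cases a <;> fin_cases b <;> simp [alt]

/-- The transpositions of a factor with the two factors of the invariant add up to the
identity. -/
theorem permOp_swap_add_tensorAlt (k : Fin N) (x : Coord (Fin N)) :
    permOp (Equiv.swap (Fin.castAdd 2 k) (Fin.natAdd N 0)) (tensorAlt N x) +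
      permOp (Equiv.swap (Fin.castAdd 2 k) (Fin.natAdd N 1)) (tensorAlt N x) = tensorAlt N x := by
  have hk : ∀ c : Fin 2, Fin.castAdd 2 k ≠ Fin.natAdd N c := fun c h =>
    absurd (congrArg Fin.val h) (by simp; omega)
  have h01 : Fin.natAdd N (0 : Fin 2) ≠ Fin.natAdd N 1 := fun h =>
    absurd (congrArg Fin.val h) (by simp)
  have h := permOp_swap_add_permOp_swap (hk 0) (hk 1) h01 (tensorAlt N x)
  have h2 : permOp (Equiv.swap (Fin.natAdd N 0) (Fin.natAdd N 1))
      (permOp (Equiv.swap (Fin.castAdd 2 k) (Fin.natAdd N 1)) (tensorAlt N x)) =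
      - permOp (Equiv.swap (Fin.castAdd 2 k) (Fin.natAdd N 0)) (tensorAlt N x) := by
    rw [permOp_permOp, Equiv.mul_swap_eq_swap_mul, ← permOp_permOp, permOp_swap_natAdd_tensorAlt,
      Equiv.swap_apply_of_ne_of_ne (hk 0) (hk 1), Equiv.swap_apply_right, map_neg]
  rw [h2, permOp_swap_natAdd_tensorAlt, map_neg] at h
  have h3 : (2 : ℂ) • (permOp (Equiv.swap (Fin.castAdd 2 k) (Fin.natAdd N 0)) (tensorAlt N x) +
      permOp (Equiv.swap (Fin.castAdd 2 k) (Fin.natAdd N 1)) (tensorAlt N x)) =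
      (2 : ℂ) • tensorAlt N x := by
    rw [two_smul, two_smul]
    linear_combination -h
  exact smul_right_injective _ (two_ne_zero (α := ℂ)) h3

/-- Tensoring with the invariant shifts the eigenvalues of the swap sum by a constant. -/
theorem swapSum_univ_tensorAlt (x : Coord (Fin N)) :
    swapSum Finset.univ (tensorAlt N x) =
      tensorAlt N (swapSum Finset.univ x) + (2 * N : ℂ) • tensorAlt N x := by
  have hsum : jucysMurphy (firstSet N (N + 2)) (Fin.natAdd N 0) (tensorAlt N x) +
      jucysMurphy (firstSet N (N + 2)) (Fin.natAdd N 1) (tensorAlt N x) =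
      (N : ℂ) • tensorAlt N x := by
    rw [jucysMurphy_apply, jucysMurphy_apply, ← Finset.sum_add_distrib, firstSet_eq_map,
      Finset.sum_map]
    refine (Finset.sum_congr rfl fun k _ => permOp_swap_add_tensorAlt k x).trans ?_
    simp [← Nat.cast_smul_eq_nsmul ℂ]
  have h1 : jucysMurphy (firstSet (N + 1) (N + 2)) (Fin.natAdd N 1) (tensorAlt N x) =
      -tensorAlt N x +
        jucysMurphy (firstSet N (N + 2)) (Fin.natAdd N 1) (tensorAlt N x) := by
    rw [firstSet_succ, jucysMurphy_apply, Finset.sum_insert natAdd_zero_notMem,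
      permOp_swap_natAdd_tensorAlt, jucysMurphy_apply]
  rw [univ_eq_insert, swapSum_insert natAdd_one_notMem, h1, firstSet_succ,
    swapSum_insert natAdd_zero_notMem, swapSum_firstSet_tensorAlt]
  have h2 : jucysMurphy (firstSet N (N + 2)) (Fin.natAdd N 1) (tensorAlt N x) =
      (N : ℂ) • tensorAlt N x -
        jucysMurphy (firstSet N (N + 2)) (Fin.natAdd N 0) (tensorAlt N x) := by
    rw [← hsum]
    abel
  rw [h2]
  module

theorem tensorAlt_dotProduct (x y : Coord (Fin N)) :
    star (tensorAlt N x) ⬝ᵥ tensorAlt N y = 2 * (star x ⬝ᵥ y) := by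
  simp only [dotProduct, Pi.star_apply]
  rw [sum_extendIdx, Finset.mul_sum]
  refine Finset.sum_congr rfl fun i _ => ?_
  simp [tensorAlt_extendIdx, Fin.sum_univ_two, alt]
  ring

/-- The invariant is maximally entangled: on average, the transposition of one of its factors with
another factor has half the norm. -/
theorem tensorAlt_dotProduct_jucysMurphy (x y : Coord (Fin N)) :
    star (tensorAlt N x) ⬝ᵥ
      jucysMurphy (firstSet N (N + 2)) (Fin.natAdd N 0) (tensorAlt N y) = N * (star x ⬝ᵥ y) := by
  have hterm : ∀ k : Fin N, star (tensorAlt N x) ⬝ᵥ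
      permOp (Equiv.swap (Fin.castAdd 2 k) (Fin.natAdd N 0)) (tensorAlt N y) = star x ⬝ᵥ y := by
    intro k
    have hk : ∀ c : Fin 2, Fin.castAdd 2 k ≠ Fin.natAdd N c := fun c h =>
      absurd (congrArg Fin.val h) (by simp; omega)
    have h := congrArg (fun z => star (tensorAlt N x) ⬝ᵥ z) (permOp_swap_add_tensorAlt k y)
    simp only [dotProduct_add, tensorAlt_dotProduct] at h
    have h2 : star (tensorAlt N x) ⬝ᵥ
          permOp (Equiv.swap (Fin.castAdd 2 k) (Fin.natAdd N 1)) (tensorAlt N y) =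
        star (tensorAlt N x) ⬝ᵥ
          permOp (Equiv.swap (Fin.castAdd 2 k) (Fin.natAdd N 0)) (tensorAlt N y) := by
      have h3 : tensorAlt N x = -permOp (Equiv.swap (Fin.natAdd N 0) (Fin.natAdd N 1))
          (tensorAlt N x) := by rw [permOp_swap_natAdd_tensorAlt, neg_neg]
      conv_lhs => rw [h3]
      rw [star_neg, neg_dotProduct, star_permOp_dotProduct, Equiv.swap_inv, permOp_permOp,
        Equiv.mul_swap_eq_swap_mul, ← permOp_permOp, permOp_swap_natAdd_tensorAlt,
        Equiv.swap_apply_of_ne_of_ne (hk 0) (hk 1), Equiv.swap_apply_right, map_neg,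
        dotProduct_neg, neg_neg]
    rw [h2] at h
    linear_combination h / 2
  rw [jucysMurphy_apply, dotProduct_sum, firstSet_eq_map, Finset.sum_map]
  refine (Finset.sum_congr rfl fun k _ => hterm k).trans ?_
  simp

end

/-! ### Normalized intertwiners -/

/-- Real-linear maps that commute with an operator commute with real polynomials in it. -/
theorem map_aeval_apply {V V' : Type} [AddCommGroup V] [Module ℂ V] [AddCommGroup V']
    [Module ℂ V'] {T : Module.End ℂ V} {T' : Module.End ℂ V'} (A : V →ₗ[ℝ] V')
    (h : ∀ x, A (T x) = T' (A x)) (p : Polynomial ℝ) (x : V) :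
    A (Polynomial.aeval T p x) = Polynomial.aeval T' p (A x) := by
  induction p using Polynomial.induction_on' with
  | add p q hp hq => simp only [map_add, LinearMap.add_apply, hp, hq]
  | monomial n a =>
    rw [Polynomial.aeval_monomial, Polynomial.aeval_monomial, Module.End.mul_apply,
      Module.End.mul_apply, Module.algebraMap_end_apply, Module.algebraMap_end_apply, map_smul]
    congr 1
    induction n with
    | zero => simp
    | succ n ih => rw [pow_succ', pow_succ', Module.End.mul_apply, Module.End.mul_apply, h, ih]

theorem aeval_apply_of_eigenvector {V : Type} [AddCommGroup V] [Module ℂ V] {T : Module.End ℂ V}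
    {x : V} {c : ℝ} (h : T x = (c : ℂ) • x) (p : Polynomial ℝ) :
    Polynomial.aeval T p x = ((p.eval c : ℝ) : ℂ) • x := by
  induction p using Polynomial.induction_on' with
  | add p q hp hq =>
    rw [map_add, LinearMap.add_apply, hp, hq, Polynomial.eval_add, Complex.ofReal_add, add_smul]
  | monomial n a =>
    rw [Polynomial.aeval_monomial, Module.End.mul_apply, Module.algebraMap_end_apply,
      Polynomial.eval_monomial, Complex.ofReal_mul, mul_smul, ← Complex.coe_smul a]
    congr 1
    induction n with
    | zero => simp
    | succ n ih =>
      rw [pow_succ', Module.End.mul_apply, ih, map_smul, h, smul_smul, ← Complex.ofReal_mul,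
        pow_succ]

/-- The projection onto the isotypic component indexed by `(N - q, q)`, as a real polynomial in
the swap sum. -/
noncomputable def isoProj (N q : ℕ) : Coord (Fin N) →ₗ[ℂ] Coord (Fin N) :=
  Polynomial.aeval (R := ℝ) (A := Module.End ℂ (Coord (Fin N))) (swapSum Finset.univ)
    (Lagrange.basis (Finset.range (N / 2 + 1)) (swapEigen N) q)

theorem mem_isoComp_univ {N q : ℕ} {x : Coord (Fin N)} :
    x ∈ isoComp Finset.univ q ↔ swapSum Finset.univ x = (swapEigen N q : ℂ) • x := by
  rw [mem_isoComp, Finset.card_univ, Fintype.card_fin]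

theorem isoProj_apply_self {N q : ℕ} (hq : 2 * q ≤ N) {x : Coord (Fin N)}
    (hx : x ∈ isoComp Finset.univ q) : isoProj N q x = x := by
  rw [isoProj, aeval_apply_of_eigenvector (mem_isoComp_univ.1 hx), Lagrange.eval_basis_self,
    Complex.ofReal_one, one_smul]
  · intro a ha b hb hab
    rw [Finset.mem_coe, Finset.mem_range] at ha hb
    exact swapEigen_injective (by omega) (by omega) hab
  · exact Finset.mem_range.2 (by omega)

theorem isoProj_apply_of_ne {N q r : ℕ} (hr : 2 * r ≤ N) (hqr : q ≠ r)
    {x : Coord (Fin N)} (hx : x ∈ isoComp Finset.univ r) : isoProj N q x = 0 := by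
  rw [isoProj, aeval_apply_of_eigenvector (mem_isoComp_univ.1 hx),
    Lagrange.eval_basis_of_ne hqr (Finset.mem_range.2 (by omega)), Complex.ofReal_zero, zero_smul]

theorem permOp_isoProj {N : ℕ} (q : ℕ) (σ : Equiv.Perm (Fin N)) (x : Coord (Fin N)) :
    permOp σ (isoProj N q x) = isoProj N q (permOp σ x) := by
  refine map_aeval_apply ((permOp σ).restrictScalars ℝ) (fun y => ?_) _ x
  simp only [LinearMap.restrictScalars_apply, swapSum, LinearMap.sum_apply, map_sum]
  refine Fintype.sum_equiv σ _ _ fun k => Fintype.sum_equiv σ _ _ fun l => ?_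
  rw [permOp_permOp, permOp_permOp, Equiv.mul_swap_eq_swap_mul]

theorem kron_mulVec_isoProj {N : ℕ} (q : ℕ) (g : Matrix (Fin 2) (Fin 2) ℂ) (x : Coord (Fin N)) :
    kron (fun _ => g) *ᵥ isoProj N q x = isoProj N q (kron (fun _ => g) *ᵥ x) := by
  refine map_aeval_apply ((kron fun _ => g).mulVecLin.restrictScalars ℝ) (fun y => ?_) _ x
  simp only [LinearMap.restrictScalars_apply, mulVecLin_apply]
  rw [← kronOn_univ, swapSum_kronOn_mulVec]

theorem star_isoProj {N : ℕ} (q : ℕ) (x : Coord (Fin N)) :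
    isoProj N q (star x) = star (isoProj N q x) := by
  let A : Coord (Fin N) →ₗ[ℝ] Coord (Fin N) :=
    { toFun := star
      map_add' := star_add
      map_smul' := fun c y => by
        ext i
        simp }
  exact (map_aeval_apply A (fun y => (star_swapSum _ y).symm) _ x).symm

/-- The intertwiner of the path with first content `u` and second content `v` from the diagram
`(N - q, q)`: the projection onto the `(N - q, q)`-component, followed by the tensor product with
the invariant, and by the (normalized) projection onto the eigenspace of the Jucys–Murphy element
for the eigenvalue `u`. -/
noncomputable def pathOp (N q : ℕ) (u v : ℝ) : Coord (Fin N) →ₗ[ℂ] Coord (Fin (N + 2)) :=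
  (((√((u - v) * (N - 2 * v)))⁻¹ : ℝ) : ℂ) •
    ((jucysMurphy (firstSet N (N + 2)) (Fin.natAdd N 0) - (v : ℂ) • LinearMap.id) ∘ₗ
      tensorAlt N ∘ₗ isoProj N q)

section

variable {N q : ℕ} {u v : ℝ}

theorem pathOp_apply (x : Coord (Fin N)) :
    pathOp N q u v x = (((√((u - v) * (N - 2 * v)))⁻¹ : ℝ) : ℂ) •
      (jucysMurphy (firstSet N (N + 2)) (Fin.natAdd N 0) (tensorAlt N (isoProj N q x)) -
        (v : ℂ) • tensorAlt N (isoProj N q x)) := rfl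

theorem permExtend_mem_firstSet (σ : Equiv.Perm (Fin N)) (m : Fin (N + 2)) :
    permExtend σ m ∈ firstSet N (N + 2) ↔ m ∈ firstSet N (N + 2) := by
  induction m using forall_fin_add_two <;> simp [firstSet]

theorem pathOp_mem_equivariantMaps : pathOp N q u v ∈ equivariantMaps N := by
  constructor
  · intro σ x
    simp only [pathOp_apply, map_smul, map_sub]
    rw [permOp_jucysMurphy (permExtend_mem_firstSet σ) (permExtend_natAdd σ 0), permOp_tensorAlt,
      permOp_isoProj]
  · intro g x
    simp only [pathOp_apply, mulVec_smul, mulVec_sub]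
    rw [← jucysMurphy_kron_mulVec, kron_mulVec_tensorAlt, kron_mulVec_isoProj]

theorem star_pathOp (x : Coord (Fin N)) :
    pathOp N q u v (star x) = star (pathOp N q u v x) := by
  simp only [pathOp_apply, star_isoProj, star_tensorAlt, star_jucysMurphy, star_smul, star_sub,
    Complex.star_def, Complex.conj_ofReal]

theorem pathOp_apply_of_ne {r : ℕ} (hr : 2 * r ≤ N) (hqr : q ≠ r)
    {x : Coord (Fin N)} (hx : x ∈ isoComp Finset.univ r) : pathOp N q u v x = 0 := by
  rw [pathOp_apply, isoProj_apply_of_ne hr hqr hx]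
  simp

theorem swapEigen_succ_succ (N q : ℕ) :
    swapEigen (N + 2) (q + 1) = swapEigen N q + 2 * N := by
  simp only [swapEigen]
  push_cast
  ring

theorem swapSum_univ_tensorAlt_of_mem {x : Coord (Fin N)} (hx : x ∈ isoComp Finset.univ q) :
    swapSum Finset.univ (tensorAlt N x) = (swapEigen (N + 2) (q + 1) : ℂ) • tensorAlt N x := by
  rw [swapSum_univ_tensorAlt, mem_isoComp_univ.1 hx, map_smul, swapEigen_succ_succ, ← add_smul]
  push_cast
  rfl

theorem pathOp_mem_isoComp_univ (hq : 2 * q ≤ N) {x : Coord (Fin N)}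
    (hx : x ∈ isoComp Finset.univ q) : pathOp N q u v x ∈ isoComp Finset.univ (q + 1) := by
  have hcomm : ∀ y, swapSum Finset.univ (jucysMurphy (firstSet N (N + 2)) (Fin.natAdd N 0) y) =
      jucysMurphy (firstSet N (N + 2)) (Fin.natAdd N 0) (swapSum Finset.univ y) := by
    intro y
    rw [jucysMurphy_apply, jucysMurphy_apply, map_sum]
    refine Finset.sum_congr rfl fun k _ => ?_
    simp only [swapSum, LinearMap.sum_apply, map_sum]
    refine (Fintype.sum_equiv (Equiv.swap k (Fin.natAdd N 0)) _ _ fun a =>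
      Fintype.sum_equiv (Equiv.swap k (Fin.natAdd N 0)) _ _ fun b => ?_).symm
    rw [permOp_permOp, permOp_permOp, Equiv.mul_swap_eq_swap_mul]
  rw [mem_isoComp_univ, pathOp_apply, isoProj_apply_self hq hx, map_smul, map_sub, map_smul,
    hcomm, swapSum_univ_tensorAlt_of_mem hx, map_smul]
  module

/-- The quadratic equation of the Jucys–Murphy element: its eigenvalues are the contents of the
two cells that can be added. -/
theorem jucysMurphy_sub_smul (huv : u + v = N - 1) (huv' : u * v = (N - q) * (q - 1))
    {x : Coord (Fin N)} (hx : x ∈ isoComp Finset.univ q) :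
    jucysMurphy (firstSet N (N + 2)) (Fin.natAdd N 0)
        (jucysMurphy (firstSet N (N + 2)) (Fin.natAdd N 0) (tensorAlt N x) -
          (v : ℂ) • tensorAlt N x) =
      (u : ℂ) • (jucysMurphy (firstSet N (N + 2)) (Fin.natAdd N 0) (tensorAlt N x) -
        (v : ℂ) • tensorAlt N x) := by
  have h := two_smul_jucysMurphy_jucysMurphy (natAdd_zero_notMem (N := N)) (tensorAlt N x)
  rw [swapSum_firstSet_tensorAlt, mem_isoComp_univ.1 hx, map_smul,
    card_firstSet (Nat.le_add_right N 2)] at h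
  have h1 : (swapEigen N q : ℂ) + (2 * N - N ^ 2) = -2 * ((u : ℂ) * v) := by
    have : swapEigen N q + (2 * N - N ^ 2) = -2 * (u * v) := by
      rw [huv', swapEigen]
      ring
    exact_mod_cast this
  have h2 : (N : ℂ) - 1 = u + v := by
    have := huv.symm
    exact_mod_cast this
  have h3 : (2 : ℂ) • jucysMurphy (firstSet N (N + 2)) (Fin.natAdd N 0)
        (jucysMurphy (firstSet N (N + 2)) (Fin.natAdd N 0) (tensorAlt N x)) =
      (2 : ℂ) • (((u : ℂ) + v) • jucysMurphy (firstSet N (N + 2)) (Fin.natAdd N 0) (tensorAlt N x)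
        - ((u : ℂ) * v) • tensorAlt N x) := by
    rw [h, h2]
    have h4 : (2 * (N : ℂ) - (N : ℂ) ^ 2) = -2 * ((u : ℂ) * v) - swapEigen N q := by
      rw [← h1]
      ring
    rw [h4]
    module
  have h5 := smul_right_injective _ (two_ne_zero (α := ℂ)) h3
  rw [map_sub, map_smul, h5]
  module

theorem pathOp_mem_isoComp_firstSet (hq : 2 * q ≤ N) (huv : u + v = N - 1)
    (huv' : u * v = (N - q) * (q - 1)) {r : ℕ}
    (hr : swapEigen (N + 1) r = swapEigen N q + 2 * u + 1) {x : Coord (Fin N)}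
    (hx : x ∈ isoComp Finset.univ q) :
    pathOp N q u v x ∈ isoComp (firstSet (N + 1) (N + 2)) r := by
  rw [mem_isoComp, card_firstSet (Nat.le_succ (N + 1)), hr, firstSet_succ,
    swapSum_insert natAdd_zero_notMem, pathOp_apply, isoProj_apply_self hq hx]
  set y := jucysMurphy (firstSet N (N + 2)) (Fin.natAdd N 0) (tensorAlt N x) -
    (v : ℂ) • tensorAlt N x with hy
  have h1 : jucysMurphy (firstSet N (N + 2)) (Fin.natAdd N 0) y = (u : ℂ) • y :=
    jucysMurphy_sub_smul huv huv' hx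
  have h2 : swapSum (firstSet N (N + 2)) y = (swapEigen N q : ℂ) • y := by
    rw [hy, map_sub, map_smul, swapSum_jucysMurphy natAdd_zero_notMem, swapSum_firstSet_tensorAlt,
      mem_isoComp_univ.1 hx, map_smul, map_smul]
    module
  rw [map_smul, map_smul, h1, h2]
  push_cast
  module

theorem pathOp_dotProduct (hq : 2 * q ≤ N) (huv : u + v = N - 1)
    (huv' : u * v = (N - q) * (q - 1)) (hpos : 0 < (u - v) * (N - 2 * v))
    {x y : Coord (Fin N)} (hx : x ∈ isoComp Finset.univ q) (hy : y ∈ isoComp Finset.univ q) :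
    star (pathOp N q u v x) ⬝ᵥ pathOp N q u v y = star x ⬝ᵥ y := by
  rw [pathOp_apply, pathOp_apply, isoProj_apply_self hq hx, isoProj_apply_self hq hy, star_smul,
    smul_dotProduct, dotProduct_smul, smul_smul]
  have h1 := jucysMurphy_sub_smul huv huv' hy
  set z := jucysMurphy (firstSet N (N + 2)) (Fin.natAdd N 0) (tensorAlt N y) -
    (v : ℂ) • tensorAlt N y with hz
  have h2 : star (jucysMurphy (firstSet N (N + 2)) (Fin.natAdd N 0) (tensorAlt N x) -
      (v : ℂ) • tensorAlt N x) ⬝ᵥ z = ((u : ℂ) - v) * (star (tensorAlt N x) ⬝ᵥ z) := by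
    rw [star_sub, sub_dotProduct, star_jucysMurphy_dotProduct, h1, star_smul, smul_dotProduct,
      dotProduct_smul, Complex.star_def, Complex.conj_ofReal, smul_eq_mul, smul_eq_mul]
    ring
  have h3 : star (tensorAlt N x) ⬝ᵥ z = ((N : ℂ) - 2 * v) * (star x ⬝ᵥ y) := by
    rw [hz, dotProduct_sub, tensorAlt_dotProduct_jucysMurphy, dotProduct_smul,
      tensorAlt_dotProduct, smul_eq_mul]
    ring
  have h4 : star (((√((u - v) * (N - 2 * v)))⁻¹ : ℝ) : ℂ) *
      (((√((u - v) * (N - 2 * v)))⁻¹ : ℝ) : ℂ) * (((u : ℂ) - v) * ((N : ℂ) - 2 * v)) = 1 := by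
    have h5 : (√((u - v) * (N - 2 * v)))⁻¹ * (√((u - v) * (N - 2 * v)))⁻¹ *
        ((u - v) * (N - 2 * v)) = 1 := by
      rw [← mul_inv, Real.mul_self_sqrt hpos.le, inv_mul_cancel₀ hpos.ne']
    rw [Complex.star_def, Complex.conj_ofReal]
    exact_mod_cast h5
  rw [h2, h3, smul_eq_mul]
  linear_combination (star x ⬝ᵥ y) * h4

/-- The component of `q ≤ N / 2` is not zero: it contains the result of tensoring a symmetric tensor
`q` times with the invariant `ω`. -/
theorem exists_ne_zero_mem_isoComp (q : ℕ) :
    ∀ N, 2 * q ≤ N → ∃ x : Coord (Fin N), x ≠ 0 ∧ x ∈ isoComp Finset.univ q := by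
  induction q with
  | zero =>
    intro N _
    refine ⟨fun _ => 1, fun h => one_ne_zero (congrFun h fun _ => 0), ?_⟩
    rw [mem_isoComp_univ]
    ext i
    rw [swapSum_apply]
    simp [swapEigen]
    ring
  | succ q ih =>
    intro N hN
    obtain ⟨M, rfl⟩ : ∃ M, N = M + 2 := ⟨N - 2, by omega⟩
    obtain ⟨x, hx0, hx⟩ := ih M (by omega)
    refine ⟨tensorAlt M x, fun h => hx0 ?_, mem_isoComp_univ.2 (swapSum_univ_tensorAlt_of_mem hx)⟩
    ext i
    have := congrFun h (extendIdx i 0 1)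
    simpa [tensorAlt_extendIdx, alt] using this

end

/-! ### Diagrams with at most two rows -/

theorem rowLen_eq_of_forall_mem {μ : YoungDiagram} {i a : ℕ} (h : ∀ j, (i, j) ∈ μ ↔ j < a) :
    μ.rowLen i = a :=
  eq_of_forall_lt_iff fun j => by rw [← YoungDiagram.mem_iff_lt_rowLen, h]

theorem fst_lt_two_of_mem {μ : YoungDiagram} (hμ : μ.colLen 0 ≤ 2) {i j : ℕ} (h : (i, j) ∈ μ) :
    i < 2 := by
  have h0 : (i, 0) ∈ μ := μ.up_left_mem le_rfl (Nat.zero_le j) h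
  exact (YoungDiagram.mem_iff_lt_colLen.1 h0).trans_le hμ

theorem card_eq_rowLen_add_rowLen {μ : YoungDiagram} (hμ : μ.colLen 0 ≤ 2) :
    μ.card = μ.rowLen 0 + μ.rowLen 1 := by
  rw [YoungDiagram.rowLen_eq_card, YoungDiagram.rowLen_eq_card, YoungDiagram.card,
    ← Finset.card_filter_add_card_filter_not (s := μ.cells) (fun c => c.1 = 0)]
  congr 2
  ext ⟨i, j⟩
  simp only [YoungDiagram.row, Finset.mem_filter, YoungDiagram.mem_cells]
  refine and_congr_right fun h => ?_
  have := fst_lt_two_of_mem hμ h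
  omega

theorem le_iff_rowLen_le {μ ν : YoungDiagram} (hμ : μ.colLen 0 ≤ 2) :
    μ ≤ ν ↔ μ.rowLen 0 ≤ ν.rowLen 0 ∧ μ.rowLen 1 ≤ ν.rowLen 1 := by
  constructor
  · intro h
    have hle : ∀ i, μ.rowLen i ≤ ν.rowLen i := fun i =>
      le_of_forall_lt fun j hj => YoungDiagram.mem_iff_lt_rowLen.1
        (h (YoungDiagram.mem_iff_lt_rowLen.2 hj))
    exact ⟨hle 0, hle 1⟩
  · rintro ⟨h0, h1⟩ ⟨i, j⟩ h
    have hj := YoungDiagram.mem_iff_lt_rowLen.1 (show (i, j) ∈ μ from h)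
    have hi := fst_lt_two_of_mem hμ h
    refine YoungDiagram.mem_iff_lt_rowLen.2 (hj.trans_le ?_)
    interval_cases i
    · exact h0
    · exact h1

theorem eq_of_rowLen_eq {μ ν : YoungDiagram} (hμ : μ.colLen 0 ≤ 2) (hν : ν.colLen 0 ≤ 2)
    (h0 : μ.rowLen 0 = ν.rowLen 0) (h1 : μ.rowLen 1 = ν.rowLen 1) : μ = ν :=
  le_antisymm ((le_iff_rowLen_le hμ).2 ⟨h0.le, h1.le⟩) ((le_iff_rowLen_le hν).2 ⟨h0.ge, h1.ge⟩)

theorem exists_rowLen_eq {a b : ℕ} (h : b ≤ a) :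
    ∃ μ : YoungDiagram, μ.colLen 0 ≤ 2 ∧ μ.rowLen 0 = a ∧ μ.rowLen 1 = b := by
  let μ : YoungDiagram :=
    { cells := (Finset.range 2 ×ˢ Finset.range a).filter fun c => c.1 = 0 ∨ c.2 < b
      isLowerSet := by
        rintro ⟨i, j⟩ ⟨i', j'⟩ ⟨hi, hj⟩ hc
        simp only [Finset.coe_filter, Finset.mem_product, Finset.mem_range,
          Set.mem_ofPred_eq] at hc ⊢
        simp only at hi hj
        omega }
  have hmem : ∀ i j, (i, j) ∈ μ ↔ (i < 2 ∧ j < a) ∧ (i = 0 ∨ j < b) := by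
    intro i j
    rw [← YoungDiagram.mem_cells]
    simp [μ]
  refine ⟨μ, ?_, rowLen_eq_of_forall_mem fun j => ?_, rowLen_eq_of_forall_mem fun j => ?_⟩
  · by_contra hc
    have := (hmem 2 0).1 (YoungDiagram.mem_iff_lt_colLen.2 (not_le.1 hc))
    omega
  · rw [hmem]
    omega
  · rw [hmem]
    omega

/-! ### Nice pairs and paths -/

namespace NicePair

variable {N : ℕ}

theorem rowLen_add (p : NicePair N) : p.lam.rowLen 0 + p.lam.rowLen 1 = N := by
  rw [← card_eq_rowLen_add_rowLen p.rows_lam, p.card_lam]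

theorem two_mul_rowLen_le (p : NicePair N) : 2 * p.lam.rowLen 1 ≤ N := by
  have h1 := p.rowLen_add
  have h2 := p.lam.rowLen_anti 0 1 zero_le_one
  omega

theorem isExceptional_iff (p : NicePair N) : p.IsExceptional ↔ 2 * p.lam.rowLen 1 = N := by
  have h1 := p.rowLen_add
  rw [IsExceptional]
  omega

theorem eq_of_rowLen_one_eq {p p' : NicePair N} (h : p.lam.rowLen 1 = p'.lam.rowLen 1) :
    p = p' := by
  have h1 := p.rowLen_add
  have h2 := p'.rowLen_add
  have h0 : p.lam.rowLen 0 = p'.lam.rowLen 0 := by omega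
  refine NicePair.ext (eq_of_rowLen_eq p.rows_lam p'.rows_lam h0 h)
    (eq_of_rowLen_eq p.rows_mu p'.rows_mu ?_ ?_)
  · rw [p.row_zero, p'.row_zero, h0]
  · rw [p.row_one, p'.row_one, h]

theorem exists_rowLen_one_eq {q : ℕ} (hq : 2 * q ≤ N) :
    ∃ p : NicePair N, p.lam.rowLen 1 = q := by
  obtain ⟨lam, hlam, h0, h1⟩ := exists_rowLen_eq (a := N - q) (b := q) (by omega)
  obtain ⟨mu, hmu, h0', h1'⟩ := exists_rowLen_eq (a := N - q + 1) (b := q + 1) (by omega)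
  refine ⟨⟨lam, mu, ?_, ?_, hlam, hmu, ?_, ?_, ?_⟩, h1⟩
  · rw [card_eq_rowLen_add_rowLen hlam]
    omega
  · rw [card_eq_rowLen_add_rowLen hmu]
    omega
  · rw [le_iff_rowLen_le hlam]
    omega
  · omega
  · omega

namespace Path

variable {p : NicePair N}

theorem colLen_le (t : p.Path) : t.1.colLen 0 ≤ 2 := by
  by_contra hc
  have h := t.2.2.1 (YoungDiagram.mem_iff_lt_colLen.2 (not_le.1 hc))
  exact absurd (fst_lt_two_of_mem p.rows_mu h) (lt_irrefl 2)

theorem rowLen_add (t : p.Path) : t.1.rowLen 0 + t.1.rowLen 1 = N + 1 := by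
  rw [← card_eq_rowLen_add_rowLen t.colLen_le, t.2.2.2]

theorem rowLen_one_cases (t : p.Path) :
    t.1.rowLen 1 = p.lam.rowLen 1 ∨ t.1.rowLen 1 = p.lam.rowLen 1 + 1 := by
  have h1 := ((le_iff_rowLen_le p.rows_lam).1 t.2.1).2
  have h2 := ((le_iff_rowLen_le t.colLen_le).1 t.2.2.1).2
  rw [p.row_one] at h2
  omega

theorem rowLen_one_of_not_isT21 {t : p.Path} (h : ¬ t.IsT21) :
    t.1.rowLen 1 = p.lam.rowLen 1 :=
  t.rowLen_one_cases.resolve_right h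

theorem eq_of_isT21_iff {s t : p.Path} (h : s.IsT21 ↔ t.IsT21) : s = t := by
  have h1 : s.1.rowLen 1 = t.1.rowLen 1 := by
    by_cases ht : t.IsT21
    · exact (h.2 ht).trans ht.symm
    · rw [rowLen_one_of_not_isT21 ht, rowLen_one_of_not_isT21 fun hs => ht (h.1 hs)]
  have h2 := s.rowLen_add
  have h3 := t.rowLen_add
  exact Subtype.ext (eq_of_rowLen_eq s.colLen_le t.colLen_le (by omega) h1)

theorem exists_not_isT21 (p : NicePair N) : ∃ t : p.Path, ¬ t.IsT21 := by
  have h1 := p.rowLen_add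
  have h2 := p.two_mul_rowLen_le
  obtain ⟨ν, hν, h0', h1'⟩ := exists_rowLen_eq (a := p.lam.rowLen 0 + 1) (b := p.lam.rowLen 1)
    (by omega)
  refine ⟨⟨ν, ?_, ?_, ?_⟩, ?_⟩
  · rw [le_iff_rowLen_le p.rows_lam]
    omega
  · rw [le_iff_rowLen_le hν, p.row_zero, p.row_one]
    omega
  · rw [card_eq_rowLen_add_rowLen hν]
    omega
  · change ¬ν.rowLen 1 = p.lam.rowLen 1 + 1
    omega

theorem exists_isT21 (hp : ¬ p.IsExceptional) : ∃ t : p.Path, t.IsT21 := by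
  have h1 := p.rowLen_add
  have h2 := p.two_mul_rowLen_le
  rw [isExceptional_iff] at hp
  obtain ⟨ν, hν, h0', h1'⟩ := exists_rowLen_eq (a := p.lam.rowLen 0) (b := p.lam.rowLen 1 + 1)
    (by omega)
  refine ⟨⟨ν, ?_, ?_, ?_⟩, h1'⟩
  · rw [le_iff_rowLen_le p.rows_lam]
    omega
  · rw [le_iff_rowLen_le hν, p.row_zero, p.row_one]
    omega
  · rw [card_eq_rowLen_add_rowLen hν]
    omega

theorem not_isT21 (hp : p.IsExceptional) (t : p.Path) : ¬ t.IsT21 := by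
  intro h
  rw [IsT21] at h
  rw [isExceptional_iff] at hp
  have h1 := t.rowLen_add
  have h2 := t.1.rowLen_anti 0 1 zero_le_one
  omega

theorem sum_of_isExceptional {M : Type} [AddCommMonoid M] (hp : p.IsExceptional) (f : p.Path → M)
    (t : p.Path) : ∑ s, f s = f t := by
  refine Finset.sum_eq_single t (fun s _ hs => ?_) (fun h => absurd (Finset.mem_univ t) h)
  exact absurd (eq_of_isT21_iff (iff_of_false (not_isT21 hp s) (not_isT21 hp t))) hs

theorem sum_of_isT21 {M : Type} [AddCommMonoid M] (f : p.Path → M)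
    {s t : p.Path} (hs : s.IsT21) (ht : ¬ t.IsT21) : ∑ r, f r = f s + f t := by
  classical
  have hst : s ≠ t := fun h => ht (h ▸ hs)
  rw [← Finset.sum_pair hst]
  refine (Finset.sum_subset (Finset.subset_univ _) fun r _ hr => ?_).symm
  rw [Finset.mem_insert, Finset.mem_singleton, not_or] at hr
  by_cases h : r.IsT21
  · exact absurd (eq_of_isT21_iff (iff_of_true h hs)) hr.1
  · exact absurd (eq_of_isT21_iff (iff_of_false h ht)) hr.2

end Path

open Classical in
theorem card_path (p : NicePair N) :
    Fintype.card p.Path = if p.IsExceptional then 1 else 2 := by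
  obtain ⟨t, ht⟩ := Path.exists_not_isT21 p
  rw [Fintype.card_eq_sum_ones]
  split_ifs with hp
  · rw [Path.sum_of_isExceptional hp _ t]
  · obtain ⟨s, hs⟩ := Path.exists_isT21 hp
    rw [Path.sum_of_isT21 _ hs ht]

open Classical in
theorem card_isExceptional (N : ℕ) :
    Nat.card {p : NicePair N // p.IsExceptional} = if Even N then 1 else 0 := by
  split_ifs with h
  · rw [Nat.card_eq_one_iff_exists]
    obtain ⟨m, hm⟩ := h
    obtain ⟨p, hp⟩ := exists_rowLen_one_eq (N := N) (q := m) (by omega)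
    refine ⟨⟨p, p.isExceptional_iff.2 (by omega)⟩, fun r => Subtype.ext (eq_of_rowLen_one_eq ?_)⟩
    have := r.1.isExceptional_iff.1 r.2
    simp only
    omega
  · have : IsEmpty {p : NicePair N // p.IsExceptional} :=
      ⟨fun r => h ⟨_, by rw [← two_mul, r.1.isExceptional_iff.1 r.2]⟩⟩
    exact Nat.card_of_isEmpty

theorem exists_equiv {n : ℕ} (hN : N + 1 = 2 * n ∨ N = 2 * n) :
    ∃ e : Fin n ≃ {p : NicePair N // ¬ p.IsExceptional},
      ∀ j, (e j).1.lam.rowLen 1 + (j + 1) = n := by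
  have h : ∀ j : Fin n, ∃ p : {p : NicePair N // ¬ p.IsExceptional},
      p.1.lam.rowLen 1 + (j + 1) = n := by
    intro j
    have := j.2
    obtain ⟨p, hp⟩ := exists_rowLen_one_eq (N := N) (q := n - (j + 1)) (by omega)
    refine ⟨⟨p, ?_⟩, ?_⟩
    · rw [isExceptional_iff]
      omega
    · simp only
      omega
  choose e he using h
  refine ⟨Equiv.ofBijective e ⟨fun j k hjk => ?_, fun p => ?_⟩, he⟩
  · have h1 := he j
    have h2 := he k
    rw [hjk] at h1
    exact Fin.ext (by omega)
  · have h1 := p.1.two_mul_rowLen_le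
    have h2 := mt p.1.isExceptional_iff.2 p.2
    have h3 : n - 1 - p.1.lam.rowLen 1 < n := by omega
    refine ⟨⟨_, h3⟩, Subtype.ext (eq_of_rowLen_one_eq ?_)⟩
    have := he ⟨_, h3⟩
    simp only at this
    omega

/-- The total number of paths is `N + 1`. -/
theorem card_sigma_path (N : ℕ) : Fintype.card (Σ p : NicePair N, p.Path) = N + 1 := by
  classical
  obtain ⟨n, hN⟩ : ∃ n, N + 1 = 2 * n ∨ N = 2 * n := ⟨(N + 1) / 2, by omega⟩
  obtain ⟨e, -⟩ := exists_equiv hN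
  have h1 := card_isExceptional N
  have h2 := Fintype.card_congr e
  rw [Nat.card_eq_fintype_card, Fintype.card_subtype] at h1
  rw [Fintype.card_fin, Fintype.card_subtype] at h2
  rw [Fintype.card_sigma, Finset.sum_congr rfl fun p _ => card_path p, Finset.sum_ite,
    Finset.sum_const, Finset.sum_const, smul_eq_mul, smul_eq_mul, h1, ← h2]
  split_ifs with h
  · rw [even_iff_two_dvd] at h
    omega
  · rw [even_iff_two_dvd] at h
    omega

end NicePair

/-! ### The path system -/

/-- A linear map between tensor powers, in coordinates. -/
noncomputable def coordMap {N M : ℕ} (f : TensorPow N →ₗ[ℂ] TensorPow M) :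
    Coord (Fin N) →ₗ[ℂ] Coord (Fin M) :=
  (coord M).toLinearMap ∘ₗ f ∘ₗ (coord N).symm.toLinearMap

/-- The linear map between tensor powers that is given by a map in coordinates. -/
noncomputable def ofCoordMap {N M : ℕ} (F : Coord (Fin N) →ₗ[ℂ] Coord (Fin M)) :
    TensorPow N →ₗ[ℂ] TensorPow M :=
  (coord M).symm.toLinearMap ∘ₗ F ∘ₗ (coord N).toLinearMap

theorem coord_ofCoordMap {N M : ℕ} (F : Coord (Fin N) →ₗ[ℂ] Coord (Fin M)) (x : TensorPow N) :
    coord M (ofCoordMap F x) = F (coord N x) :=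
  (coord M).apply_symm_apply _

theorem coordMap_coord {N M : ℕ} (f : TensorPow N →ₗ[ℂ] TensorPow M) (x : TensorPow N) :
    coordMap f (coord N x) = coord M (f x) := by
  change coord M (f ((coord N).symm (coord N x))) = _
  rw [LinearEquiv.symm_apply_apply]

theorem isEquivariant_ofCoordMap {N : ℕ} {F : Coord (Fin N) →ₗ[ℂ] Coord (Fin (N + 2))}
    (hF : F ∈ equivariantMaps N) : IsEquivariant (ofCoordMap F) := by
  refine ⟨fun σ x => (coord (N + 2)).injective ?_, fun g x => (coord (N + 2)).injective ?_⟩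
  · rw [coord_permAct, coord_ofCoordMap, coord_ofCoordMap, coord_permAct, hF.1]
  · rw [coord_slRep, coord_ofCoordMap, coord_ofCoordMap, coord_slRep, kronOn_univ, kronOn_univ,
      hF.2]

theorem coordMap_mem_equivariantMaps {N : ℕ} {f : TensorPow N →ₗ[ℂ] TensorPow (N + 2)}
    (hf : IsEquivariant f) : coordMap f ∈ equivariantMaps N := by
  refine ⟨fun σ x => ?_, fun g x => ?_⟩
  · obtain ⟨x, rfl⟩ := (coord N).surjective x
    rw [← coord_permAct, coordMap_coord, coordMap_coord, hf.1, coord_permAct]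
  · obtain ⟨x, rfl⟩ := (coord N).surjective x
    rw [← kronOn_univ, ← kronOn_univ, ← coord_slRep, coordMap_coord, coordMap_coord, hf.2,
      coord_slRep]

theorem isRealMap_ofCoordMap {N M : ℕ} {F : Coord (Fin N) →ₗ[ℂ] Coord (Fin M)}
    (hF : ∀ x, F (star x) = star (F x)) : IsRealMap (ofCoordMap F) := by
  intro i j
  have h1 : star (coord N (stdBasis N j)) = coord N (stdBasis N j) := by
    ext k
    simp only [coord, Pi.star_apply, Module.Basis.equivFun_apply, Module.Basis.repr_self,
      Finsupp.single_apply]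
    split_ifs <;> simp
  have h2 := congrFun (hF (coord N (stdBasis N j))) i
  rw [h1, ← coord_ofCoordMap] at h2
  exact Complex.conj_eq_iff_im.1 h2.symm

namespace NicePair

variable {N : ℕ} {p : NicePair N}

open Classical in
/-- The content (column index minus row index) of the cell that is added first. -/
noncomputable def Path.content (t : p.Path) : ℝ :=
  if t.IsT21 then (p.lam.rowLen 1 : ℝ) - 1 else (N : ℝ) - p.lam.rowLen 1

theorem Path.content_mul (t : p.Path) : t.content * (N - 1 - t.content) =
    (N - p.lam.rowLen 1) * (p.lam.rowLen 1 - 1) := by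
  rw [content]
  split_ifs <;> ring

theorem Path.content_pos (t : p.Path) :
    0 < (t.content - (N - 1 - t.content)) * (N - 2 * (N - 1 - t.content)) := by
  have h1 : 2 * (p.lam.rowLen 1 : ℝ) ≤ N := by exact_mod_cast p.two_mul_rowLen_le
  rw [content]
  split_ifs with h
  · have h2 : 2 * p.lam.rowLen 1 ≠ N := fun h2 =>
      not_isT21 (p.isExceptional_iff.2 h2) t h
    have h3 : 2 * (p.lam.rowLen 1 : ℝ) < N :=
      lt_of_le_of_ne h1 (by exact_mod_cast h2)
    exact mul_pos_of_neg_of_neg (by linarith) (by linarith)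
  · exact mul_pos (by linarith) (by linarith)

theorem Path.swapEigen_rowLen (t : p.Path) :
    swapEigen (N + 1) (t.1.rowLen 1) = swapEigen N (p.lam.rowLen 1) + 2 * t.content + 1 := by
  rw [content]
  split_ifs with h
  · rw [show t.1.rowLen 1 = p.lam.rowLen 1 + 1 from h, swapEigen, swapEigen]
    push_cast
    ring
  · rw [rowLen_one_of_not_isT21 h, swapEigen, swapEigen]
    push_cast
    ring

theorem mem_component_lam {x : TensorPow N} :
    x ∈ component N p.lam ↔ coord N x ∈ isoComp Finset.univ (p.lam.rowLen 1) :=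
  mem_component_iff p.rowLen_add

theorem mem_component_mu {x : TensorPow (N + 2)} :
    x ∈ component (N + 2) p.mu ↔ coord (N + 2) x ∈ isoComp Finset.univ (p.lam.rowLen 1 + 1) := by
  rw [← p.row_one]
  refine mem_component_iff ?_
  have := p.rowLen_add
  rw [p.row_zero, p.row_one]
  omega

theorem Path.mem_componentFirst (t : p.Path) {x : TensorPow (N + 2)} :
    x ∈ componentFirst (N + 1) (N + 2) t.1 ↔
      coord (N + 2) x ∈ isoComp (firstSet (N + 1) (N + 2)) (t.1.rowLen 1) :=
  mem_componentFirst_iff (Nat.le_succ _) t.rowLen_add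

/-- The normalized intertwiner of a path, in coordinates. -/
noncomputable def Path.coordOp (t : p.Path) : Coord (Fin N) →ₗ[ℂ] Coord (Fin (N + 2)) :=
  pathOp N (p.lam.rowLen 1) t.content (N - 1 - t.content)

end NicePair

/-- The normalized intertwiners of the paths. -/
noncomputable def pathIntertwiner {N : ℕ} (p : NicePair N) (t : p.Path) :
    TensorPow N →ₗ[ℂ] TensorPow (N + 2) :=
  ofCoordMap t.coordOp

theorem isPathSystem_pathIntertwiner (N : ℕ) : IsPathSystem (pathIntertwiner (N := N)) where
  equivariant p t := isEquivariant_ofCoordMap pathOp_mem_equivariantMaps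
  real p t := isRealMap_ofCoordMap star_pathOp
  isometric p t x hx y hy := by
    rw [tensorInner_eq, tensorInner_eq, pathIntertwiner, coord_ofCoordMap, coord_ofCoordMap]
    exact pathOp_dotProduct p.two_mul_rowLen_le (by ring) t.content_mul t.content_pos
      (NicePair.mem_component_lam.1 hx) (NicePair.mem_component_lam.1 hy)
  vanish p t q hq x hx := by
    refine (coord (N + 2)).injective ?_
    rw [pathIntertwiner, coord_ofCoordMap, map_zero]
    exact pathOp_apply_of_ne q.two_mul_rowLen_le
      (fun h => hq (NicePair.eq_of_rowLen_one_eq h).symm) (NicePair.mem_component_lam.1 hx)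
  mem_mu p t x hx := by
    rw [NicePair.mem_component_mu, pathIntertwiner, coord_ofCoordMap]
    exact pathOp_mem_isoComp_univ p.two_mul_rowLen_le (NicePair.mem_component_lam.1 hx)
  mem_path p t x hx := by
    rw [t.mem_componentFirst, pathIntertwiner, coord_ofCoordMap]
    exact pathOp_mem_isoComp_firstSet p.two_mul_rowLen_le (by ring) t.content_mul
      t.swapEigen_rowLen (NicePair.mem_component_lam.1 hx)

/-! ### Orthogonality of components -/

section

variable {N : ℕ}

theorem tensorInner_eq_zero_of_mem_lam {p q : NicePair N} (hpq : p ≠ q) {x y : TensorPow N}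
    (hx : x ∈ component N p.lam) (hy : y ∈ component N q.lam) : tensorInner x y = 0 := by
  rw [tensorInner_eq]
  refine dotProduct_eq_zero_of_swapSum (mem_isoComp_univ.1 (NicePair.mem_component_lam.1 hx))
    (mem_isoComp_univ.1 (NicePair.mem_component_lam.1 hy)) fun h => hpq ?_
  exact NicePair.eq_of_rowLen_one_eq
    (swapEigen_injective p.two_mul_rowLen_le q.two_mul_rowLen_le h)

theorem tensorInner_eq_zero_of_mem_mu {p q : NicePair N} (hpq : p ≠ q) {x y : TensorPow (N + 2)}
    (hx : x ∈ component (N + 2) p.mu) (hy : y ∈ component (N + 2) q.mu) : tensorInner x y = 0 := by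
  rw [tensorInner_eq]
  refine dotProduct_eq_zero_of_swapSum (mem_isoComp_univ.1 (NicePair.mem_component_mu.1 hx))
    (mem_isoComp_univ.1 (NicePair.mem_component_mu.1 hy)) fun h => hpq ?_
  have hp := p.two_mul_rowLen_le
  have hq := q.two_mul_rowLen_le
  have := swapEigen_injective (by omega) (by omega) h
  exact NicePair.eq_of_rowLen_one_eq (by omega)

theorem tensorInner_eq_zero_of_mem_path {p : NicePair N} {s t : p.Path} (hst : s ≠ t)
    {x y : TensorPow (N + 2)} (hx : x ∈ componentFirst (N + 1) (N + 2) s.1)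
    (hy : y ∈ componentFirst (N + 1) (N + 2) t.1) : tensorInner x y = 0 := by
  have hcard : (firstSet (N + 1) (N + 2)).card = N + 1 := card_firstSet (Nat.le_succ (N + 1))
  rw [tensorInner_eq]
  refine dotProduct_eq_zero_of_swapSum (mem_isoComp.1 (s.mem_componentFirst.1 hx))
    (mem_isoComp.1 (t.mem_componentFirst.1 hy)) fun h => hst ?_
  have h1 := s.rowLen_add
  have h2 := t.rowLen_add
  have h3 := s.1.rowLen_anti 0 1 zero_le_one
  have h4 := t.1.rowLen_anti 0 1 zero_le_one
  have h5 := swapEigen_injective (by omega) (by omega) h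
  exact Subtype.ext (eq_of_rowLen_eq s.colLen_le t.colLen_le (by omega) h5)

theorem exists_mem_component_lam (p : NicePair N) :
    ∃ x ∈ component N p.lam, tensorInner x x ≠ 0 := by
  obtain ⟨x, hx0, hx⟩ := exists_ne_zero_mem_isoComp _ N p.two_mul_rowLen_le
  refine ⟨(coord N).symm x, ?_, ?_⟩
  · rw [NicePair.mem_component_lam, LinearEquiv.apply_symm_apply]
    exact hx
  · rw [tensorInner_eq, LinearEquiv.apply_symm_apply]
    exact fun h => hx0 (eq_zero_of_star_dotProduct_self h)

/-- An additive property that holds on all the components holds everywhere, because the components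
span the tensor power. -/
theorem component_induction {P : TensorPow N → Prop}
    (hmem : ∀ (p : NicePair N), ∀ x ∈ component N p.lam, P x) (hzero : P 0)
    (hadd : ∀ x y, P x → P y → P (x + y)) (x : TensorPow N) : P x := by
  have hx : coord N x ∈
      ⨆ q : {q : ℕ // 2 * q ≤ (Finset.univ : Finset (Fin N)).card}, isoComp Finset.univ q.1 := by
    rw [iSup_subtype, iSup_isoComp]
    exact Submodule.mem_top
  have key : ∀ y ∈ ⨆ q : {q : ℕ // 2 * q ≤ (Finset.univ : Finset (Fin N)).card},
      isoComp (Finset.univ : Finset (Fin N)) q.1, P ((coord N).symm y) := by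
    intro y hy
    induction hy using Submodule.iSup_induction' with
    | mem q y hy =>
      have hq : 2 * q.1 ≤ N := by simpa using q.2
      obtain ⟨p, hp⟩ := NicePair.exists_rowLen_one_eq hq
      refine hmem p _ ?_
      rw [NicePair.mem_component_lam, LinearEquiv.apply_symm_apply, hp]
      exact hy
    | zero => rwa [map_zero]
    | add y z _ _ hy hz =>
      rw [map_add]
      exact hadd _ _ hy hz
  have := key _ hx
  rwa [LinearEquiv.symm_apply_apply] at this

/-! ### Maps defined by families of vectors of the multiplicity spaces -/

variable {E : ∀ p : NicePair N, p.Path → (TensorPow N →ₗ[ℂ] TensorPow (N + 2))}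

theorem tensorInner_sum_smul_right {M : ℕ} {α : Type} (s : Finset α) (c : α → ℂ) (x : TensorPow M)
    (y : α → TensorPow M) :
    tensorInner x (∑ a ∈ s, c a • y a) = ∑ a ∈ s, c a * tensorInner x (y a) := by
  simp only [tensorInner_eq, map_sum, map_smul, dotProduct_sum, dotProduct_smul, smul_eq_mul]

theorem tensorInner_sum_smul_left {M : ℕ} {α : Type} (s : Finset α) (c : α → ℂ) (y : TensorPow M)
    (x : α → TensorPow M) :
    tensorInner (∑ a ∈ s, c a • x a) y = ∑ a ∈ s, star (c a) * tensorInner (x a) y := by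
  simp only [tensorInner_eq, map_sum, map_smul, star_sum, star_smul, sum_dotProduct,
    smul_dotProduct, smul_eq_mul]

theorem pathMap_apply_of_mem (hE : IsPathSystem E) (h : ∀ p : NicePair N, p.MultSpace)
    (p : NicePair N) {x : TensorPow N} (hx : x ∈ component N p.lam) :
    pathMap E h x = ∑ t, h p t • E p t x := by
  rw [pathMap, LinearMap.sum_apply, Finset.sum_eq_single p]
  · simp only [LinearMap.sum_apply, LinearMap.smul_apply]
  · intro q _ hq
    simp only [LinearMap.sum_apply, LinearMap.smul_apply]
    refine Finset.sum_eq_zero fun t _ => ?_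
    rw [hE.vanish q t p hq.symm x hx, smul_zero]
  · simp

theorem tensorInner_pathMap_right (hE : IsPathSystem E) (h : ∀ p : NicePair N, p.MultSpace)
    (p : NicePair N) (t : p.Path) {x y : TensorPow N} (hx : x ∈ component N p.lam)
    (hy : y ∈ component N p.lam) :
    tensorInner (E p t x) (pathMap E h y) = h p t * tensorInner x y := by
  rw [pathMap_apply_of_mem hE h p hy, tensorInner_sum_smul_right, Finset.sum_eq_single t]
  · rw [hE.isometric p t x hx y hy]
  · intro s _ hs
    rw [tensorInner_eq_zero_of_mem_path hs.symm (hE.mem_path p t x hx) (hE.mem_path p s y hy),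
      mul_zero]
  · simp

theorem tensorInner_pathMap (hE : IsPathSystem E) (h : ∀ p : NicePair N, p.MultSpace)
    (p : NicePair N) {x y : TensorPow N} (hx : x ∈ component N p.lam)
    (hy : y ∈ component N p.lam) :
    tensorInner (pathMap E h x) (pathMap E h y) = ((‖h p‖ ^ 2 : ℝ) : ℂ) * tensorInner x y := by
  rw [pathMap_apply_of_mem hE h p hx, tensorInner_sum_smul_left,
    Finset.sum_congr rfl fun t _ => by rw [tensorInner_pathMap_right hE h p t hx hy],
    EuclideanSpace.norm_sq_eq, Complex.ofReal_sum, Finset.sum_mul]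
  refine Finset.sum_congr rfl fun t _ => ?_
  rw [← mul_assoc, Complex.star_def, Complex.conj_mul', Complex.ofReal_pow]

theorem pathMap_injective (hE : IsPathSystem E) : Function.Injective (pathMap E) := by
  intro h h' heq
  funext p
  ext t
  obtain ⟨x, hx, hx0⟩ := exists_mem_component_lam p
  have h1 := tensorInner_pathMap_right hE h p t hx hx
  rw [heq, tensorInner_pathMap_right hE h' p t hx hx] at h1
  exact (mul_right_cancel₀ hx0 h1).symm

theorem isEquivariant_pathMap (hE : IsPathSystem E) (h : ∀ p : NicePair N, p.MultSpace) :
    IsEquivariant (pathMap E h) := by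
  constructor
  · intro σ x
    simp only [pathMap, LinearMap.sum_apply, LinearMap.smul_apply, map_sum, map_smul,
      (hE.equivariant _ _).1 σ x]
  · intro g x
    simp only [pathMap, LinearMap.sum_apply, LinearMap.smul_apply, map_sum, map_smul,
      (hE.equivariant _ _).2 g x]

/-- Every equivariant map is of the form `pathMap E h`, by comparison of dimensions. -/
theorem exists_pathMap_eq (hE : IsPathSystem E) {f : TensorPow N →ₗ[ℂ] TensorPow (N + 2)}
    (hf : IsEquivariant f) : ∃ h, pathMap E h = f := by
  let fam : ((Σ p : NicePair N, p.Path) → ℂ) → ∀ p : NicePair N, p.MultSpace :=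
    fun c p => WithLp.toLp 2 fun t => c ⟨p, t⟩
  obtain ⟨Ψ, hΨ⟩ : ∃ Ψ : ((Σ p : NicePair N, p.Path) → ℂ) →ₗ[ℂ]
      (Coord (Fin N) →ₗ[ℂ] Coord (Fin (N + 2))), ∀ c, Ψ c = coordMap (pathMap E (fam c)) :=
    ⟨{  toFun := fun c => coordMap (pathMap E (fam c))
        map_add' := fun c d => by
          refine LinearMap.ext fun x => ?_
          simp [coordMap, pathMap, fam, add_smul, Finset.sum_add_distrib]
        map_smul' := fun a c => by
          refine LinearMap.ext fun x => ?_
          simp [coordMap, pathMap, fam, mul_smul, Finset.smul_sum] }, fun _ => rfl⟩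
  have hcoord : ∀ f g : TensorPow N →ₗ[ℂ] TensorPow (N + 2), coordMap f = coordMap g → f = g := by
    intro f g hfg
    refine LinearMap.ext fun x => (coord (N + 2)).injective ?_
    rw [← coordMap_coord, ← coordMap_coord, hfg]
  have hinj : Function.Injective Ψ := by
    intro c d hcd
    rw [hΨ, hΨ] at hcd
    have h1 := pathMap_injective hE (hcoord _ _ hcd)
    funext ⟨p, t⟩
    exact congrArg (fun v : p.MultSpace => v t) (congrFun h1 p)
  have hle : LinearMap.range Ψ ≤ equivariantMaps N := by
    rintro _ ⟨c, rfl⟩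
    rw [hΨ]
    exact coordMap_mem_equivariantMaps (isEquivariant_pathMap hE _)
  have hrange : LinearMap.range Ψ = equivariantMaps N := by
    refine Submodule.eq_of_le_of_finrank_le hle ((finrank_equivariantMaps_le N).trans ?_)
    rw [LinearMap.finrank_range_of_inj hinj, Module.finrank_fintype_fun_eq_card,
      NicePair.card_sigma_path]
  have hfmem : coordMap f ∈ LinearMap.range Ψ := by
    rw [hrange]
    exact coordMap_mem_equivariantMaps hf
  obtain ⟨c, hc⟩ := hfmem
  rw [hΨ] at hc
  exact ⟨fam c, hcoord _ _ hc⟩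

/-- The map given by a family of vectors is isometric if and only if these are unit vectors. -/
theorem isSchurWeylEmbedding_pathMap_iff (hE : IsPathSystem E)
    (h : ∀ p : NicePair N, p.MultSpace) :
    IsSchurWeylEmbedding (pathMap E h) ↔ ∀ p, ‖h p‖ = 1 := by
  constructor
  · intro hf p
    obtain ⟨x, hx, hx0⟩ := exists_mem_component_lam p
    have h1 := tensorInner_pathMap hE h p hx hx
    rw [hf.1] at h1
    have h2 : ((‖h p‖ ^ 2 : ℝ) : ℂ) = 1 :=
      mul_right_cancel₀ hx0 (by rw [← h1, one_mul])
    have h3 : ‖h p‖ ^ 2 = 1 := by exact_mod_cast h2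
    exact (pow_eq_one_iff_of_nonneg (norm_nonneg _) two_ne_zero).1 h3
  · intro hh
    have hadd_right : ∀ {M : ℕ} (x y z : TensorPow M),
        tensorInner x (y + z) = tensorInner x y + tensorInner x z := by
      intro M x y z
      simp only [tensorInner_eq, map_add, dotProduct_add]
    have hadd_left : ∀ {M : ℕ} (x y z : TensorPow M),
        tensorInner (x + y) z = tensorInner x z + tensorInner y z := by
      intro M x y z
      simp only [tensorInner_eq, map_add, star_add, add_dotProduct]
    refine ⟨fun x y => ?_, isEquivariant_pathMap hE h⟩
    induction x using component_induction with
    | hzero => simp [tensorInner_eq]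
    | hadd x x' hx hx' => rw [map_add, hadd_left, hadd_left, hx, hx']
    | hmem p x hx =>
      induction y using component_induction with
      | hzero => simp [tensorInner_eq]
      | hadd y y' hy hy' => rw [map_add, hadd_right, hadd_right, hy, hy']
      | hmem q y hy =>
        by_cases hpq : p = q
        · subst hpq
          rw [tensorInner_pathMap hE h p hx hy, hh p]
          simp
        · rw [tensorInner_eq_zero_of_mem_lam hpq hx hy]
          have hmem : ∀ (p : NicePair N) (x : TensorPow N), x ∈ component N p.lam →
              pathMap E h x ∈ component (N + 2) p.mu := by
            intro p x hx
            rw [pathMap_apply_of_mem hE h p hx]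
            exact Submodule.sum_mem _ fun t _ => Submodule.smul_mem _ _ (hE.mem_mu p t x hx)
          exact tensorInner_eq_zero_of_mem_mu hpq (hmem p x hx) (hmem q y hy)

/-- The map given by a family of vectors is real if and only if these have real coordinates. -/
theorem isRealMap_pathMap_iff (hE : IsPathSystem E) (h : ∀ p : NicePair N, p.MultSpace) :
    IsRealMap (pathMap E h) ↔ ∀ p t, (h p t).im = 0 := by
  have hentry : ∀ (h : ∀ p : NicePair N, p.MultSpace) i j,
      (stdBasis (N + 2)).repr (pathMap E h (stdBasis N j)) i =
        ∑ p, ∑ t, h p t * (stdBasis (N + 2)).repr (E p t (stdBasis N j)) i := by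
    intro h i j
    simp [pathMap, LinearMap.sum_apply, Finsupp.finsetSum_apply]
  constructor
  · intro hf p t
    let h' : ∀ p : NicePair N, p.MultSpace := fun p => WithLp.toLp 2 fun t => star (h p t)
    have heq : pathMap E h' = pathMap E h := by
      refine (stdBasis N).ext fun j => (stdBasis (N + 2)).repr.injective (Finsupp.ext fun i => ?_)
      have h1 := Complex.conj_eq_iff_im.2 (hf i j)
      rw [hentry, map_sum] at h1
      rw [hentry, hentry, ← h1]
      refine Finset.sum_congr rfl fun p _ => ?_
      rw [map_sum]
      refine Finset.sum_congr rfl fun t _ => ?_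
      rw [map_mul, Complex.conj_eq_iff_im.2 (hE.real p t i j)]
      rfl
    have h2 := congrFun (pathMap_injective hE heq) p
    exact Complex.conj_eq_iff_im.1 (congrArg (fun v : p.MultSpace => v t) h2)
  · intro hh i j
    rw [hentry, Complex.im_sum]
    refine Finset.sum_eq_zero fun p _ => ?_
    rw [Complex.im_sum]
    refine Finset.sum_eq_zero fun t _ => ?_
    rw [Complex.mul_im, hh, hE.real p t i j]
    ring

theorem bijOn_pathMap (hE : IsPathSystem E) :
    Set.BijOn (pathMap E) {h | ∀ p, ‖h p‖ = 1} {f | IsSchurWeylEmbedding f} := by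
  refine ⟨fun h hh => (isSchurWeylEmbedding_pathMap_iff hE h).2 hh,
    (pathMap_injective hE).injOn, fun f hf => ?_⟩
  obtain ⟨h, rfl⟩ := exists_pathMap_eq hE hf.2
  exact ⟨h, (isSchurWeylEmbedding_pathMap_iff hE h).1 hf, rfl⟩

theorem bijOn_pathMap_real (hE : IsPathSystem E) :
    Set.BijOn (pathMap E) {h | (∀ p, ‖h p‖ = 1) ∧ ∀ p t, (h p t).im = 0}
      {f | IsSchurWeylEmbedding f ∧ IsRealMap f} := by
  refine ⟨fun h hh => ⟨(isSchurWeylEmbedding_pathMap_iff hE h).2 hh.1,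
    (isRealMap_pathMap_iff hE h).2 hh.2⟩, (pathMap_injective hE).injOn, fun f hf => ?_⟩
  obtain ⟨h, rfl⟩ := exists_pathMap_eq hE hf.1.2
  exact ⟨h, ⟨(isSchurWeylEmbedding_pathMap_iff hE h).1 hf.1,
    (isRealMap_pathMap_iff hE h).1 hf.2⟩, rfl⟩

end

/-! ### Real unit vectors and points of circles -/

section

variable {N n : ℕ} {e : Fin n ≃ {p : NicePair N // ¬ p.IsExceptional}}

theorem circleFamily_of_isExceptional (z : Fin n → Circle) (s : ℤˣ) {p : NicePair N}
    (hp : p.IsExceptional) (t : p.Path) : circleFamily e z s p t = ((s : ℤ) : ℂ) := by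
  simp [circleFamily, hp]

theorem circleFamily_of_isT21 (z : Fin n → Circle) (s : ℤˣ) (j : Fin n) {t : (e j).1.Path}
    (ht : t.IsT21) : circleFamily e z s (e j).1 t = (((z j : ℂ).re : ℝ) : ℂ) := by
  simp [circleFamily, (e j).2, ht]

theorem circleFamily_of_not_isT21 (z : Fin n → Circle) (s : ℤˣ) (j : Fin n) {t : (e j).1.Path}
    (ht : ¬ t.IsT21) : circleFamily e z s (e j).1 t = (((z j : ℂ).im : ℝ) : ℂ) := by
  simp [circleFamily, (e j).2, ht]

theorem eq_or_exists_eq (e : Fin n ≃ {p : NicePair N // ¬ p.IsExceptional}) (p : NicePair N) :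
    p.IsExceptional ∨ ∃ j, p = (e j).1 := by
  by_cases hp : p.IsExceptional
  · exact Or.inl hp
  · exact Or.inr ⟨e.symm ⟨p, hp⟩, by simp⟩

theorem norm_eq_one_iff_of_isExceptional {p : NicePair N} (hp : p.IsExceptional) (v : p.MultSpace)
    (t : p.Path) : ‖v‖ = 1 ↔ ‖v t‖ ^ 2 = 1 := by
  rw [← NicePair.Path.sum_of_isExceptional hp (fun t => ‖v t‖ ^ 2) t, ← EuclideanSpace.norm_sq_eq,
    pow_eq_one_iff_of_nonneg (norm_nonneg _) two_ne_zero]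

theorem norm_eq_one_iff_of_isT21 {p : NicePair N} (v : p.MultSpace) {s t : p.Path}
    (hs : s.IsT21) (ht : ¬ t.IsT21) : ‖v‖ = 1 ↔ ‖v s‖ ^ 2 + ‖v t‖ ^ 2 = 1 := by
  rw [← NicePair.Path.sum_of_isT21 (fun t => ‖v t‖ ^ 2) hs ht, ← EuclideanSpace.norm_sq_eq,
    pow_eq_one_iff_of_nonneg (norm_nonneg _) two_ne_zero]

theorem circleFamily_mem (z : Fin n → Circle) (s : ℤˣ) :
    circleFamily e z s ∈
      {h : ∀ p : NicePair N, p.MultSpace | (∀ p, ‖h p‖ = 1) ∧ ∀ p t, (h p t).im = 0} := by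
  constructor
  · intro p
    obtain ⟨t, ht⟩ := NicePair.Path.exists_not_isT21 p
    rcases eq_or_exists_eq e p with hp | ⟨j, rfl⟩
    · rw [norm_eq_one_iff_of_isExceptional hp _ t, circleFamily_of_isExceptional z s hp]
      rcases Int.units_eq_one_or s with rfl | rfl <;> simp
    · obtain ⟨t', ht'⟩ := NicePair.Path.exists_isT21 (e j).2
      rw [norm_eq_one_iff_of_isT21 _ ht' ht, circleFamily_of_isT21 z s j ht',
        circleFamily_of_not_isT21 z s j ht, Complex.norm_real, Complex.norm_real,
        Real.norm_eq_abs, Real.norm_eq_abs, sq_abs, sq_abs]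
      have := Circle.normSq_coe (z j)
      rw [Complex.normSq_apply] at this
      linarith
  · intro p t
    rcases eq_or_exists_eq e p with hp | ⟨j, rfl⟩
    · rw [circleFamily_of_isExceptional z s hp]
      simp
    · by_cases ht : t.IsT21
      · rw [circleFamily_of_isT21 z s j ht, Complex.ofReal_im]
      · rw [circleFamily_of_not_isT21 z s j ht, Complex.ofReal_im]

theorem circleFamily_injective_left {z z' : Fin n → Circle} {s s' : ℤˣ}
    (h : circleFamily e z s = circleFamily e z' s') : z = z' := by
  funext j
  obtain ⟨t, ht⟩ := NicePair.Path.exists_not_isT21 (e j).1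
  obtain ⟨t', ht'⟩ := NicePair.Path.exists_isT21 (e j).2
  have h1 := congrFun h (e j).1
  have hre := congrArg (fun v : (e j).1.MultSpace => v t') h1
  have him := congrArg (fun v : (e j).1.MultSpace => v t) h1
  simp only [circleFamily_of_isT21 _ _ j ht', Complex.ofReal_inj] at hre
  simp only [circleFamily_of_not_isT21 _ _ j ht, Complex.ofReal_inj] at him
  exact Circle.ext (Complex.ext hre him)

theorem circleFamily_injective_right {z z' : Fin n → Circle} {s s' : ℤˣ}
    (h : circleFamily e z s = circleFamily e z' s') {p : NicePair N} (hp : p.IsExceptional) :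
    s = s' := by
  obtain ⟨t, -⟩ := NicePair.Path.exists_not_isT21 p
  have h1 := congrArg (fun v : p.MultSpace => v t) (congrFun h p)
  simp only [circleFamily_of_isExceptional _ _ hp] at h1
  exact Units.ext (by exact_mod_cast h1)

theorem exists_circleFamily_eq {h : ∀ p : NicePair N, p.MultSpace} (hnorm : ∀ p, ‖h p‖ = 1)
    (hreal : ∀ p t, (h p t).im = 0) : ∃ z s, circleFamily e z s = h := by
  have hre : ∀ p t, h p t = (((h p t).re : ℝ) : ℂ) := fun p t =>
    Complex.ext rfl (by rw [hreal, Complex.ofReal_im])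
  have hsq : ∀ p t, ‖h p t‖ ^ 2 = (h p t).re ^ 2 := by
    intro p t
    rw [hre p t, Complex.norm_real, Complex.ofReal_re, Real.norm_eq_abs, sq_abs]
  have hz : ∀ j, ∃ z : Circle, (∀ t : (e j).1.Path, t.IsT21 → h (e j).1 t = ((z : ℂ).re : ℂ)) ∧
      ∀ t : (e j).1.Path, ¬ t.IsT21 → h (e j).1 t = ((z : ℂ).im : ℂ) := by
    intro j
    obtain ⟨t, ht⟩ := NicePair.Path.exists_not_isT21 (e j).1
    obtain ⟨t', ht'⟩ := NicePair.Path.exists_isT21 (e j).2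
    have h1 := (norm_eq_one_iff_of_isT21 _ ht' ht).1 (hnorm (e j).1)
    rw [hsq, hsq] at h1
    refine ⟨⟨⟨(h (e j).1 t').re, (h (e j).1 t).re⟩, ?_⟩, fun r hr => ?_, fun r hr => ?_⟩
    · refine mem_sphere_zero_iff_norm.2
        ((pow_eq_one_iff_of_nonneg (norm_nonneg _) two_ne_zero).1 ?_)
      rw [Complex.sq_norm, Complex.normSq_mk, ← h1]
      ring
    · rw [NicePair.Path.eq_of_isT21_iff (iff_of_true hr ht')]
      exact hre _ _
    · rw [NicePair.Path.eq_of_isT21_iff (iff_of_false hr ht)]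
      exact hre _ _
  choose z hz1 hz2 using hz
  have hs : ∃ s : ℤˣ, ∀ p : NicePair N, p.IsExceptional → ∀ t : p.Path,
      h p t = ((s : ℤ) : ℂ) := by
    by_cases hex : ∃ p : NicePair N, p.IsExceptional
    · obtain ⟨p, hp⟩ := hex
      obtain ⟨t, ht⟩ := NicePair.Path.exists_not_isT21 p
      have h1 := (norm_eq_one_iff_of_isExceptional hp _ t).1 (hnorm p)
      rw [hsq] at h1
      have huniq : ∀ (p' : NicePair N), p'.IsExceptional → ∀ t' : p'.Path, h p' t' = h p t := by
        intro p' hp' t'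
        obtain rfl : p' = p := NicePair.eq_of_rowLen_one_eq (by
          have h2 := p'.isExceptional_iff.1 hp'
          have h3 := p.isExceptional_iff.1 hp
          omega)
        rw [NicePair.Path.eq_of_isT21_iff (s := t') (t := t)
          (iff_of_false (NicePair.Path.not_isT21 hp t') ht)]
      rcases sq_eq_one_iff.1 h1 with h2 | h2
      · exact ⟨1, fun p' hp' t' => by rw [huniq p' hp' t', hre, h2]; simp⟩
      · exact ⟨-1, fun p' hp' t' => by rw [huniq p' hp' t', hre, h2]; simp⟩
    · exact ⟨1, fun p hp => absurd ⟨p, hp⟩ hex⟩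
  obtain ⟨s, hs⟩ := hs
  refine ⟨z, s, funext fun p => ?_⟩
  ext t
  rcases eq_or_exists_eq e p with hp | ⟨j, rfl⟩
  · rw [circleFamily_of_isExceptional z s hp, hs p hp t]
  · by_cases ht : t.IsT21
    · rw [circleFamily_of_isT21 z s j ht, hz1 j t ht]
    · rw [circleFamily_of_not_isT21 z s j ht, hz2 j t ht]

end

end SchurWeyl

open Classical in
theorem mainTheorem5 (N n : ℕ) (hN : N + 1 = 2 * n ∨ N = 2 * n) :
    -- dimensions of the multiplicity spaces, and the number of exceptional pairs
    (∀ p : SchurWeyl.NicePair N,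
      Module.finrank ℂ p.MultSpace = if p.IsExceptional then 1 else 2) ∧
    Nat.card {p : SchurWeyl.NicePair N // p.IsExceptional} = (if Even N then 1 else 0) ∧
    -- the non-exceptional pairs are those with `lam = (N - n + k, n - k)`, `k = 1, ..., n`
    ∃ e : Fin n ≃ {p : SchurWeyl.NicePair N // ¬ p.IsExceptional},
      (∀ j, (e j).1.lam.rowLen 1 + (j + 1) = n) ∧
      ∃ E : ∀ p : SchurWeyl.NicePair N,
          p.Path → (SchurWeyl.TensorPow N →ₗ[ℂ] SchurWeyl.TensorPow (N + 2)),
        SchurWeyl.IsPathSystem E ∧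
        -- all Schur--Weyl embeddings: families of unit vectors of the multiplicity spaces
        Set.BijOn (SchurWeyl.pathMap E)
          {h : ∀ p : SchurWeyl.NicePair N, p.MultSpace | ∀ p, ‖h p‖ = 1}
          {f | SchurWeyl.IsSchurWeylEmbedding f} ∧
        -- real Schur--Weyl embeddings, `N = 2n - 1`: points of the torus `(𝕋¹)ⁿ`
        (N + 1 = 2 * n →
          Set.BijOn
            (fun z : Fin n → Circle => SchurWeyl.pathMap E (SchurWeyl.circleFamily e z 1))
            Set.univ {f | SchurWeyl.IsSchurWeylEmbedding f ∧ SchurWeyl.IsRealMap f}) ∧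
        -- real Schur--Weyl embeddings, `N = 2n`: points of the torus `(𝕋¹)ⁿ` and a sign
        (N = 2 * n →
          Set.BijOn
            (fun w : (Fin n → Circle) × ℤˣ =>
              SchurWeyl.pathMap E (SchurWeyl.circleFamily e w.1 w.2))
            Set.univ {f | SchurWeyl.IsSchurWeylEmbedding f ∧ SchurWeyl.IsRealMap f}) := by
  refine ⟨fun p => ?_, SchurWeyl.NicePair.card_isExceptional N, ?_⟩
  · rw [finrank_euclideanSpace, SchurWeyl.NicePair.card_path]
  obtain ⟨e, he⟩ := SchurWeyl.NicePair.exists_equiv hN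
  have hE := SchurWeyl.isPathSystem_pathIntertwiner N
  refine ⟨e, he, SchurWeyl.pathIntertwiner, hE, SchurWeyl.bijOn_pathMap hE, fun hodd => ?_,
    fun heven => ?_⟩
  · refine (SchurWeyl.bijOn_pathMap_real hE).comp (f := fun z => SchurWeyl.circleFamily e z 1)
      ⟨fun z _ => SchurWeyl.circleFamily_mem z 1,
        fun z _ z' _ h => SchurWeyl.circleFamily_injective_left h, fun h hh => ?_⟩
    obtain ⟨z, s, rfl⟩ := SchurWeyl.exists_circleFamily_eq (e := e) hh.1 hh.2
    -- without exceptional pairs the sign plays no role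
    refine ⟨z, Set.mem_univ _, funext fun p => ?_⟩
    have hp : ¬ p.IsExceptional := fun hp => by
      have := p.isExceptional_iff.1 hp
      omega
    ext t
    simp [SchurWeyl.circleFamily, hp]
  · obtain ⟨p, hp⟩ := SchurWeyl.NicePair.exists_rowLen_one_eq (N := N) (q := n) (by omega)
    have hp' : p.IsExceptional := p.isExceptional_iff.2 (by omega)
    refine (SchurWeyl.bijOn_pathMap_real hE).comp
      (f := fun w : (Fin n → Circle) × ℤˣ => SchurWeyl.circleFamily e w.1 w.2)
      ⟨fun w _ => SchurWeyl.circleFamily_mem w.1 w.2,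
        fun w _ w' _ h => Prod.ext (SchurWeyl.circleFamily_injective_left h)
          (SchurWeyl.circleFamily_injective_right h hp'), fun h hh => ?_⟩
    obtain ⟨z, s, rfl⟩ := SchurWeyl.exists_circleFamily_eq (e := e) hh.1 hh.2
    exact ⟨(z, s), Set.mem_univ _, rfl⟩
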